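/- Let $\Gamma<\mathrm{PSL}_2(\mathbb C)$ be a quasi-Fuchsian group, i.e. a discrete subgroup acting freely on $\mathbb H^3$ whose limit set $\Lambda_\Gamma\subset\partial_\infty\mathbb H^3$ is a quasi-circle; let $\Omega^+,\Omega^-$ be the two components of $\partial_\infty\mathbb H^3\setminus\Lambda_\Gamma$, and let $M=\mathbb H^3/\Gamma\cong\Sigma\times\mathbb R$, where $\Sigma$ is a closed connected surface. If $S\subset M$ is a closed embedded $C^2$ surface homotopic to $\Sigma\times\{*\}$, its lift $\widetilde S$ disconnects $\mathbb H^3$ into two components, one whose closure in $\mathbb H^3\cup\partial_\infty\mathbb H^3$ contains $\Omega^+$ and one whose closure contains $\Omega^-$; the unit normal $\nu$ of $S$ is the one pointing towards the former. The second fundamental form is $\mathrm{II}(v,w)=\langle-\nabla_v\nu,w\rangle$, the principal curvatures are its eigenvalues with respect to the first fundamental form, and the mean curvature is half their sum. The signed distance from $S$ of a point of $M$ is plus or minus its distance from $S$, positive on the side of $\Omega^-$ and negative on the side of $\Omega^+$. Let $S_H$ and $S_{H'}$ be closed embedded $C^2$ surfaces in $M$ homotopic to $\Sigma\times\{*\}$,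 with constant mean curvatures $H$ and $H'$ respectively, where $H\neq H'$. Suppose that $S_H$ has small principal curvatures, i.e. all its principal curvatures lie in $(-1,1)$. Then: 1. $S_H$ and $S_{H'}$ are disjoint. 2. There exist differentiable functions $f_-,f_+:\mathbb R\to\mathbb R$ with $f_\pm(0)=H$ and $f_\pm'(r)>0$ for all $r$ such that, for every $r\in\mathbb R$, the mean curvature of the equidistant surface $\{\exp_p(-r\nu(p)) : p\in S_H\}$, computed with respect to the unit normal $-\partial_r$, is everywhere between $f_-(r)$ and $f_+(r)$. 3. For every such pair $f_-,f_+$, the signed distance from $S_H$ of every point of $S_{H'}$ lies in the closed interval of $[-\infty,+\infty]$ with endpoints $f_+^{-1}(H')$ and $f_-^{-1}(H')$. Here $f_\pm^{-1}(H')$ is understood as $+\infty$ if $H'$ is greater than all values of $f_\pm$, and as $-\infty$ if $H'$ is smaller than all values of $f_\pm$. -/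

import Mathlib

open Filter Topology
open scoped ComplexOrder Matrix MatrixGroups Matrix.Norms.Frobenius

namespace QuasiFuchsian

/-- Complex `2 × 2` matrices. As a real normed space (Frobenius norm) this is the ambient space in
which hyperbolic space and its surfaces live. -/
abbrev Mat : Type := Matrix (Fin 2) (Fin 2) ℂ

/-- The coordinate plane in which surfaces are parametrized. -/
abbrev Plane : Type := EuclideanSpace ℝ (Fin 2)

/-! ### Hyperbolic space, its boundary at infinity, and the action of `PSL(2, ℂ)` -/

/-- Hyperbolic three-space: the hyperboloid `det X = 1` of positive definite matrices inside the
Minkowski space of Hermitian matrices with quadratic form `-det`. -/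
abbrev Hyp : Type := {X : Mat // X.PosDef ∧ X.det = 1}

/-- The Minkowski product on Hermitian matrices, the polarization of `-det`. -/
noncomputable def mink (X Y : Mat) : ℝ := -(X * Y.adjugate).trace.re / 2

/-- The hyperbolic distance: `cosh d(x, y) = -⟨x, y⟩`. -/
noncomputable def hdist (x y : Hyp) : ℝ := Real.arcosh (-mink x y)

/-- The Klein model: hyperbolic space as the interior of the ball of positive semidefinite matrices
of trace one. -/
noncomputable def klein (x : Hyp) : Mat := (x : Mat).trace⁻¹ • (x : Mat)

/-- The boundary at infinity `ℂP¹` of hyperbolic space, as the boundary of the Klein ball: a line in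
`ℂ²` is represented by the orthogonal projection onto it. The distance induced by the Frobenius norm
is (up to the factor `√2`) the chordal distance of the round unit sphere. -/
abbrev Ideal : Type := {P : Mat // P.PosSemidef ∧ P.trace = 1 ∧ P.det = 0}

theorem sl_smul_mem (A : SL(2, ℂ)) (x : Hyp) :
    ((A : Mat) * (x : Mat) * (A : Mat)ᴴ).PosDef ∧
      ((A : Mat) * (x : Mat) * (A : Mat)ᴴ).det = 1 := by
  refine ⟨x.2.1.mul_mul_conjTranspose_same ?_, ?_⟩
  · refine Matrix.vecMul_injective_of_isUnit ?_
    rw [Matrix.isUnit_iff_isUnit_det, A.det_coe]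
    exact isUnit_one
  · simp [Matrix.det_mul, Matrix.det_conjTranspose, x.2.2]

/-- `SL(2, ℂ)` acts on hyperbolic space by `A • X = A X A*`. -/
noncomputable instance slAction : MulAction SL(2, ℂ) Hyp where
  smul A x := ⟨(A : Mat) * (x : Mat) * (A : Mat)ᴴ, sl_smul_mem A x⟩
  one_smul x := Subtype.ext (by
    change ((1 : SL(2, ℂ)) : Mat) * (x : Mat) * ((1 : SL(2, ℂ)) : Mat)ᴴ = x
    simp)
  mul_smul A B x := Subtype.ext (by
    change ((A * B : SL(2, ℂ)) : Mat) * (x : Mat) * ((A * B : SL(2, ℂ)) : Mat)ᴴ =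
      (A : Mat) * ((B : Mat) * (x : Mat) * (B : Mat)ᴴ) * (A : Mat)ᴴ
    simp [Matrix.mul_assoc, Matrix.conjTranspose_mul])

theorem sl_smul_coe (A : SL(2, ℂ)) (x : Hyp) :
    ((A • x : Hyp) : Mat) = (A : Mat) * (x : Mat) * (A : Mat)ᴴ := rfl

theorem center_le_ker :
    Subgroup.center SL(2, ℂ) ≤ (MulAction.toPermHom SL(2, ℂ) Hyp).ker := by
  intro A hA
  rw [MonoidHom.mem_ker]
  obtain ⟨r, hr, hA⟩ := Matrix.SpecialLinearGroup.mem_center_iff.1 hA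
  have hn : r * star r = 1 := by
    have h2 : ‖r‖ ^ 2 = 1 := by
      have := congrArg norm hr
      simpa using this
    have : ((‖r‖ ^ 2 : ℝ) : ℂ) = 1 := by rw [h2]; simp
    rw [Complex.star_def, Complex.mul_conj']
    exact_mod_cast this
  ext1 x
  apply Subtype.ext
  change ((A • x : Hyp) : Mat) = x
  rw [sl_smul_coe, ← hA]
  ext i j
  have hn' : r * (starRingEnd ℂ) r = 1 := hn
  simp [Matrix.scalar_apply, Matrix.diagonal_conjTranspose]
  linear_combination ((x : Mat) i j) * hn'

/-- `PSL(2, ℂ)`, the group of orientation-preserving isometries of hyperbolic space, acts on it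
through the action of `SL(2, ℂ)`. -/
noncomputable def pslHom : PSL(2, ℂ) →* Equiv.Perm Hyp :=
  QuotientGroup.lift _ (MulAction.toPermHom SL(2, ℂ) Hyp) center_le_ker

noncomputable instance pslAction : MulAction PSL(2, ℂ) Hyp := MulAction.compHom _ pslHom

/-! ### Quasi-Fuchsian groups and manifolds -/

/-- The limit set: the accumulation points at infinity of the orbits. -/
def limitSet (Γ : Subgroup PSL(2, ℂ)) : Set Ideal :=
  {P | ∃ x : Hyp, (P : Mat) ∈ closure (klein '' MulAction.orbit Γ x)}

/-- Quasiconformal homeomorphisms of the sphere at infinity, in the metric sense: the linear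
dilatation `limsup_{r → 0} (max_{d(P,Q) ≤ r} d(f P, f Q)) / (min_{d(P,R) ≥ r} d(f P, f R))` is
bounded independently of `P`. -/
def IsQuasiconformal (f : Ideal ≃ₜ Ideal) : Prop :=
  ∃ K : ℝ, ∀ P : Ideal, ∀ᶠ r in 𝓝[>] (0 : ℝ), ∀ Q R : Ideal,
    dist P Q ≤ r → r ≤ dist P R → dist (f P) (f Q) ≤ K * dist (f P) (f R)

/-- The round circle `ℝP¹` inside `ℂP¹`. -/
def roundCircle : Set Ideal := {P | ((P : Mat) 0 1).im = 0}

/-- A quasi-circle is the image of a round circle under a quasiconformal homeomorphism. -/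
def IsQuasicircle (L : Set Ideal) : Prop :=
  ∃ f : Ideal ≃ₜ Ideal, IsQuasiconformal f ∧ L = f '' roundCircle

/-- Quasi-Fuchsian groups: discrete subgroups of `PSL(2, ℂ)` acting freely on hyperbolic space whose
limit set is a quasi-circle. -/
structure IsQuasiFuchsian (Γ : Subgroup PSL(2, ℂ)) : Prop where
  discrete : DiscreteTopology Γ
  free : ∀ γ ∈ Γ, ∀ x : Hyp, γ • x = x → γ = 1
  quasicircle : IsQuasicircle (limitSet Γ)

/-- The hyperbolic manifold `ℍ³ / Γ`, with the quotient topology. -/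
abbrev Mfd (Γ : Subgroup PSL(2, ℂ)) : Type := MulAction.orbitRel.Quotient Γ Hyp

/-- The covering projection. -/
noncomputable def proj (Γ : Subgroup PSL(2, ℂ)) (x : Hyp) : Mfd Γ := Quotient.mk _ x

/-- The full lift of a subset of `ℍ³ / Γ` to `ℍ³`. -/
noncomputable def lift {Γ : Subgroup PSL(2, ℂ)} (S : Set (Mfd Γ)) : Set Hyp := proj Γ ⁻¹' S

/-- The distance of `ℍ³ / Γ`. -/
noncomputable def mdist {Γ : Subgroup PSL(2, ℂ)} (p q : Mfd Γ) : ℝ :=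
  sInf {d | ∃ x y : Hyp, proj Γ x = p ∧ proj Γ y = q ∧ d = hdist x y}

/-- `A` and `B` are the two connected components of the complement of `C`. -/
structure AreTwoComponents {X : Type*} [TopologicalSpace X] (C A B : Set X) : Prop where
  open_left : IsOpen A
  open_right : IsOpen B
  connected_left : IsConnected A
  connected_right : IsConnected B
  disjoint : Disjoint A B
  union : A ∪ B = Cᶜ

/-! ### Surfaces in hyperbolic space -/

/-- `X` is a regular `C²` parametrization, centred at `0`, of a neighbourhood of `x` in the subset
`S` of hyperbolic space. The last field says that `X` maps small neighbourhoods of `0` onto small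
neighbourhoods of `x` in `S`. -/
structure IsLocalParam (S : Set Hyp) (x : Hyp) (X : Plane → Mat) : Prop where
  contDiffAt : ContDiffAt ℝ 2 X 0
  map_zero : X 0 = x
  immersion : Function.Injective (fderiv ℝ X 0)
  map_nhds : map X (𝓝 0) = 𝓝[Subtype.val '' S] (x : Mat)

/-- `S` is an embedded `C²` surface in hyperbolic space. -/
def IsEmbeddedSurface (S : Set Hyp) : Prop := ∀ x ∈ S, ∃ X, IsLocalParam S x X

/-- The first fundamental form, at the parameter `0`. -/
noncomputable def firstForm (X : Plane → Mat) (v w : Plane) : ℝ :=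
  mink (fderiv ℝ X 0 v) (fderiv ℝ X 0 w)

/-- The second fundamental form `⟨-∇ᵥ N, dX w⟩` with respect to the unit normal field `N` along `X`,
at the parameter `0`. -/
noncomputable def secondForm (X N : Plane → Mat) (v w : Plane) : ℝ :=
  -mink (fderiv ℝ N 0 v) (fderiv ℝ X 0 w)

/-- The mean curvature: half the trace of the second fundamental form with respect to the first. -/
noncomputable def meanCurvature (X N : Plane → Mat) : ℝ :=
  let e : Fin 2 → Plane := fun i => EuclideanSpace.single i 1
  (((Matrix.of fun i j => firstForm X (e i) (e j))⁻¹ *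
    Matrix.of fun i j => secondForm X N (e i) (e j)).trace) / 2

/-- `k` is a principal curvature: an eigenvalue of the second fundamental form with respect to the
first. -/
def IsPrincipalCurvature (X N : Plane → Mat) (k : ℝ) : Prop :=
  ∃ v : Plane, v ≠ 0 ∧ ∀ w : Plane, secondForm X N v w = k * firstForm X v w

/-- The point at signed distance `t` from `x` on the geodesic with unit initial velocity `v`. -/
noncomputable def geod (x v : Mat) (t : ℝ) : Mat := Real.cosh t • x + Real.sinh t • v

/-- `ν` is a (continuous) unit normal field along the embedded surface `S`. -/
structure IsUnitNormal (S : Set Hyp) (ν : Mat → Mat) : Prop where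
  continuousOn : ContinuousOn ν (Subtype.val '' S)
  hermitian : ∀ x ∈ S, (ν x).IsHermitian
  unit : ∀ x ∈ S, mink (ν x) (ν x) = 1
  tangent : ∀ x ∈ S, mink (ν x) x = 0
  normal : ∀ x ∈ S, ∀ X, IsLocalParam S x X → ∀ w, mink (ν x) (fderiv ℝ X 0 w) = 0

/-- The normal convention. The lift `S` of the surface disconnects hyperbolic space in two
components, `Up` on the side of `Ωp` and `Um` on the side of `Ωm`, and `ν` is the unit normal of `S`
pointing out of `Um` into `Up`, i.e. towards `Ωp`. -/
structure IsCooriented (Ωp Ωm : Set Ideal) (S Up Um : Set Hyp) (ν : Mat → Mat) : Prop where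
  components : AreTwoComponents S Up Um
  plus_side : Subtype.val '' Ωp ⊆ closure (klein '' Up)
  minus_side : Subtype.val '' Ωm ⊆ closure (klein '' Um)
  unitNormal : IsUnitNormal S ν
  points_plus : ∀ x ∈ S, ∀ᶠ t in 𝓝[>] (0 : ℝ), geod x (ν x) t ∈ Subtype.val '' Up
  points_minus : ∀ x ∈ S, ∀ᶠ t in 𝓝[>] (0 : ℝ), geod x (ν x) (-t) ∈ Subtype.val '' Um

/-- The surface `S` with unit normal `ν` has constant mean curvature `H`. -/
def HasConstMeanCurvature (S : Set Hyp) (ν : Mat → Mat) (H : ℝ) : Prop :=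
  ∀ x ∈ S, ∀ X, IsLocalParam S x X → meanCurvature X (ν ∘ X) = H

/-- The principal curvatures of `S` are all in `(-1, 1)`. -/
def HasSmallPrincipalCurvatures (S : Set Hyp) (ν : Mat → Mat) : Prop :=
  ∀ x ∈ S, ∀ X, IsLocalParam S x X → ∀ k, IsPrincipalCurvature X (ν ∘ X) k → k ∈ Set.Ioo (-1) 1

/-! ### Closed surfaces homotopic to the fiber, signed distance, equidistant surfaces -/

/-- `S` is a closed embedded surface in `ℍ³ / Γ ≅ F × ℝ` homotopic to `F × {*}`. -/
structure IsFiberSurface {Γ : Subgroup PSL(2, ℂ)} {F : Type*} [TopologicalSpace F]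
    (φ : F × ℝ ≃ₜ Mfd Γ) (S : Set (Mfd Γ)) : Prop where
  homotopic : ∃ ι : C(F, Mfd Γ), Function.Injective ι ∧ Set.range ι = S ∧
    ι.Homotopic ⟨fun x => φ (x, 0), by fun_prop⟩
  embedded : IsEmbeddedSurface (lift S)

open Classical in
/-- The signed distance from `S` in `ℍ³ / Γ`: negative on the side `Up` of `Ωp`, towards which the
normal points, and positive on the side of `Ωm`. -/
noncomputable def signedDist {Γ : Subgroup PSL(2, ℂ)} (S : Set (Mfd Γ)) (Up : Set Hyp)
    (q : Mfd Γ) : ℝ :=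
  if q ∈ proj Γ '' Up then -sInf (mdist q '' S) else sInf (mdist q '' S)

/-- The equidistant immersion `ζ(·, r)` at signed distance `r`, in the parametrization `X` of a
surface with normal `N`. -/
noncomputable def equidist (X N : Plane → Mat) (r : ℝ) : Plane → Mat :=
  fun u => geod (X u) (-N u) r

/-- The unit normal `-∂ζ/∂r` of the equidistant immersion, pointing towards `Ωp`. -/
noncomputable def equidistNormal (X N : Plane → Mat) (r : ℝ) : Plane → Mat :=
  fun u => Real.cosh r • N u - Real.sinh r • X u

/-- The functions `f₋`, `f₊`: differentiable, with value `H` at `0` and positive derivative, and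
such that for all `r` the mean curvature of the equidistant surface at signed distance `r` from the
surface `S` (with normal `ν`, of constant mean curvature `H`) is between `f₋ r` and `f₊ r`. -/
structure AreCurvatureBounds (S : Set Hyp) (ν : Mat → Mat) (H : ℝ) (fm fp : ℝ → ℝ) : Prop where
  differentiable_minus : Differentiable ℝ fm
  differentiable_plus : Differentiable ℝ fp
  zero_minus : fm 0 = H
  zero_plus : fp 0 = H
  deriv_minus : ∀ r, 0 < deriv fm r
  deriv_plus : ∀ r, 0 < deriv fp r
  between : ∀ r : ℝ, ∀ x ∈ S, ∀ X, IsLocalParam S x X →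
    meanCurvature (equidist X (ν ∘ X) r) (equidistNormal X (ν ∘ X) r) ∈ Set.uIcc (fm r) (fp r)

/-- The inverse of an increasing continuous function `f : ℝ → ℝ`, as an extended real number: it is
`f⁻¹ y` if `y` is in the range of `f`, `+∞` if `y` is above it and `-∞` if `y` is below it. -/
noncomputable def extInv (f : ℝ → ℝ) (y : ℝ) : EReal :=
  sSup ((fun r : ℝ => (r : EReal)) '' {r : ℝ | f r ≤ y})

end QuasiFuchsian

/-! Everything happens on the hyperboloid, after lifting both surfaces. For a point `y`, the
critical points of cosh d(y, ·) on the lift of S_H are the feet of the perpendiculars from `y`. If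
the perpendicular has signed length t, the Hessian there is cosh t · I + sinh t · II, which is
positive definite since the principal curvatures lie in (-1, 1) and |sinh t| < cosh t. So every
critical point is a strict local minimum, and a mountain pass argument (`eq_of_strict_min`) leaves
room for only one (`foot_unique`). Hence the normal exponential map is a homeomorphism from S × ℝ
onto hyperbolic space (`collar`), and the signed distance `Sides.sd` is defined everywhere. Two
global facts enter. The lift is connected, because it is the common frontier of the two connected
pieces of its complement and simply connected spaces are unicoherent. The signed distance is
Γ-invariant, because a deck transformation exchanging the sides would leave a quotient with a single
end, whereas F × ℝ has two (`Sides.not_swap`).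

At signed distance r a principal curvature k becomes (k cosh r + sinh r) / (cosh r + k sinh r), that
is tanh (a + r) if k = tanh a. So the mean curvature of the equidistant surfaces (`curvFun`) is
strictly increasing in r. For fixed H it depends on the point only through the product K of the
principal curvatures, monotonically in K with a direction given by the sign of r. The umbilic value
K = H² and a uniform lower bound for K, obtained by compactness, give the two bounding functions.

By compactness the signed distance from S_H has a maximum r₁ and a minimum r₀ on the lift of S_{H'}.
At such a point S_{H'} is tangent to an equidistant surface of S_H. The unit normals agree rather
than being opposite, because both point towards the same component of the domain of discontinuity
(`Sides.normal_ne_of_max`, `Sides.normal_ne_of_min`). The second order comparison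
(`Sides.exists_mc_comparison`) then gives `curvFun` ≤ H' at r₁ and H' ≤ `curvFun` at r₀, each with
the K of the corresponding foot. If the surfaces met, then r₀ ≤ 0 ≤ r₁ and monotonicity would give H
≤ H' ≤ H. In general, inserting bounding functions and inverting them confines r₀ and r₁, hence the
whole range of the distance. -/

namespace QuasiFuchsian

/-! ### Minkowski space in real coordinates -/

/-- Real coordinates on Hermitian matrices: the diagonal entries, and the real and imaginary part of
the upper right entry. -/
abbrev R4 : Type := Fin 4 → ℝ

/-- The Minkowski product in real coordinates. -/
noncomputable def eta (v w : R4) : ℝ := v 2 * w 2 + v 3 * w 3 - (v 0 * w 1 + v 1 * w 0) / 2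

theorem eta_comm (v w : R4) : eta v w = eta w v := by simp only [eta]; ring

theorem eta_add_left (u v w : R4) : eta (u + v) w = eta u w + eta v w := by simp [eta]; ring

theorem eta_smul_left (a : ℝ) (v w : R4) : eta (a • v) w = a * eta v w := by simp [eta]; ring

theorem eta_add_right (w u v : R4) : eta w (u + v) = eta w u + eta w v := by simp [eta]; ring

theorem eta_smul_right (a : ℝ) (w v : R4) : eta w (a • v) = a * eta w v := by simp [eta]; ring

theorem eta_neg_left (v w : R4) : eta (-v) w = -eta v w := by simp [eta]; ring

theorem eta_neg_right (v w : R4) : eta v (-w) = -eta v w := by simp [eta]; ring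

theorem eta_sub_left (u v w : R4) : eta (u - v) w = eta u w - eta v w := by simp [eta]; ring

theorem eta_sub_right (w u v : R4) : eta w (u - v) = eta w u - eta w v := by simp [eta]; ring

theorem eta_zero_left (w : R4) : eta 0 w = 0 := by simp [eta]

theorem eta_zero_right (w : R4) : eta w 0 = 0 := by simp [eta]

/-- The Minkowski product as a continuous bilinear map. -/
noncomputable def etaL : R4 →L[ℝ] R4 →L[ℝ] ℝ :=
  LinearMap.toContinuousLinearMap
    ((LinearMap.toContinuousLinearMap : (R4 →ₗ[ℝ] ℝ) ≃ₗ[ℝ] (R4 →L[ℝ] ℝ)).toLinearMap ∘ₗ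
      LinearMap.mk₂ ℝ eta eta_add_left eta_smul_left eta_add_right eta_smul_right)

@[simp] theorem etaL_apply (v w : R4) : etaL v w = eta v w := rfl

theorem continuous_eta : Continuous fun p : R4 × R4 => eta p.1 p.2 := by
  simp only [eta]; fun_prop

/-- Hyperbolic space in real coordinates. -/
def Hyp4 : Set R4 := {v | 0 < v 0 ∧ v 0 * v 1 = 1 + v 2 ^ 2 + v 3 ^ 2}

theorem pos_of_mem_hyp4 {x : R4} (hx : x ∈ Hyp4) : 0 < x 0 ∧ 0 < x 1 := by
  obtain ⟨h1, h2⟩ := hx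
  refine ⟨h1, ?_⟩
  by_contra h
  push Not at h
  have := mul_nonpos_of_nonneg_of_nonpos h1.le h
  nlinarith [sq_nonneg (x 2), sq_nonneg (x 3)]

theorem eta_self_hyp4 {x : R4} (hx : x ∈ Hyp4) : eta x x = -1 := by
  have := hx.2
  simp only [eta]; linarith

/-- Reversed Cauchy–Schwarz: the Minkowski product of two points is minus the hyperbolic cosine of
their distance. -/
theorem one_le_neg_eta {x y : R4} (hx : x ∈ Hyp4) (hy : y ∈ Hyp4) : 1 ≤ -eta x y := by
  obtain ⟨h1, h2⟩ := pos_of_mem_hyp4 hx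
  obtain ⟨k1, k2⟩ := pos_of_mem_hyp4 hy
  have h3 := hx.2
  have k3 := hy.2
  simp only [eta]
  have h : (2 * (1 + x 2 * y 2 + x 3 * y 3)) ^ 2 ≤ (x 0 * y 1 + x 1 * y 0) ^ 2 := by
    have e : (x 0 * y 1 + x 1 * y 0) ^ 2 = (x 0 * y 1 - x 1 * y 0) ^ 2 +
        4 * (1 + x 2 ^ 2 + x 3 ^ 2) * (1 + y 2 ^ 2 + y 3 ^ 2) := by
      rw [← h3, ← k3]; ring
    rw [e]
    nlinarith [sq_nonneg (x 0 * y 1 - x 1 * y 0), sq_nonneg (x 2 - y 2), sq_nonneg (x 3 - y 3),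
      sq_nonneg (x 2 * y 3 - x 3 * y 2)]
  have := le_of_abs_le (abs_le_of_sq_le_sq h (by positivity))
  linarith

/-- Bounded distance from `y` bounds the trace of `x`. This is the source of all the compactness
below: closed balls lie in `isCompact_bounded`. -/
theorem add_le_mul_neg_eta {x y : R4} (hx : x ∈ Hyp4) (hy : y ∈ Hyp4) :
    x 0 + x 1 ≤ 2 * (y 0 + y 1) * -eta x y := by
  obtain ⟨h1, h2⟩ := pos_of_mem_hyp4 hx
  obtain ⟨k1, k2⟩ := pos_of_mem_hyp4 hy
  have h3 := hx.2
  have k3 := hy.2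
  have hD : -eta x y = (x 0 * y 1 + x 1 * y 0) / 2 - (x 2 * y 2 + x 3 * y 3) := by
    simp only [eta]; ring
  generalize -eta x y = D at *
  have h1' : x 0 ≤ 2 * y 0 * D := by
    have e : x 0 * (2 * y 0 * D) =
        x 0 * x 0 + y 0 ^ 2 + (x 0 * y 2 - y 0 * x 2) ^ 2 + (x 0 * y 3 - y 0 * x 3) ^ 2 := by
      rw [hD]; linear_combination x 0 ^ 2 * k3 + y 0 ^ 2 * h3
    exact le_of_mul_le_mul_left (by rw [e]; nlinarith) h1
  have h2' : x 1 ≤ 2 * y 1 * D := by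
    have e : x 1 * (2 * y 1 * D) =
        x 1 * x 1 + y 1 ^ 2 + (x 1 * y 2 - y 1 * x 2) ^ 2 + (x 1 * y 3 - y 1 * x 3) ^ 2 := by
      rw [hD]; linear_combination x 1 ^ 2 * k3 + y 1 ^ 2 * h3
    exact le_of_mul_le_mul_left (by rw [e]; nlinarith) h2
  linarith

/-- Vectors orthogonal to a point of hyperbolic space are spacelike. -/
theorem eta_self_tangent {v x : R4} (hx : x ∈ Hyp4) (h : eta v x = 0) :
    0 ≤ eta v v ∧ (eta v v = 0 → v = 0) := by
  obtain ⟨h1, h2⟩ := pos_of_mem_hyp4 hx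
  have h3 := hx.2
  simp only [eta] at *
  have hz : v 0 = 0 ∧ v 1 = 0 ∧ v 2 = 0 ∧ v 3 = 0 → v = 0 := by
    rintro ⟨e0, e1, e2, e3⟩
    funext i
    fin_cases i <;> assumption
  generalize x 0 = a at *
  generalize x 1 = b at *
  generalize x 2 = c at *
  generalize x 3 = d at *
  generalize v 0 = a' at *
  generalize v 1 = b' at *
  generalize v 2 = c' at *
  generalize v 3 = d' at *
  have hab : 0 < a * b := mul_pos h1 h2
  -- Orthogonality and Cauchy–Schwarz bound (a'b + b'a)² by 4 (c² + d²)(c'² + d'²), where c² + d² =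
  -- ab - 1; on the other hand it is at least 4 aba'b'.
  have key : c' ^ 2 + d' ^ 2 ≤ a * b * (c' ^ 2 + d' ^ 2 - a' * b') := by
    have e1 : a' * b + b' * a = 2 * (c' * c + d' * d) := by linarith
    have e2 : (a' * b + b' * a) ^ 2 ≤ 4 * (c ^ 2 + d ^ 2) * (c' ^ 2 + d' ^ 2) := by
      rw [e1]; nlinarith [sq_nonneg (c' * d - d' * c)]
    have e3 : c ^ 2 + d ^ 2 = a * b - 1 := by linarith
    rw [e3] at e2
    nlinarith [sq_nonneg (a' * b - b' * a)]
  refine ⟨?_, fun h0 => hz ?_⟩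
  · have : 0 ≤ c' ^ 2 + d' ^ 2 - a' * b' := by
      by_contra hn
      push Not at hn
      have := mul_neg_of_pos_of_neg hab hn
      nlinarith [sq_nonneg c', sq_nonneg d']
    nlinarith
  · have e0 : c' ^ 2 + d' ^ 2 - a' * b' = 0 := by nlinarith
    rw [e0, mul_zero] at key
    have hc : c' = 0 := by nlinarith [sq_nonneg c', sq_nonneg d']
    have hd : d' = 0 := by nlinarith [sq_nonneg c', sq_nonneg d']
    subst hc hd
    have e4 : a' * b' = 0 := by linarith
    have e5 : a' * b + b' * a = 0 := by linarith
    rcases mul_eq_zero.1 e4 with e | e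
    · subst e
      have : b' * a = 0 := by linarith
      exact ⟨rfl, (mul_eq_zero.1 this).resolve_right h1.ne', rfl, rfl⟩
    · subst e
      have : a' * b = 0 := by linarith
      exact ⟨(mul_eq_zero.1 this).resolve_right h2.ne', rfl, rfl, rfl⟩

theorem eta_self_pos {v x : R4} (hx : x ∈ Hyp4) (h : eta v x = 0) (h0 : v ≠ 0) :
    0 < eta v v :=
  lt_of_le_of_ne (eta_self_tangent hx h).1 fun e => h0 ((eta_self_tangent hx h).2 e.symm)

/-- The sign of the product with one point of the upper sheet distinguishes the two sheets: `-y`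
would violate `one_le_neg_eta`. -/
theorem mem_hyp4 {x y : R4} (h1 : eta y y = -1) (hx : x ∈ Hyp4) (h : eta y x < 0) : y ∈ Hyp4 := by
  have hd : y 0 * y 1 = 1 + y 2 ^ 2 + y 3 ^ 2 := by simp only [eta] at h1; linarith
  refine ⟨?_, hd⟩
  by_contra hn
  have hne : y 0 ≠ 0 := by
    intro h0
    rw [h0, zero_mul] at hd
    nlinarith [sq_nonneg (y 2), sq_nonneg (y 3)]
  have hm : -y ∈ Hyp4 := by
    refine ⟨?_, by simpa using hd⟩
    simpa using lt_of_le_of_ne (not_lt.1 hn) hne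
  have := one_le_neg_eta hm hx
  rw [eta_neg_left] at this
  linarith

/-- The point at signed distance `t` from `x` on the geodesic with initial velocity `-n`. -/
noncomputable def zeta (x n : R4) (t : ℝ) : R4 := Real.cosh t • x - Real.sinh t • n

theorem zeta_mem {x n : R4} (hx : x ∈ Hyp4) (h : eta n x = 0) (h1 : eta n n = 1) (t : ℝ) :
    zeta x n t ∈ Hyp4 := by
  have hxx := eta_self_hyp4 hx
  refine mem_hyp4 ?_ hx ?_
  · simp only [zeta, eta_sub_left, eta_sub_right, eta_smul_left, eta_smul_right, hxx, h, h1,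
      eta_comm x n]
    nlinarith [Real.cosh_sq t]
  · simp only [zeta, eta_sub_left, eta_smul_left, hxx, h]
    linarith [Real.cosh_pos t]

/-- Otherwise `y` would be spacelike and `x, e, f, n, y` would be five independent vectors in a
space of dimension four. -/
theorem eq_zero_of_orthogonal {x e f n y : R4} (hx : x ∈ Hyp4)
    (hex : eta e x = 0) (hfx : eta f x = 0) (hnx : eta n x = 0) (hYx : eta y x = 0)
    (hne : eta n e = 0) (hnf : eta n f = 0) (hYe : eta y e = 0) (hYf : eta y f = 0)
    (hYn : eta y n = 0) (hn0 : n ≠ 0)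
    (hef : ∀ a b : ℝ, a • e + b • f = 0 → a = 0 ∧ b = 0) : y = 0 := by
  by_contra hY0
  have hYY := eta_self_pos hx hYx hY0
  have hnn := eta_self_pos hx hnx hn0
  have hxx := eta_self_hyp4 hx
  have hli : LinearIndependent ℝ (![x, e, f, n, y] : Fin 5 → R4) := by
    rw [Fintype.linearIndependent_iff]
    intro g h0
    simp only [Fin.sum_univ_five] at h0
    simp only [Matrix.cons_val] at h0
    have hY' : g 4 = 0 := by
      have := congrArg (eta y) h0
      simp only [eta_add_right, eta_smul_right, hYx, hYe, hYf, hYn, eta_zero_right] at this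
      have : g 4 * eta y y = 0 := by linarith
      exact (mul_eq_zero.1 this).resolve_right hYY.ne'
    have hn' : g 3 = 0 := by
      have := congrArg (eta n) h0
      simp only [eta_add_right, eta_smul_right, hnx, hne, hnf, eta_comm n y, hYn,
        eta_zero_right] at this
      have : g 3 * eta n n = 0 := by linarith
      exact (mul_eq_zero.1 this).resolve_right hnn.ne'
    have hx' : g 0 = 0 := by
      have := congrArg (eta x) h0
      simp only [eta_add_right, eta_smul_right, eta_comm x n, eta_comm x y,
        eta_comm x e, eta_comm x f, hnx, hex, hfx, hYx, hxx, eta_zero_right] at this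
      linarith
    rw [hY', hn', hx'] at h0
    simp only [zero_smul, zero_add, add_zero] at h0
    obtain ⟨h1, h2⟩ := hef _ _ h0
    intro i
    fin_cases i <;> assumption
  have := hli.fintype_card_le_finrank
  simp at this

/-- The triple product in Minkowski space. -/
noncomputable def cross (a b c : R4) : R4 :=
  ![2 * (a 0 * (b 2 * c 3 - b 3 * c 2) - a 2 * (b 0 * c 3 - b 3 * c 0)
      + a 3 * (b 0 * c 2 - b 2 * c 0)),
    -(2 * (a 1 * (b 2 * c 3 - b 3 * c 2) - a 2 * (b 1 * c 3 - b 3 * c 1)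
      + a 3 * (b 1 * c 2 - b 2 * c 1))),
    a 0 * (b 1 * c 3 - b 3 * c 1) - a 1 * (b 0 * c 3 - b 3 * c 0)
      + a 3 * (b 0 * c 1 - b 1 * c 0),
    -(a 0 * (b 1 * c 2 - b 2 * c 1) - a 1 * (b 0 * c 2 - b 2 * c 0)
      + a 2 * (b 0 * c 1 - b 1 * c 0))]

theorem cross_orthogonal (a b c : R4) :
    eta (cross a b c) a = 0 ∧ eta (cross a b c) b = 0 ∧ eta (cross a b c) c = 0 := by
  simp only [eta, cross, Matrix.cons_val]
  refine ⟨?_, ?_, ?_⟩ <;> ring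

/-- Minus four times the Gram determinant. For a point `x` and two tangent vectors it becomes four
times their Gram determinant, so the cross product is a nonvanishing normal that depends smoothly on
its arguments. -/
theorem eta_cross_self (a b c : R4) : eta (cross a b c) (cross a b c) =
    -4 * (eta a a * (eta b b * eta c c - eta b c ^ 2)
      - eta a b * (eta a b * eta c c - eta b c * eta a c)
      + eta a c * (eta a b * eta b c - eta b b * eta a c)) := by
  simp only [eta, cross, Matrix.cons_val]
  ring

theorem gram_pos {x e f : R4} (hx : x ∈ Hyp4) (hex : eta e x = 0) (hfx : eta f x = 0)
    (hef : ∀ a b : ℝ, a • e + b • f = 0 → a = 0 ∧ b = 0) :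
    0 < eta e e ∧ 0 < eta f f ∧ 0 < eta e e * eta f f - eta e f ^ 2 := by
  have he : e ≠ 0 := by
    rintro rfl
    have := hef 1 0 (by simp)
    simp at this
  have hf : f ≠ 0 := by
    rintro rfl
    have := hef 0 1 (by simp)
    simp at this
  have h1 := eta_self_pos hx hex he
  have h2 := eta_self_pos hx hfx hf
  refine ⟨h1, h2, ?_⟩
  have hg : eta e e • f - eta e f • e ≠ 0 := by
    intro h
    have := hef (-eta e f) (eta e e) (by rw [← h]; module)
    linarith [this.2]
  have h3 := eta_self_pos hx (v := eta e e • f - eta e f • e)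
    (by simp [eta_sub_left, eta_smul_left, hex, hfx]) hg
  simp only [eta_sub_left, eta_smul_left, eta_sub_right, eta_smul_right, eta_comm f e] at h3
  refine pos_of_mul_pos_right (a := eta e e) ?_ h1.le
  nlinarith

theorem eq_smul_normal {x e f n y : R4} (hx : x ∈ Hyp4)
    (hex : eta e x = 0) (hfx : eta f x = 0) (hnx : eta n x = 0) (hYx : eta y x = 0)
    (hne : eta n e = 0) (hnf : eta n f = 0) (hYe : eta y e = 0) (hYf : eta y f = 0)
    (hnn : eta n n = 1)
    (hef : ∀ a b : ℝ, a • e + b • f = 0 → a = 0 ∧ b = 0) : y = eta y n • n := by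
  rw [← sub_eq_zero]
  have hn0 : n ≠ 0 := by rintro rfl; simp [eta_zero_left] at hnn
  apply eq_zero_of_orthogonal hx hex hfx hnx _ hne hnf _ _ _ hn0 hef <;>
    simp [eta_sub_left, eta_smul_left, *]

theorem mem_span_tangent {x e f n y : R4} (hx : x ∈ Hyp4)
    (hex : eta e x = 0) (hfx : eta f x = 0) (hnx : eta n x = 0) (hYx : eta y x = 0)
    (hne : eta n e = 0) (hnf : eta n f = 0) (hyn : eta y n = 0) (hn0 : n ≠ 0)
    (hef : ∀ a b : ℝ, a • e + b • f = 0 → a = 0 ∧ b = 0) : ∃ a b : ℝ, y = a • e + b • f := by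
  obtain ⟨h1, h2, h3⟩ := gram_pos hx hex hfx hef
  set D := eta e e * eta f f - eta e f ^ 2 with hD
  refine ⟨(eta f f * eta y e - eta e f * eta y f) / D,
    (eta e e * eta y f - eta e f * eta y e) / D, ?_⟩
  rw [← sub_eq_zero]
  apply eq_zero_of_orthogonal hx hex hfx hnx _ hne hnf _ _ _ hn0 hef
  · simp [eta_sub_left, eta_add_left, eta_smul_left, hYx, hex, hfx]
  · simp only [eta_sub_left, eta_add_left, eta_smul_left, eta_comm f e]
    field_simp
    rw [hD]; ring
  · simp only [eta_sub_left, eta_add_left, eta_smul_left]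
    field_simp
    rw [hD]; ring
  · simp [eta_sub_left, eta_add_left, eta_smul_left, hyn, eta_comm e n, eta_comm f n, hne, hnf]

/-! ### Hermitian matrices in coordinates -/

theorem isHermitian_iff (Y : Mat) :
    Y.IsHermitian ↔ (Y 0 0).im = 0 ∧ (Y 1 1).im = 0 ∧ (Y 1 0).re = (Y 0 1).re ∧
      (Y 1 0).im = -(Y 0 1).im := by
  rw [Matrix.IsHermitian.ext_iff]
  simp only [Fin.forall_fin_two, Complex.ext_iff, Complex.star_def, Complex.conj_re,
    Complex.conj_im]
  constructor
  · rintro ⟨⟨⟨_, h1⟩, h2, h3⟩, ⟨h4, h5⟩, _, h6⟩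
    refine ⟨by linarith, by linarith, by linarith, by linarith⟩
  · rintro ⟨h1, h2, h3, h4⟩
    refine ⟨⟨⟨trivial, by linarith⟩, by linarith, by linarith⟩, ⟨by linarith, by linarith⟩,
      trivial, by linarith⟩

/-- Real coordinates of Hermitian matrices. -/
noncomputable def ofMat (Y : Mat) : R4 := ![(Y 0 0).re, (Y 1 1).re, (Y 0 1).re, (Y 0 1).im]

/-- The Hermitian matrix with given real coordinates. -/
noncomputable def toMat (v : R4) : Mat := !![(v 0 : ℂ), ⟨v 2, v 3⟩; ⟨v 2, -v 3⟩, (v 1 : ℂ)]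

theorem ofMat_toMat (v : R4) : ofMat (toMat v) = v := by
  funext i
  fin_cases i <;> simp [ofMat, toMat]

theorem toMat_herm (v : R4) : (toMat v).IsHermitian := by
  rw [isHermitian_iff]; simp [toMat]

theorem toMat_ofMat {Y : Mat} (hY : Y.IsHermitian) : toMat (ofMat Y) = Y := by
  have := (isHermitian_iff Y).1 hY
  ext i j
  fin_cases i <;> fin_cases j <;> apply Complex.ext <;> simp [toMat, ofMat, this]

theorem mink_eq (X Y : Mat) :
    mink X Y = -(X 0 0 * Y 1 1 + X 1 1 * Y 0 0 - X 0 1 * Y 1 0 - X 1 0 * Y 0 1).re / 2 := by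
  simp only [mink, Matrix.trace_fin_two, Matrix.mul_apply, Fin.sum_univ_two,
    Matrix.adjugate_fin_two]
  simp
  ring

theorem mink_toMat (v w : R4) : mink (toMat v) (toMat w) = eta v w := by
  rw [mink_eq]
  simp [toMat, eta]
  ring

theorem mink_ofMat {X Y : Mat} (hX : X.IsHermitian) (hY : Y.IsHermitian) :
    mink X Y = eta (ofMat X) (ofMat Y) := by
  rw [← mink_toMat, toMat_ofMat hX, toMat_ofMat hY]

theorem toMat_add (v w : R4) : toMat (v + w) = toMat v + toMat w := by
  ext i j
  fin_cases i <;> fin_cases j <;> apply Complex.ext <;> simp [toMat]; ring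

theorem toMat_smul (a : ℝ) (v : R4) : toMat (a • v) = a • toMat v := by
  ext i j
  fin_cases i <;> fin_cases j <;> apply Complex.ext <;> simp [toMat]

theorem toMat_neg (v : R4) : toMat (-v) = -toMat v := by
  ext i j
  fin_cases i <;> fin_cases j <;> apply Complex.ext <;> simp [toMat]

theorem toMat_sub (v w : R4) : toMat (v - w) = toMat v - toMat w := by
  rw [sub_eq_add_neg, sub_eq_add_neg, toMat_add, toMat_neg]

theorem toMat_injective : Function.Injective toMat := fun v w h => by
  rw [← ofMat_toMat v, h, ofMat_toMat]

theorem continuous_toMat : Continuous toMat := by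
  refine continuous_matrix fun i j => ?_
  have h1 : Continuous fun v : R4 => (⟨v 2, v 3⟩ : ℂ) := by
    have : (fun v : R4 => (⟨v 2, v 3⟩ : ℂ)) = fun v => (v 2 : ℂ) + (v 3 : ℂ) * Complex.I := by
      funext v; exact Complex.mk_eq_add_mul_I _ _
    rw [this]; fun_prop
  have h2 : Continuous fun v : R4 => (⟨v 2, -v 3⟩ : ℂ) := by
    have : (fun v : R4 => (⟨v 2, -v 3⟩ : ℂ)) = fun v => (v 2 : ℂ) + ((-v 3 : ℝ) : ℂ) * Complex.I := by
      funext v; exact Complex.mk_eq_add_mul_I _ _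
    rw [this]; fun_prop
  fin_cases i <;> fin_cases j
  · simp [toMat]; fun_prop
  · simpa [toMat] using h1
  · simpa [toMat] using h2
  · simp [toMat]; fun_prop

theorem continuous_ofMat : Continuous ofMat := by
  refine continuous_pi fun i => ?_
  fin_cases i <;> simp [ofMat] <;> fun_prop

theorem posDef_iff (Y : Mat) : Y.PosDef ∧ Y.det = 1 ↔ Y.IsHermitian ∧ ofMat Y ∈ Hyp4 := by
  have det_herm : Y.IsHermitian →
      Y.det = (((Y 0 0).re * (Y 1 1).re - (Y 0 1).re ^ 2 - (Y 0 1).im ^ 2 : ℝ) : ℂ) := by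
    intro hX
    rw [isHermitian_iff] at hX
    rw [Matrix.det_fin_two, Complex.ext_iff, Complex.ofReal_re, Complex.ofReal_im]
    simp only [Complex.sub_re, Complex.mul_re, Complex.sub_im, Complex.mul_im, hX]
    constructor <;> ring
  simp only [Hyp4, ofMat, Set.mem_ofPred_eq, Matrix.cons_val]
  constructor
  · rintro ⟨h, hd⟩
    refine ⟨h.isHermitian, (Complex.pos_iff.1 (h.diag_pos (i := 0))).1, ?_⟩
    rw [det_herm h.isHermitian] at hd
    have : (Y 0 0).re * (Y 1 1).re - (Y 0 1).re ^ 2 - (Y 0 1).im ^ 2 = 1 := by exact_mod_cast hd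
    linarith
  · rintro ⟨h, h0, hd⟩
    refine ⟨Matrix.PosDef.of_dotProduct_mulVec_pos h fun x hx => ?_, ?_⟩
    · rw [isHermitian_iff] at h
      obtain ⟨h1, h2, h3, h4⟩ := h
      rw [Complex.pos_iff]
      simp only [dotProduct, Matrix.mulVec, Fin.sum_univ_two, Pi.star_apply]
      simp only [Complex.star_def, Complex.add_re, Complex.mul_re, Complex.conj_re,
        Complex.conj_im, Complex.add_im, Complex.mul_im, h1, h2, h3, h4]
      refine ⟨?_, by ring⟩
      have hx' : ¬ ((x 0).re = 0 ∧ (x 0).im = 0 ∧ (x 1).re = 0 ∧ (x 1).im = 0) := by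
        rintro ⟨h1, h2, h3, h4⟩
        apply hx
        funext i
        fin_cases i
        · exact Complex.ext h1 h2
        · exact Complex.ext h3 h4
      generalize (x 0).re = p at *
      generalize (x 0).im = q at *
      generalize (x 1).re = r at *
      generalize (x 1).im = s at *
      generalize (Y 0 0).re = a at *
      generalize (Y 1 1).re = b at *
      generalize (Y 0 1).re = c at *
      generalize (Y 0 1).im = d at *
      refine pos_of_mul_pos_right (a := a) ?_ h0.le
      -- Completing the square, with determinant 1.
      have key : a * (a * (p ^ 2 + q ^ 2) + b * (r ^ 2 + s ^ 2) +
          2 * (p * (c * r - d * s) + q * (c * s + d * r))) =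
          (a * p + (c * r - d * s)) ^ 2 + (a * q + (c * s + d * r)) ^ 2 + (r ^ 2 + s ^ 2) := by
        linear_combination (r ^ 2 + s ^ 2) * hd
      have : 0 < (a * p + (c * r - d * s)) ^ 2 + (a * q + (c * s + d * r)) ^ 2 +
          (r ^ 2 + s ^ 2) := by
        by_cases hrs : r ^ 2 + s ^ 2 = 0
        · have hr : r = 0 := by nlinarith [sq_nonneg r, sq_nonneg s]
          have hs : s = 0 := by nlinarith [sq_nonneg r, sq_nonneg s]
          subst hr hs
          have : 0 < p ^ 2 + q ^ 2 := by
            apply lt_of_le_of_ne (by positivity)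
            intro h
            exact hx' ⟨by nlinarith [sq_nonneg p, sq_nonneg q],
              by nlinarith [sq_nonneg p, sq_nonneg q], rfl, rfl⟩
          have : 0 < a ^ 2 * (p ^ 2 + q ^ 2) := by positivity
          nlinarith
        · have : 0 < r ^ 2 + s ^ 2 := lt_of_le_of_ne (by positivity) (Ne.symm hrs)
          positivity
      rw [← key] at this
      refine this.trans_eq ?_
      ring
    · rw [det_herm h, hd]; push_cast; ring

/-- The real coordinates of a point of hyperbolic space. -/
noncomputable def coe4 (x : Hyp) : R4 := ofMat x

theorem hyp_herm (x : Hyp) : (x : Mat).IsHermitian := x.2.1.isHermitian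

theorem toMat_coe4 (x : Hyp) : toMat (coe4 x) = x := toMat_ofMat (hyp_herm x)

theorem coe4_mem (x : Hyp) : coe4 x ∈ Hyp4 := ((posDef_iff _).1 x.2).2

/-- The point of hyperbolic space with given coordinates. -/
noncomputable def ofHyp4 (v : R4) (hv : v ∈ Hyp4) : Hyp :=
  ⟨toMat v, (posDef_iff _).2 ⟨toMat_herm v, by rwa [ofMat_toMat]⟩⟩

theorem coe4_ofHyp4 (v : R4) (hv : v ∈ Hyp4) : coe4 (ofHyp4 v hv) = v := ofMat_toMat v

theorem coe4_injective : Function.Injective coe4 := fun x y h =>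
  Subtype.ext (by rw [← toMat_coe4 x, h, toMat_coe4])

theorem continuous_coe4 : Continuous coe4 := continuous_ofMat.comp continuous_subtype_val

theorem range_coe4 : Set.range coe4 = Hyp4 := by
  ext v
  exact ⟨by rintro ⟨x, rfl⟩; exact coe4_mem x, fun hv => ⟨_, coe4_ofHyp4 v hv⟩⟩

theorem isClosed_hyp4 : IsClosed Hyp4 := by
  have : Hyp4 = {v : R4 | 0 ≤ v 0} ∩ {v | v 0 * v 1 = 1 + v 2 ^ 2 + v 3 ^ 2} := by
    ext v
    refine ⟨fun h => ⟨h.1.le, h.2⟩, fun h => ⟨lt_of_le_of_ne h.1 fun e => ?_, h.2⟩⟩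
    have h2 : v 0 * v 1 = 1 + v 2 ^ 2 + v 3 ^ 2 := h.2
    rw [← e, zero_mul] at h2
    nlinarith [sq_nonneg (v 2), sq_nonneg (v 3)]
  rw [this]
  exact (isClosed_le (by fun_prop) (by fun_prop)).inter (isClosed_eq (by fun_prop) (by fun_prop))

theorem isEmbedding_coe4 : Topology.IsEmbedding coe4 := by
  have h1 : Topology.IsEmbedding (fun x : Hyp => toMat (coe4 x)) := by
    have : (fun x : Hyp => toMat (coe4 x)) = Subtype.val := by
      funext x; exact toMat_coe4 x
    rw [this]
    exact Topology.IsEmbedding.subtypeVal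
  exact Topology.IsEmbedding.of_comp continuous_coe4 continuous_toMat h1

theorem isClosedEmbedding_coe4 : Topology.IsClosedEmbedding coe4 :=
  ⟨isEmbedding_coe4, by rw [range_coe4]; exact isClosed_hyp4⟩

theorem mink_coe4 (x y : Hyp) : mink x y = eta (coe4 x) (coe4 y) :=
  mink_ofMat (hyp_herm x) (hyp_herm y)

theorem hdist_eq (x y : Hyp) : hdist x y = Real.arcosh (-eta (coe4 x) (coe4 y)) := by
  rw [hdist, mink_coe4]

/-- The sets of bounded trace are compact. -/
theorem isCompact_bounded (R : ℝ) : IsCompact {v : R4 | v ∈ Hyp4 ∧ v 0 + v 1 ≤ R} := by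
  refine Metric.isCompact_of_isClosed_isBounded
    (isClosed_hyp4.inter (isClosed_le (f := fun v : R4 => v 0 + v 1) (g := fun _ => R)
      (by fun_prop) (by fun_prop))) ?_
  refine (Metric.isBounded_closedBall (x := (0 : R4)) (r := R)).subset ?_
  rintro v ⟨hv, hR⟩
  obtain ⟨h0, h1⟩ := pos_of_mem_hyp4 hv
  have h2 := hv.2
  have hR0 : 0 ≤ R := by linarith
  rw [mem_closedBall_zero_iff, pi_norm_le_iff_of_nonneg hR0]
  intro i
  rw [Real.norm_eq_abs]
  fin_cases i
  · rw [abs_le]; constructor <;> simp <;> linarith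
  · rw [abs_le]; constructor <;> simp <;> linarith
  · apply abs_le_of_sq_le_sq _ hR0; simp; nlinarith [sq_nonneg (v 3)]
  · apply abs_le_of_sq_le_sq _ hR0; simp; nlinarith [sq_nonneg (v 2)]

theorem mink_conj (A : SL(2, ℂ)) (X Y : Mat) :
    mink ((A : Mat) * X * (A : Mat)ᴴ) ((A : Mat) * Y * (A : Mat)ᴴ) = mink X Y := by
  have hA : (A : Mat).adjugate * (A : Mat) = 1 := by
    rw [Matrix.adjugate_mul, A.det_coe, one_smul]
  have hA' : (A : Mat)ᴴ * ((A : Mat)ᴴ).adjugate = 1 := by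
    rw [Matrix.mul_adjugate, Matrix.det_conjTranspose, A.det_coe, star_one, one_smul]
  unfold mink
  have : (A : Mat) * X * (A : Mat)ᴴ * ((A : Mat) * Y * (A : Mat)ᴴ).adjugate
      = (A : Mat) * (X * Y.adjugate) * (A : Mat).adjugate := by
    rw [Matrix.adjugate_mul_distrib, Matrix.adjugate_mul_distrib]
    calc _ = (A : Mat) * X * ((A : Mat)ᴴ * ((A : Mat)ᴴ).adjugate) *
          (Y.adjugate * (A : Mat).adjugate) := by simp only [Matrix.mul_assoc]
      _ = _ := by rw [hA']; simp [Matrix.mul_assoc]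
  rw [this, Matrix.trace_mul_comm, ← Matrix.mul_assoc, hA, one_mul]


/-! ### Parametrizations in real coordinates -/

/-- `X` is a regular `C²` parametrization, centred at `0`, of a neighbourhood of `x` in `T`. -/
structure LParam (T : Set R4) (x : R4) (X : Plane → R4) : Prop where
  contDiffAt : ContDiffAt ℝ 2 X 0
  map_zero : X 0 = x
  immersion : Function.Injective (fderiv ℝ X 0)
  map_nhds : map X (𝓝 0) = 𝓝[T] x

/-- `toMat` as a linear map. -/
noncomputable def toMatL : R4 →ₗ[ℝ] Mat where
  toFun := toMat
  map_add' := toMat_add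
  map_smul' := toMat_smul

/-- `ofMat` as a linear map. -/
noncomputable def ofMatL : Mat →ₗ[ℝ] R4 where
  toFun := ofMat
  map_add' X Y := by ext i; fin_cases i <;> simp [ofMat]
  map_smul' a X := by ext i; fin_cases i <;> simp [ofMat]

theorem contDiff_toMat {n : WithTop ℕ∞} : ContDiff ℝ n toMat :=
  (LinearMap.toContinuousLinearMap toMatL).contDiff

theorem contDiff_ofMat {n : WithTop ℕ∞} : ContDiff ℝ n ofMat :=
  (LinearMap.toContinuousLinearMap ofMatL).contDiff

theorem fderiv_toMat_comp {g : Plane → R4} {u : Plane} (hg : DifferentiableAt ℝ g u) (v : Plane) :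
    fderiv ℝ (toMat ∘ g) u v = toMat (fderiv ℝ g u v) := by
  have h := ((LinearMap.toContinuousLinearMap toMatL).hasFDerivAt (x := g u)).comp u
    hg.hasFDerivAt
  have h2 : fderiv ℝ (toMat ∘ g) u =
      (LinearMap.toContinuousLinearMap toMatL).comp (fderiv ℝ g u) := h.fderiv
  rw [h2]
  rfl

theorem map_nhds_ofMat {T : Set Mat} (hT : ∀ Y ∈ T, Y.IsHermitian) {Y : Mat} (hY : Y ∈ T) :
    map ofMat (𝓝[T] Y) = 𝓝[ofMat '' T] (ofMat Y) := by
  refine le_antisymm ?_ ?_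
  · exact tendsto_nhdsWithin_iff.2 ⟨continuous_ofMat.continuousAt.mono_left nhdsWithin_le_nhds,
      eventually_nhdsWithin_of_forall fun Z hZ => Set.mem_image_of_mem _ hZ⟩
  · intro s hs
    rw [mem_map, mem_nhdsWithin] at hs
    obtain ⟨o, ho, hYo, hos⟩ := hs
    rw [mem_nhdsWithin]
    refine ⟨toMat ⁻¹' o, ho.preimage continuous_toMat, ?_, ?_⟩
    · show toMat (ofMat Y) ∈ o
      rwa [toMat_ofMat (hT Y hY)]
    · rintro _ ⟨hz, Z, hZ, rfl⟩
      have : Z ∈ o := by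
        have : toMat (ofMat Z) ∈ o := hz
        rwa [toMat_ofMat (hT Z hZ)] at this
      exact hos ⟨this, hZ⟩

theorem map_nhds_toMat (T : Set R4) (y : R4) : map toMat (𝓝[T] y) = 𝓝[toMat '' T] (toMat y) := by
  refine le_antisymm ?_ ?_
  · exact tendsto_nhdsWithin_iff.2 ⟨continuous_toMat.continuousAt.mono_left nhdsWithin_le_nhds,
      eventually_nhdsWithin_of_forall fun Z hZ => Set.mem_image_of_mem _ hZ⟩
  · intro s hs
    rw [mem_map, mem_nhdsWithin] at hs
    obtain ⟨o, ho, hYo, hos⟩ := hs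
    rw [mem_nhdsWithin]
    refine ⟨ofMat ⁻¹' o, ho.preimage continuous_ofMat, ?_, ?_⟩
    · show ofMat (toMat y) ∈ o
      rwa [ofMat_toMat]
    · rintro _ ⟨hz, Z, hZ, rfl⟩
      have : Z ∈ o := by
        have : ofMat (toMat Z) ∈ o := hz
        rwa [ofMat_toMat] at this
      exact hos ⟨this, hZ⟩

theorem image_coe4 (S : Set Hyp) : coe4 '' S = ofMat '' (Subtype.val '' S) := by
  rw [Set.image_image]; rfl

theorem image_val (S : Set Hyp) : Subtype.val '' S = toMat '' (coe4 '' S) := by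
  rw [Set.image_image]
  exact Set.image_congr fun x _ => (toMat_coe4 x).symm

theorem IsLocalParam.eventually_mem {S : Set Hyp} {x : Hyp} {X : Plane → Mat}
    (h : IsLocalParam S x X) : ∀ᶠ u in 𝓝 0, X u ∈ Subtype.val '' S := by
  have : Subtype.val '' S ∈ map X (𝓝 0) := by rw [h.map_nhds]; exact self_mem_nhdsWithin
  exact this

theorem IsLocalParam.eventuallyEq {S : Set Hyp} {x : Hyp} {X : Plane → Mat}
    (h : IsLocalParam S x X) : X =ᶠ[𝓝 0] toMat ∘ (ofMat ∘ X) := by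
  filter_upwards [h.eventually_mem] with u hu
  obtain ⟨y, _, hy⟩ := hu
  rw [Function.comp_apply, Function.comp_apply, ← hy, toMat_ofMat (hyp_herm y)]

theorem IsLocalParam.contDiffAt_ofMat {S : Set Hyp} {x : Hyp} {X : Plane → Mat}
    (h : IsLocalParam S x X) : ContDiffAt ℝ 2 (ofMat ∘ X) 0 :=
  contDiff_ofMat.contDiffAt.comp 0 h.contDiffAt

theorem IsLocalParam.fderiv_eq {S : Set Hyp} {x : Hyp} {X : Plane → Mat}
    (h : IsLocalParam S x X) (v : Plane) :
    fderiv ℝ X 0 v = toMat (fderiv ℝ (ofMat ∘ X) 0 v) := by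
  rw [← fderiv_toMat_comp (h.contDiffAt_ofMat.differentiableAt (by norm_num)), h.eventuallyEq.fderiv_eq]

theorem IsLocalParam.lParam {S : Set Hyp} {x : Hyp} {X : Plane → Mat} (hx : x ∈ S)
    (h : IsLocalParam S x X) : LParam (coe4 '' S) (coe4 x) (ofMat ∘ X) where
  contDiffAt := h.contDiffAt_ofMat
  map_zero := by simp [h.map_zero, coe4]
  immersion := by
    intro v w hvw
    apply h.immersion
    rw [h.fderiv_eq, h.fderiv_eq, hvw]
  map_nhds := by
    rw [← map_map, h.map_nhds, map_nhds_ofMat, ← image_coe4, coe4]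
    · rintro _ ⟨y, _, rfl⟩; exact hyp_herm y
    · exact Set.mem_image_of_mem _ hx

theorem LParam.isLocalParam {S : Set Hyp} {x : Hyp} {X : Plane → R4}
    (h : LParam (coe4 '' S) (coe4 x) X) : IsLocalParam S x (toMat ∘ X) where
  contDiffAt := contDiff_toMat.contDiffAt.comp 0 h.contDiffAt
  map_zero := by simp [h.map_zero, toMat_coe4]
  immersion := by
    intro v w hvw
    rw [fderiv_toMat_comp (h.contDiffAt.differentiableAt (by norm_num)),
      fderiv_toMat_comp (h.contDiffAt.differentiableAt (by norm_num))] at hvw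
    exact h.immersion (toMat_injective hvw)
  map_nhds := by
    rw [← map_map, h.map_nhds, map_nhds_toMat, ← image_val, toMat_coe4]

/-! ### Charts -/

/-- A neighbourhood of a point of an embedded surface is the homeomorphic image of an open set of
the plane, with an inverse that extends to a `C²` map. -/
theorem LParam.chart {T : Set R4} {x : R4} {X : Plane → R4} (h : LParam T x X)
    {W : Set Plane} (hW : W ∈ 𝓝 0) :
    ∃ U : Set Plane, ∃ V : Set R4, ∃ ψ : R4 → Plane, IsOpen U ∧ IsOpen V ∧ 0 ∈ U ∧ x ∈ V ∧ U ⊆ W ∧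
      (∀ u ∈ U, X u ∈ V ∩ T ∧ ψ (X u) = u ∧ ContDiffAt ℝ 2 X u ∧
        Function.Injective (fderiv ℝ X u)) ∧
      (∀ y ∈ V ∩ T, ψ y ∈ U ∧ X (ψ y) = y) ∧ (∀ y ∈ V, ContDiffAt ℝ 2 ψ y) := by
  -- With a linear left inverse `P` of the differential, P ∘ X is a local diffeomorphism of the
  -- plane, and (P ∘ X)⁻¹ ∘ P is a C² inverse of X defined on an open set of the ambient space.
  obtain ⟨P, hP⟩ : ∃ P : R4 →L[ℝ] Plane, P.comp (fderiv ℝ X 0) = ContinuousLinearMap.id ℝ _ := by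
    obtain ⟨g, hg⟩ := LinearMap.exists_leftInverse_of_injective (fderiv ℝ X 0 : Plane →ₗ[ℝ] R4)
      (LinearMap.ker_eq_bot.2 h.immersion)
    exact ⟨LinearMap.toContinuousLinearMap g, by
      ext v : 1
      exact LinearMap.congr_fun hg v⟩
  have hPX : ContDiffAt ℝ 2 (P ∘ X) 0 := P.contDiff.contDiffAt.comp 0 h.contDiffAt
  have hd : HasFDerivAt (P ∘ X) ((ContinuousLinearEquiv.refl ℝ Plane : Plane →L[ℝ] Plane)) 0 := by
    have := P.hasFDerivAt.comp (0 : Plane)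
      (h.contDiffAt.differentiableAt (by norm_num)).hasFDerivAt
    rw [hP] at this
    exact this
  set Φ := hPX.toOpenPartialHomeomorph (P ∘ X) hd (by norm_num) with hΦ
  have hΦc : (Φ : Plane → Plane) = P ∘ X := rfl
  have h0 : (0 : Plane) ∈ Φ.source := hPX.mem_toOpenPartialHomeomorph_source hd (by norm_num)
  have hsymm : ContDiffAt ℝ 2 Φ.symm (Φ 0) := hPX.to_localInverse hd (by norm_num)
  have e1 : ∀ᶠ u in 𝓝 (0 : Plane), ContDiffAt ℝ 2 X u :=
    h.contDiffAt.eventually (by norm_num)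
  have e2 : ∀ᶠ z in 𝓝 (Φ 0), ContDiffAt ℝ 2 Φ.symm z := hsymm.eventually (by norm_num)
  have e3 : ∀ᶠ u in 𝓝 (0 : Plane), X u ∈ T := by
    have : T ∈ map X (𝓝 0) := by rw [h.map_nhds]; exact self_mem_nhdsWithin
    exact this
  have e4 : ∀ᶠ u in 𝓝 (0 : Plane), Function.Injective (fderiv ℝ X u) := by
    have hc : ContinuousAt (fun u => P.comp (fderiv ℝ X u)) 0 :=
      continuousAt_const.clm_comp
        (h.contDiffAt.fderiv_right (m := 1) (by norm_num)).continuousAt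
    have hu : IsUnit (P.comp (fderiv ℝ X 0)) := by rw [hP]; exact isUnit_one
    have := hc.eventually (Units.isOpen.mem_nhds hu)
    filter_upwards [this] with u hu
    have hinj : Function.Injective (P.comp (fderiv ℝ X u)) := by
      obtain ⟨q, hq⟩ := hu
      intro v w hvw
      have h1 : (↑q⁻¹ * ↑q : Plane →L[ℝ] Plane) = 1 := q.inv_mul
      have h2 := congrArg (↑q⁻¹ : Plane →L[ℝ] Plane) hvw
      rw [← hq] at h2
      have h3 : ∀ z, (↑q⁻¹ : Plane →L[ℝ] Plane) ((q : Plane →L[ℝ] Plane) z) = z := fun z =>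
        DFunLike.congr_fun h1 z
      change (↑q⁻¹ : Plane →L[ℝ] Plane) ((q : Plane →L[ℝ] Plane) v) =
        (↑q⁻¹ : Plane →L[ℝ] Plane) ((q : Plane →L[ℝ] Plane) w) at h2
      rwa [h3, h3] at h2
    exact Function.Injective.of_comp (f := P) hinj
  obtain ⟨U1, hU1, hU1o, hU10⟩ := eventually_nhds_iff.1
    (((e1.and e3).and e4).and ((Φ.open_source.eventually_mem h0).and (eventually_mem_set.2 hW)))
  obtain ⟨V2, hV2, hV2o, hV20⟩ := eventually_nhds_iff.1 e2
  -- The neighbourhood condition on `X` is used here: without it other sheets of `T` could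
  -- accumulate at `x`.
  have hXU : X '' U1 ∈ 𝓝[T] x := by
    rw [← h.map_nhds]
    exact image_mem_map (hU1o.mem_nhds hU10)
  obtain ⟨V1, hV1o, hxV1, hV1⟩ := mem_nhdsWithin.1 hXU
  have hXc : ContinuousOn X U1 := fun u hu =>
    ((hU1 u hu).1.1.1).continuousAt.continuousWithinAt
  set V := V1 ∩ P ⁻¹' V2 with hV
  have hVo : IsOpen V := hV1o.inter (hV2o.preimage P.continuous)
  have hxV : x ∈ V := ⟨hxV1, by
    show P x ∈ V2
    rw [← h.map_zero]; exact hV20⟩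
  have hψ : ∀ u ∈ U1, Φ.symm (P (X u)) = u := fun u hu => Φ.left_inv (hU1 u hu).2.1
  refine ⟨U1 ∩ X ⁻¹' V, V, Φ.symm ∘ P, hXc.isOpen_inter_preimage hU1o hVo, hVo,
    ⟨hU10, by rw [Set.mem_preimage, h.map_zero]; exact hxV⟩, hxV,
    fun u hu => (hU1 u hu.1).2.2, ?_, ?_, ?_⟩
  · rintro u ⟨hu, huV⟩
    exact ⟨⟨huV, (hU1 u hu).1.1.2⟩, hψ u hu, (hU1 u hu).1.1.1, (hU1 u hu).1.2⟩
  · rintro y ⟨hyV, hyT⟩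
    obtain ⟨u, hu, rfl⟩ := hV1 ⟨hyV.1, hyT⟩
    rw [Function.comp_apply, hψ u hu]
    exact ⟨⟨hu, hyV⟩, rfl⟩
  · intro y hy
    exact (hV2 _ hy.2).comp y P.contDiff.contDiffAt

/-- Parametrizations only carry information at the parameter 0; translating the parameter turns
facts at the centre into facts at all nearby points, which can then be differentiated. -/
theorem LParam.recenter {T : Set R4} {x : R4} {X : Plane → R4} (h : LParam T x X) :
    ∀ᶠ u in 𝓝 0, X u ∈ T ∧ LParam T (X u) (fun w => X (u + w)) := by
  obtain ⟨U, V, ψ, hUo, hVo, h0, hx, -, h1, h2, h3⟩ := h.chart univ_mem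
  filter_upwards [hUo.mem_nhds h0] with u hu
  obtain ⟨⟨hXV, hXT⟩, hψ, hc, hi⟩ := h1 u hu
  have hadd : map (fun w => u + w) (𝓝 (0 : Plane)) = 𝓝 u := by simp
  refine ⟨hXT, ?_, by simp, ?_, ?_⟩
  · have : ContDiffAt ℝ 2 X (u + 0) := by rwa [add_zero]
    exact this.comp (0 : Plane) (contDiffAt_const.add contDiffAt_id)
  · rw [fderiv_comp_add_left, add_zero]; exact hi
  · have : (fun w => X (u + w)) = X ∘ fun w => u + w := rfl
    rw [this, ← map_map, hadd]
    refine le_antisymm ?_ ?_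
    · refine tendsto_nhdsWithin_iff.2 ⟨hc.continuousAt, ?_⟩
      filter_upwards [hUo.mem_nhds hu] with w hw
      exact (h1 w hw).1.2
    · intro s hs
      rw [mem_map] at hs
      have hψc : ContinuousAt ψ (X u) := (h3 _ hXV).continuousAt
      have : ∀ᶠ y in 𝓝 (X u), ψ y ∈ X ⁻¹' s := hψc.eventually (by rw [hψ]; exact hs)
      filter_upwards [mem_nhdsWithin_of_mem_nhds this, self_mem_nhdsWithin,
        mem_nhdsWithin_of_mem_nhds (hVo.mem_nhds hXV)] with y hy hyT hyV
      rw [Set.mem_preimage, (h2 y ⟨hyV, hyT⟩).2] at hy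
      exact hy


/-! ### Unit normals in real coordinates -/

/-- `n` is a continuous unit normal field along the subset `T` of hyperbolic space. -/
structure LNormal (T : Set R4) (n : R4 → R4) : Prop where
  sub : T ⊆ Hyp4
  continuousOn : ContinuousOn n T
  unit : ∀ x ∈ T, eta (n x) (n x) = 1
  tangent : ∀ x ∈ T, eta (n x) x = 0
  normal : ∀ x ∈ T, ∀ X, LParam T x X → ∀ w, eta (n x) (fderiv ℝ X 0 w) = 0

section
variable {E : Type*} [NormedAddCommGroup E] [NormedSpace ℝ E]

theorem hasFDerivAt_eta {f g : E → R4} {f' g' : E →L[ℝ] R4} {u : E} (hf : HasFDerivAt f f' u)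
    (hg : HasFDerivAt g g' u) :
    HasFDerivAt (fun z => eta (f z) (g z))
      (((etaL (f u)).comp g') + ((etaL.flip (g u)).comp f')) u := by
  exact (etaL.hasFDerivAt_of_bilinear hf hg).congr_fderiv (by ext v; rfl)

theorem fderiv_eta {f g : E → R4} {u : E} (hf : DifferentiableAt ℝ f u)
    (hg : DifferentiableAt ℝ g u) (v : E) :
    fderiv ℝ (fun z => eta (f z) (g z)) u v =
      eta (f u) (fderiv ℝ g u v) + eta (fderiv ℝ f u v) (g u) := by
  rw [(hasFDerivAt_eta hf.hasFDerivAt hg.hasFDerivAt).fderiv]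
  rfl

theorem fderiv_eta_of_eventuallyEq {f g : E → R4} {u : E} {c : ℝ} (hf : DifferentiableAt ℝ f u)
    (hg : DifferentiableAt ℝ g u) (h : ∀ᶠ z in 𝓝 u, eta (f z) (g z) = c) (v : E) :
    eta (f u) (fderiv ℝ g u v) + eta (fderiv ℝ f u v) (g u) = 0 := by
  rw [← fderiv_eta hf hg]
  have : (fun z => eta (f z) (g z)) =ᶠ[𝓝 u] fun _ => c := h
  rw [this.fderiv_eq]
  simp

theorem contDiffAt_eta {f g : E → R4} {u : E} {k : WithTop ℕ∞} (hf : ContDiffAt ℝ k f u)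
    (hg : ContDiffAt ℝ k g u) : ContDiffAt ℝ k (fun z => eta (f z) (g z)) u := by
  rw [contDiffAt_pi] at hf hg
  simp only [eta]
  exact (((hf 2).mul (hg 2)).add ((hf 3).mul (hg 3))).sub
    ((((hf 0).mul (hg 1)).add ((hf 1).mul (hg 0))).div_const 2)

theorem contDiffAt_cross {f g h : E → R4} {u : E} {k : WithTop ℕ∞} (hf : ContDiffAt ℝ k f u)
    (hg : ContDiffAt ℝ k g u) (hh : ContDiffAt ℝ k h u) :
    ContDiffAt ℝ k (fun z => cross (f z) (g z) (h z)) u := by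
  rw [contDiffAt_pi] at hf hg hh ⊢
  intro i
  have hf0 := hf 0
  have hf1 := hf 1
  have hf2 := hf 2
  have hf3 := hf 3
  have hg0 := hg 0
  have hg1 := hg 1
  have hg2 := hg 2
  have hg3 := hg 3
  have hh0 := hh 0
  have hh1 := hh 1
  have hh2 := hh 2
  have hh3 := hh 3
  fin_cases i <;> simp only [cross, Fin.zero_eta, Fin.mk_one, Fin.reduceFinMk, Matrix.cons_val] <;>
    fun_prop

end

/-- The standard basis of the parameter plane. -/
noncomputable def pb (i : Fin 2) : Plane := EuclideanSpace.single i 1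

theorem plane_eq (v : Plane) : v = v 0 • pb 0 + v 1 • pb 1 := by
  ext i
  fin_cases i <;> simp [pb]

theorem indep_of_injective {A : Plane →L[ℝ] R4} (hA : Function.Injective A) (a b : ℝ)
    (h : a • A (pb 0) + b • A (pb 1) = 0) : a = 0 ∧ b = 0 := by
  have h1 : A (a • pb 0 + b • pb 1) = A 0 := by rw [map_add, map_smul, map_smul, h, map_zero]
  have h2 := hA h1
  have h3 := congrArg (fun v : Plane => v 0) h2
  have h4 := congrArg (fun v : Plane => v 1) h2
  simp [pb] at h3 h4
  exact ⟨h3, h4⟩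

namespace LParam

variable {T : Set R4} {x : R4} {X : Plane → R4} {n : R4 → R4}

theorem eventually_contDiffAt (h : LParam T x X) : ∀ᶠ u in 𝓝 0, ContDiffAt ℝ 2 X u :=
  h.contDiffAt.eventually (by norm_num)

theorem eventually_mem (h : LParam T x X) : ∀ᶠ u in 𝓝 0, X u ∈ T :=
  h.recenter.mono fun _ hu => hu.1

theorem differentiableAt (h : LParam T x X) : DifferentiableAt ℝ X 0 :=
  h.contDiffAt.differentiableAt (by norm_num)

theorem contDiffAt_fderiv (h : LParam T x X) : ContDiffAt ℝ 1 (fderiv ℝ X) 0 :=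
  h.contDiffAt.fderiv_right (m := 1) (by norm_num)

theorem contDiffAt_fderiv_apply (h : LParam T x X) (w : Plane) :
    ContDiffAt ℝ 1 (fun u => fderiv ℝ X u w) 0 :=
  h.contDiffAt_fderiv.clm_apply contDiffAt_const

theorem fderiv_fderiv_apply (h : LParam T x X) (v w : Plane) :
    fderiv ℝ (fun u => fderiv ℝ X u w) 0 v = fderiv ℝ (fderiv ℝ X) 0 v w := by
  rw [fderiv_clm_apply (h.contDiffAt_fderiv.differentiableAt (by norm_num))
    (differentiableAt_const w)]
  simp

theorem eventually_injective (h : LParam T x X) :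
    ∀ᶠ u in 𝓝 0, Function.Injective (fderiv ℝ X u) := by
  filter_upwards [h.recenter] with u hu
  have := hu.2.immersion
  rwa [fderiv_comp_add_left, add_zero] at this

theorem eventually_normal (h : LParam T x X) (hn : LNormal T n) :
    ∀ᶠ u in 𝓝 0, ∀ w, eta (n (X u)) (fderiv ℝ X u w) = 0 := by
  filter_upwards [h.recenter] with u hu w
  have := hn.normal _ hu.1 _ hu.2 w
  rwa [fderiv_comp_add_left, add_zero] at this

theorem eventually_tangent (h : LParam T x X) (hT : T ⊆ Hyp4) :
    ∀ᶠ u in 𝓝 0, ∀ w, eta (X u) (fderiv ℝ X u w) = 0 := by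
  have e := (h.eventually_mem.mono fun u hu => eta_self_hyp4 (hT hu)).eventually_nhds
  filter_upwards [e, h.eventually_contDiffAt] with u hu hc w
  have hd := hc.differentiableAt (by norm_num)
  have := fderiv_eta_of_eventuallyEq hd hd hu w
  rw [eta_comm (fderiv ℝ X u w)] at this
  linarith

/-- The normal is only assumed continuous. It is a multiple of the cross product of `X` and its two
partial derivatives, which is C¹, so it equals ± the normalized cross product, with a locally
constant sign by continuity. -/
theorem contDiffAt_normal (h : LParam T x X) (hn : LNormal T n) :
    ContDiffAt ℝ 1 (n ∘ X) 0 := by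
  have hx : x ∈ T := by have := h.eventually_mem.self_of_nhds; rwa [h.map_zero] at this
  set e := fun u => fderiv ℝ X u (pb 0)
  set f := fun u => fderiv ℝ X u (pb 1)
  set c := fun u => cross (X u) (e u) (f u) with hc
  have hcC : ContDiffAt ℝ 1 c 0 := contDiffAt_cross (h.contDiffAt.of_le (by norm_num))
    (h.contDiffAt_fderiv_apply _) (h.contDiffAt_fderiv_apply _)
  set b := fun u => eta (c u) (n (X u)) with hb
  have hN : ContinuousAt (n ∘ X) 0 := by
    have h1 : ContinuousWithinAt n T (X 0) := hn.continuousOn _ (by rwa [h.map_zero])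
    exact h1.tendsto.comp (tendsto_nhdsWithin_iff.2
      ⟨h.differentiableAt.continuousAt, h.eventually_mem⟩)
  have hbc : ContinuousAt b 0 :=
    continuous_eta.continuousAt.comp (hcC.continuousAt.prodMk hN)
  have key : ∀ᶠ u in 𝓝 0, c u = b u • n (X u) ∧ b u * b u = eta (c u) (c u) ∧
      0 < eta (c u) (c u) := by
    filter_upwards [h.eventually_mem, h.eventually_normal hn, h.eventually_tangent hn.sub,
      h.eventually_injective] with u hT hnu htu hi
    obtain ⟨c1, c2, c3⟩ := cross_orthogonal (X u) (e u) (f u)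
    have hu := hn.sub hT
    have e1 : eta (e u) (X u) = 0 := by rw [eta_comm]; exact htu _
    have f1 : eta (f u) (X u) = 0 := by rw [eta_comm]; exact htu _
    have h1 : c u = b u • n (X u) := eq_smul_normal hu e1 f1
      (hn.tangent _ hT) c1 (hnu _) (hnu _) c2 c3 (hn.unit _ hT) (indep_of_injective hi)
    refine ⟨h1, ?_, ?_⟩
    · conv_rhs => rw [h1]
      rw [eta_smul_left, eta_smul_right, hn.unit _ hT, mul_one]
    · have := (gram_pos hu e1 f1 (indep_of_injective hi)).2.2
      rw [eta_cross_self, eta_self_hyp4 hu, eta_comm (X u) (e u), eta_comm (X u) (f u), e1, f1]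
      linarith
  have hq : ContDiffAt ℝ 1 (fun u => Real.sqrt (eta (c u) (c u))) 0 :=
    (contDiffAt_eta hcC hcC).sqrt key.self_of_nhds.2.2.ne'
  have hq0 : Real.sqrt (eta (c 0) (c 0)) ≠ 0 := (Real.sqrt_pos.2 key.self_of_nhds.2.2).ne'
  have hmain : ContDiffAt ℝ 1 (fun u => (Real.sqrt (eta (c u) (c u)))⁻¹ • c u) 0 :=
    (hq.inv hq0).smul hcC
  have hb0 : b 0 ≠ 0 := fun h0 => by
    have := key.self_of_nhds
    rw [h0] at this
    linarith [this.2.1, this.2.2]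
  rcases lt_or_gt_of_ne hb0 with hb0 | hb0
  · refine hmain.neg.congr_of_eventuallyEq ?_
    filter_upwards [key, hbc.eventually (eventually_lt_nhds hb0)] with u ⟨h1, h2, h3⟩ h4
    have h5 : Real.sqrt (eta (c u) (c u)) = -b u := by
      rw [← h2, ← neg_mul_neg, Real.sqrt_mul_self (by linarith)]
    rw [h5]
    conv_rhs => rw [h1]
    rw [smul_smul, inv_neg, neg_mul, inv_mul_cancel₀ h4.ne]
    simp
  · refine hmain.congr_of_eventuallyEq ?_
    filter_upwards [key, hbc.eventually (eventually_gt_nhds hb0)] with u ⟨h1, h2, h3⟩ h4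
    have h5 : Real.sqrt (eta (c u) (c u)) = b u := by
      rw [← h2, Real.sqrt_mul_self h4.le]
    rw [h5]
    conv_rhs => rw [h1]
    rw [smul_smul, inv_mul_cancel₀ h4.ne']
    simp

/-- The first fundamental form at the parameter `0`. -/
noncomputable def fst (X : Plane → R4) (v w : Plane) : ℝ := eta (fderiv ℝ X 0 v) (fderiv ℝ X 0 w)

/-- The second fundamental form at the parameter `0`. -/
noncomputable def snd (X N : Plane → R4) (v w : Plane) : ℝ :=
  -eta (fderiv ℝ N 0 v) (fderiv ℝ X 0 w)

theorem mem (h : LParam T x X) : x ∈ T := by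
  have := h.eventually_mem.self_of_nhds; rwa [h.map_zero] at this

theorem tangent_zero (h : LParam T x X) (hT : T ⊆ Hyp4) (w : Plane) :
    eta (fderiv ℝ X 0 w) x = 0 := by
  have := (h.eventually_tangent hT).self_of_nhds w
  rwa [h.map_zero, eta_comm] at this

theorem normal_zero (h : LParam T x X) (hn : LNormal T n) (w : Plane) :
    eta (n x) (fderiv ℝ X 0 w) = 0 := by
  have := (h.eventually_normal hn).self_of_nhds w
  rwa [h.map_zero] at this

theorem eta_hess (h : LParam T x X) (hT : T ⊆ Hyp4) (v w : Plane) :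
    eta x (fderiv ℝ (fderiv ℝ X) 0 v w) = -fst X v w := by
  have := fderiv_eta_of_eventuallyEq h.differentiableAt
    ((h.contDiffAt_fderiv_apply w).differentiableAt (by norm_num))
    ((h.eventually_tangent hT).mono fun u hu => hu w) v
  rw [h.fderiv_fderiv_apply, h.map_zero] at this
  simp only [fst]
  linarith

theorem differentiableAt_normal (h : LParam T x X) (hn : LNormal T n) :
    DifferentiableAt ℝ (n ∘ X) 0 := (h.contDiffAt_normal hn).differentiableAt (by norm_num)

/-- Differentiate the relation η(n, dX w) = 0. The symmetry of the second fundamental form follows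
from that of the second derivative. -/
theorem normal_hess (h : LParam T x X) (hn : LNormal T n) (v w : Plane) :
    eta (n x) (fderiv ℝ (fderiv ℝ X) 0 v w) = snd X (n ∘ X) v w := by
  have := fderiv_eta_of_eventuallyEq (h.differentiableAt_normal hn)
    ((h.contDiffAt_fderiv_apply w).differentiableAt (by norm_num))
    ((h.eventually_normal hn).mono fun u hu => hu w) v
  rw [h.fderiv_fderiv_apply, Function.comp_apply, h.map_zero] at this
  simp only [snd]
  linarith

theorem hess_symm (h : LParam T x X) (v w : Plane) :
    fderiv ℝ (fderiv ℝ X) 0 v w = fderiv ℝ (fderiv ℝ X) 0 w v :=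
  (h.contDiffAt.isSymmSndFDerivAt (by simp)).eq v w

theorem snd_symm (h : LParam T x X) (hn : LNormal T n) (v w : Plane) :
    snd X (n ∘ X) v w = snd X (n ∘ X) w v := by
  rw [← h.normal_hess hn, h.hess_symm, h.normal_hess hn]

theorem fst_symm (X : Plane → R4) (v w : Plane) : fst X v w = fst X w v := eta_comm _ _

/-- The derivative of the normal is tangent to the surface. -/
theorem weingarten (h : LParam T x X) (hn : LNormal T n) (v : Plane) :
    ∃ w : Plane, fderiv ℝ (n ∘ X) 0 v = -fderiv ℝ X 0 w := by
  have h1 := fderiv_eta_of_eventuallyEq (h.differentiableAt_normal hn)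
    (h.differentiableAt_normal hn)
    (h.eventually_mem.mono fun u hu => (hn.unit _ hu : eta ((n ∘ X) u) ((n ∘ X) u) = 1)) v
  have h2 := fderiv_eta_of_eventuallyEq (h.differentiableAt_normal hn)
    h.differentiableAt
    (h.eventually_mem.mono fun u hu => (hn.tangent _ hu : eta ((n ∘ X) u) (X u) = 0)) v
  rw [Function.comp_apply, h.map_zero, eta_comm (n x)] at h1
  rw [Function.comp_apply, h.map_zero, h.normal_zero hn] at h2
  have hn0 : n x ≠ 0 := by
    intro h0
    have := hn.unit x h.mem
    rw [h0, eta_zero_left] at this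
    norm_num at this
  obtain ⟨a, b, hab⟩ := mem_span_tangent (hn.sub h.mem) (h.tangent_zero hn.sub (pb 0))
    (h.tangent_zero hn.sub (pb 1)) (hn.tangent x h.mem) (by linarith : eta (fderiv ℝ (n ∘ X) 0 v) x = 0)
    (h.normal_zero hn _) (h.normal_zero hn _) (by linarith) hn0 (indep_of_injective h.immersion)
  refine ⟨-(a • pb 0 + b • pb 1), ?_⟩
  rw [hab, map_neg, neg_neg, map_add, map_smul, map_smul]

end LParam


/-! ### Pairs of binary quadratic forms -/

/-- The trace of a semidefinite form with respect to a definite one is nonnegative: 4F²m² ≤ 4EG · ln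
≤ (En + Gl)². -/
theorem trace_form_pos {E F G l m n : ℝ} (hE : 0 < E) (hG : 0 < G) (ha : 0 < E * G - F ^ 2)
    (hl : 0 ≤ l) (hn : 0 ≤ n) (hd : 0 ≤ l * n - m ^ 2) : 0 ≤ E * n + G * l - 2 * F * m := by
  have h : (2 * F * m) ^ 2 ≤ (E * n + G * l) ^ 2 := by
    have h1 : F ^ 2 * m ^ 2 ≤ (E * G) * (l * n) :=
      mul_le_mul (by linarith) (by linarith) (sq_nonneg _) (by positivity)
    nlinarith [sq_nonneg (E * n - G * l)]
  have := le_of_abs_le (abs_le_of_sq_le_sq h (by positivity))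
  linarith

/-- The eigenvalues of one form with respect to a definite one are real. -/
theorem discr_nonneg {E F G L M N : ℝ} (hE : 0 < E) (ha : 0 < E * G - F ^ 2) :
    0 ≤ (E * N + G * L - 2 * F * M) ^ 2 - 4 * (E * G - F ^ 2) * (L * N - M ^ 2) := by
  have h : E ^ 2 * ((E * N + G * L - 2 * F * M) ^ 2 - 4 * (E * G - F ^ 2) * (L * N - M ^ 2)) =
      (E * (E * N - G * L) - 2 * F * (E * M - F * L)) ^ 2 +
        4 * (E * G - F ^ 2) * (E * M - F * L) ^ 2 := by ring
  have h2 : 0 ≤ E ^ 2 * ((E * N + G * L - 2 * F * M) ^ 2 -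
      4 * (E * G - F ^ 2) * (L * N - M ^ 2)) := by rw [h]; positivity
  exact nonneg_of_mul_nonneg_right h2 (by positivity)

/-- Both roots of the characteristic polynomial are below 1, so the difference of the forms has
positive determinant. If it were not positive definite it would be negative semidefinite, and the
sum of the roots would be at least 2. -/
theorem form_lt_of_eigenvalues {E F G L M N : ℝ} (hE : 0 < E) (hG : 0 < G)
    (ha : 0 < E * G - F ^ 2)
    (h : ∀ k : ℝ, (L - k * E) * (N - k * G) - (M - k * F) ^ 2 = 0 → k < 1) :
    0 < E - L ∧ 0 < (E - L) * (G - N) - (F - M) ^ 2 := by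
  have hdisc := discr_nonneg (N := N) (L := L) (M := M) hE ha
  set a := E * G - F ^ 2 with hadef
  set t := E * N + G * L - 2 * F * M with ht
  set d := L * N - M ^ 2 with hd
  set q := Real.sqrt (t ^ 2 - 4 * a * d) with hq
  have hqq : q ^ 2 = t ^ 2 - 4 * a * d := Real.sq_sqrt hdisc
  have hp : ∀ k : ℝ, (L - k * E) * (N - k * G) - (M - k * F) ^ 2 = a * k ^ 2 - t * k + d := by
    intro k; rw [hadef, ht, hd]; ring
  have hk1 := h ((t + q) / (2 * a)) (by rw [hp]; field_simp; linear_combination hqq)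
  have hk2 := h ((t - q) / (2 * a)) (by rw [hp]; field_simp; linear_combination hqq)
  rw [div_lt_one (by positivity)] at hk1 hk2
  have hprod : 0 < (2 * a - (t + q)) * (2 * a - (t - q)) :=
    mul_pos (by linarith) (by linarith)
  have hdet : 0 < (E - L) * (G - N) - (F - M) ^ 2 := by
    have e : (2 * a - (t + q)) * (2 * a - (t - q)) =
        4 * a * ((E - L) * (G - N) - (F - M) ^ 2) := by
      have : (E - L) * (G - N) - (F - M) ^ 2 = a - t + d := by rw [hadef, ht, hd]; ring
      rw [this]; linear_combination -hqq
    rw [e] at hprod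
    exact pos_of_mul_pos_right hprod (by positivity)
  refine ⟨?_, hdet⟩
  by_contra hle
  push Not at hle
  have hGN : G - N ≤ 0 := by
    by_contra hgn
    push Not at hgn
    nlinarith [mul_nonpos_of_nonpos_of_nonneg hle hgn.le, sq_nonneg (F - M)]
  have := trace_form_pos hE hG ha (l := L - E) (m := M - F) (n := N - G) (by linarith)
    (by linarith) (by nlinarith)
  have ht2 : t < 2 * a := by linarith
  nlinarith

theorem form_abs_lt_of_eigenvalues {E F G L M N : ℝ} (hE : 0 < E) (hG : 0 < G)
    (ha : 0 < E * G - F ^ 2)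
    (h : ∀ k : ℝ, (L - k * E) * (N - k * G) - (M - k * F) ^ 2 = 0 → -1 < k ∧ k < 1) :
    (0 < E - L ∧ 0 < (E - L) * (G - N) - (F - M) ^ 2) ∧
      (0 < E + L ∧ 0 < (E + L) * (G + N) - (F + M) ^ 2) := by
  refine ⟨form_lt_of_eigenvalues hE hG ha fun k hk => (h k hk).2, ?_⟩
  have := form_lt_of_eigenvalues (L := -L) (M := -M) (N := -N) hE hG ha fun k hk => by
    have := (h (-k) (by linarith)).1
    linarith
  simpa using this

theorem form_pos {E F G a b : ℝ} (hE : 0 < E) (hd : 0 < E * G - F ^ 2) (hab : ¬ (a = 0 ∧ b = 0)) :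
    0 < E * a ^ 2 + 2 * F * (a * b) + G * b ^ 2 := by
  have h : E * (E * a ^ 2 + 2 * F * (a * b) + G * b ^ 2) =
      (E * a + F * b) ^ 2 + (E * G - F ^ 2) * b ^ 2 := by ring
  refine pos_of_mul_pos_right (a := E) ?_ hE.le
  rw [h]
  by_cases hb : b = 0
  · subst hb
    have : a ≠ 0 := fun h => hab ⟨h, rfl⟩
    simp only [mul_zero, add_zero]
    positivity
  · positivity

/-! ### The mean curvature of equidistant surfaces -/

/-- The mean curvature, at signed distance `r` from a surface with mean curvature `H` and extrinsic
curvature `K`. -/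
noncomputable def curvFun (H K r : ℝ) : ℝ :=
  (H * (Real.cosh r ^ 2 + Real.sinh r ^ 2) + (1 + K) * (Real.sinh r * Real.cosh r)) /
    (Real.cosh r ^ 2 + 2 * H * (Real.sinh r * Real.cosh r) + K * Real.sinh r ^ 2)

theorem curvFun_zero (H K : ℝ) : curvFun H K 0 = H := by simp [curvFun]

/-- The possible values of the mean curvature and the extrinsic curvature of a surface with principal
curvatures in `(-1, 1)`. -/
structure SmallCurv (H K : ℝ) : Prop where
  lower : -1 < H
  upper : H < 1
  le_sq : K ≤ H ^ 2
  sub_pos : 0 < 1 - 2 * H + K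
  add_pos : 0 < 1 + 2 * H + K

namespace SmallCurv

variable {H K : ℝ}

theorem lt_one (h : SmallCurv H K) : K < 1 := by
  nlinarith [h.lower, h.upper, h.le_sq]

/-- In terms of the principal curvatures this is (cosh r + k₁ sinh r)(cosh r + k₂ sinh r), while 1 ∓
2H + K = (1 ∓ k₁)(1 ∓ k₂). -/
theorem denom_pos (h : SmallCurv H K) (r : ℝ) :
    0 < Real.cosh r ^ 2 + 2 * H * (Real.sinh r * Real.cosh r) + K * Real.sinh r ^ 2 := by
  have e := Real.cosh_sq r
  have h1 := h.sub_pos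
  have h2 := h.add_pos
  have h3 := h.lt_one
  generalize Real.cosh r = c at *
  generalize Real.sinh r = s at *
  -- Four times the denominator is (1 - 2H + K)(c - s)² + (1 + 2H + K)(c + s)² + 2(1 - K)(c² - s²),
  -- and c² - s² = 1.
  nlinarith [mul_nonneg h1.le (sq_nonneg (c - s)), mul_nonneg h2.le (sq_nonneg (c + s))]

theorem hasDerivAt (h : SmallCurv H K) (r : ℝ) : ∃ d, 0 < d ∧ HasDerivAt (curvFun H K) d r := by
  have hD := h.denom_pos r
  have hc := Real.hasDerivAt_cosh r
  have hs := Real.hasDerivAt_sinh r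
  have hsc := hs.mul hc
  have hN := (((hc.pow 2).add (hs.pow 2)).const_mul H).add (hsc.const_mul (1 + K))
  have hDd := ((hc.pow 2).add (hsc.const_mul (2 * H))).add ((hs.pow 2).const_mul K)
  have hq := hN.div hDd hD.ne'
  refine ⟨_, ?_, hq⟩
  refine div_pos ?_ (pow_pos hD 2)
  have e := Real.cosh_sq r
  have h1 := h.sub_pos
  have h2 := h.add_pos
  have h3 := h.lt_one
  simp only [Pi.add_apply, Pi.mul_apply, Pi.pow_apply]
  generalize Real.cosh r = c at *
  generalize Real.sinh r = s at *
  -- Equal to a quarter of (1 - 2H + K)(c - s)² + (1 + 2H + K)(c + s)².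
  have hE : 0 < 2 * H * (s * c) + (1 + K) / 2 * (c ^ 2 + s ^ 2) := by
    have : c ^ 2 + s ^ 2 ≠ 0 := by nlinarith [sq_nonneg s]
    have hcs : 0 < (c - s) ^ 2 := by
      apply lt_of_le_of_ne (sq_nonneg _)
      intro h
      have : c - s = 0 := by nlinarith
      nlinarith
    nlinarith [mul_pos h1 hcs, mul_nonneg h2.le (sq_nonneg (c + s))]
  have hB : 0 < ((1 + K) / 2) ^ 2 - H ^ 2 := by nlinarith
  -- The numerator of the derivative is the expression in `key` with its first summand multiplied by
  -- c² - s² and its second by (c² - s²)².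
  have e2 : (c ^ 2 - s ^ 2) = 1 := by linarith
  have key : 0 < (1 - K) * (2 * H * (s * c) + (1 + K) / 2 * (c ^ 2 + s ^ 2)) +
      2 * (((1 + K) / 2) ^ 2 - H ^ 2) := by nlinarith
  have e3 : (c ^ 2 - s ^ 2) ^ 2 = 1 := by rw [e2]; ring
  refine key.trans_eq ?_
  push_cast
  linear_combination (-(1 - K) * (2 * H * (s * c) + (1 + K) / 2 * (c ^ 2 + s ^ 2))) * e2 -
    (2 * (((1 + K) / 2) ^ 2 - H ^ 2)) * e3

theorem differentiable (h : SmallCurv H K) : Differentiable ℝ (curvFun H K) := fun r => by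
  obtain ⟨d, _, hd⟩ := h.hasDerivAt r
  exact hd.differentiableAt

theorem deriv_pos (h : SmallCurv H K) (r : ℝ) : 0 < deriv (curvFun H K) r := by
  obtain ⟨d, h0, hd⟩ := h.hasDerivAt r
  rwa [hd.deriv]

theorem strictMono (h : SmallCurv H K) : StrictMono (curvFun H K) :=
  strictMono_of_deriv_pos h.deriv_pos

/-- Monotonicity in the extrinsic curvature for fixed mean curvature. The direction is the sign of
r, which is why the bounds are stated with unordered intervals. -/
theorem curvFun_sub {K' : ℝ} (h : SmallCurv H K) (h' : SmallCurv H K') (r : ℝ) :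
    ∃ q, 0 < q ∧ curvFun H K' r - curvFun H K r = (K' - K) * (Real.sinh r * q) := by
  have hD := h.denom_pos r
  have hD' := h'.denom_pos r
  have hc := Real.cosh_pos r
  have hq : 0 < Real.cosh r + H * Real.sinh r := by
    have e := Real.cosh_sq r
    have := h.lower
    have := h.upper
    have h1 : (H * Real.sinh r) ^ 2 < Real.cosh r ^ 2 := by
      have hH : 0 < 1 - H ^ 2 := by nlinarith
      nlinarith [mul_nonneg hH.le (sq_nonneg (Real.sinh r))]
    have := (abs_lt.1 (abs_lt_of_sq_lt_sq h1 hc.le)).1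
    linarith
  refine ⟨(Real.cosh r + H * Real.sinh r) / ((Real.cosh r ^ 2 + 2 * H * (Real.sinh r * Real.cosh r) +
    K' * Real.sinh r ^ 2) * (Real.cosh r ^ 2 + 2 * H * (Real.sinh r * Real.cosh r) +
    K * Real.sinh r ^ 2)), by positivity, ?_⟩
  rw [curvFun, curvFun, div_sub_div _ _ hD'.ne' hD.ne', mul_div_assoc', mul_div_assoc']
  congr 1
  have e := Real.cosh_sq r
  generalize Real.cosh r = c at *
  generalize Real.sinh r = s at *
  have e2 : (c ^ 2 - s ^ 2) = 1 := by linarith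
  linear_combination ((K' - K) * s * (c + H * s)) * e2

theorem mem_uIcc {K₀ : ℝ} (h : SmallCurv H K) (h' : SmallCurv H K₀) (hK : K₀ ≤ K) (r : ℝ) :
    curvFun H K r ∈ Set.uIcc (curvFun H K₀ r) (curvFun H (H ^ 2) r) := by
  have h2 : SmallCurv H (H ^ 2) := ⟨h.lower, h.upper, le_rfl, by nlinarith [h.upper],
    by nlinarith [h.lower]⟩
  obtain ⟨q, hq, e⟩ := curvFun_sub h' h r
  obtain ⟨q', hq', e'⟩ := curvFun_sub h h2 r
  have hKH := h.le_sq
  rcases le_total 0 (Real.sinh r) with hs | hs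
  · refine Set.mem_uIcc_of_le ?_ ?_
    · have : 0 ≤ (K - K₀) * (Real.sinh r * q) :=
        mul_nonneg (by linarith) (mul_nonneg hs hq.le)
      linarith
    · have : 0 ≤ (H ^ 2 - K) * (Real.sinh r * q') :=
        mul_nonneg (by linarith) (mul_nonneg hs hq'.le)
      linarith
  · refine Set.mem_uIcc_of_ge ?_ ?_
    · have : (H ^ 2 - K) * (Real.sinh r * q') ≤ 0 :=
        mul_nonpos_of_nonneg_of_nonpos (by linarith) (mul_nonpos_of_nonpos_of_nonneg hs hq'.le)
      linarith
    · have : (K - K₀) * (Real.sinh r * q) ≤ 0 :=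
        mul_nonpos_of_nonneg_of_nonpos (by linarith) (mul_nonpos_of_nonpos_of_nonneg hs hq.le)
      linarith

end SmallCurv

namespace LParam

variable {T : Set R4} {x : R4} {X : Plane → R4} {n : R4 → R4}

/-- The determinant of the first fundamental form. -/
noncomputable def gram (X : Plane → R4) : ℝ :=
  fst X (pb 0) (pb 0) * fst X (pb 1) (pb 1) - fst X (pb 0) (pb 1) ^ 2

/-- The mean curvature in real coordinates. -/
noncomputable def mc (X N : Plane → R4) : ℝ :=
  (fst X (pb 0) (pb 0) * snd X N (pb 1) (pb 1) + fst X (pb 1) (pb 1) * snd X N (pb 0) (pb 0) -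
    fst X (pb 0) (pb 1) * snd X N (pb 0) (pb 1) - fst X (pb 0) (pb 1) * snd X N (pb 1) (pb 0)) /
    (2 * gram X)

/-- The extrinsic curvature in real coordinates. -/
noncomputable def ec (X N : Plane → R4) : ℝ :=
  (snd X N (pb 0) (pb 0) * snd X N (pb 1) (pb 1) - snd X N (pb 0) (pb 1) * snd X N (pb 1) (pb 0)) /
    gram X

theorem gram_pos (h : LParam T x X) (hT : T ⊆ Hyp4) :
    0 < fst X (pb 0) (pb 0) ∧ 0 < fst X (pb 1) (pb 1) ∧ 0 < gram X :=
  QuasiFuchsian.gram_pos (hT h.mem) (h.tangent_zero hT _) (h.tangent_zero hT _)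
    (indep_of_injective h.immersion)

/-- The mean curvature of the equidistant surface. -/
theorem mc_zeta (h : LParam T x X) (hn : LNormal T n) (r : ℝ)
    (hD : Real.cosh r ^ 2 + 2 * mc X (n ∘ X) * (Real.sinh r * Real.cosh r) +
      ec X (n ∘ X) * Real.sinh r ^ 2 ≠ 0) :
    0 < gram (fun u => zeta (X u) (n (X u)) r) ∧
    mc (fun u => zeta (X u) (n (X u)) r)
      (fun u => Real.cosh r • n (X u) - Real.sinh r • X u) =
      curvFun (mc X (n ∘ X)) (ec X (n ∘ X)) r := by
  have hdX := h.differentiableAt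
  have hdN := h.differentiableAt_normal hn
  have d1 : ∀ v, fderiv ℝ (fun u => zeta (X u) (n (X u)) r) 0 v =
      Real.cosh r • fderiv ℝ X 0 v - Real.sinh r • fderiv ℝ (n ∘ X) 0 v := by
    intro v
    have := ((hdX.hasFDerivAt.const_smul (Real.cosh r)).sub
      (hdN.hasFDerivAt.const_smul (Real.sinh r))).fderiv
    exact DFunLike.congr_fun this v
  have d2 : ∀ v, fderiv ℝ (fun u => Real.cosh r • n (X u) - Real.sinh r • X u) 0 v =
      Real.cosh r • fderiv ℝ (n ∘ X) 0 v - Real.sinh r • fderiv ℝ X 0 v := by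
    intro v
    have := ((hdN.hasFDerivAt.const_smul (Real.cosh r)).sub
      (hdX.hasFDerivAt.const_smul (Real.sinh r))).fderiv
    exact DFunLike.congr_fun this v
  -- The coordinates of `w0` and `w1` are the entries of the shape operator A. With c = cosh r and s
  -- = sinh r, the differential of the equidistant immersion is dX (c + sA), that of its normal is
  -- -dX (cA + s), and D = det (c + sA), so the Gram determinant is multiplied by D².
  obtain ⟨w0, hw0⟩ := h.weingarten hn (pb 0)
  obtain ⟨w1, hw1⟩ := h.weingarten hn (pb 1)
  rw [plane_eq w0, map_add, map_smul, map_smul] at hw0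
  rw [plane_eq w1, map_add, map_smul, map_smul] at hw1
  obtain ⟨hE, hG, ha⟩ := h.gram_pos hn.sub
  unfold curvFun
  unfold mc ec gram fst snd at *
  simp only [d1, d2, hw0, hw1, eta_sub_left, eta_sub_right, eta_smul_left, eta_smul_right,
    eta_add_left, eta_add_right, eta_neg_left, eta_neg_right] at hD ⊢
  simp only [eta_comm (fderiv ℝ X 0 (pb 1)) (fderiv ℝ X 0 (pb 0))] at *
  generalize eta (fderiv ℝ X 0 (pb 0)) (fderiv ℝ X 0 (pb 0)) = E at *
  generalize eta (fderiv ℝ X 0 (pb 0)) (fderiv ℝ X 0 (pb 1)) = F at *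
  generalize eta (fderiv ℝ X 0 (pb 1)) (fderiv ℝ X 0 (pb 1)) = G at *
  generalize w0 0 = p at *
  generalize w0 1 = q at *
  generalize w1 0 = u at *
  generalize w1 1 = v at *
  generalize Real.cosh r = c at *
  generalize Real.sinh r = s at *
  have eH : (E * -(-(u * F + v * G)) + G * -(-(p * E + q * F)) - F * -(-(p * F + q * G)) -
      F * -(-(u * E + v * F))) / (2 * (E * G - F ^ 2)) = (p + v) / 2 := by
    rw [div_eq_div_iff (by positivity) two_ne_zero]; ring
  have eK : (-(-(p * E + q * F)) * -(-(u * F + v * G)) -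
      -(-(p * F + q * G)) * -(-(u * E + v * F))) / (E * G - F ^ 2) = p * v - q * u := by
    rw [div_eq_iff ha.ne']; ring
  rw [eH, eK] at hD ⊢
  set D := c ^ 2 + 2 * ((p + v) / 2) * (s * c) + (p * v - q * u) * s ^ 2 with hDdef
  have hpos : 0 < D ^ 2 * (E * G - F ^ 2) := by positivity
  refine (and_iff_left_of_imp fun hg => ?_).2 ?_
  · rw [div_eq_div_iff (by positivity) hD, hDdef]
    ring
  · refine hpos.trans_eq ?_
    rw [hDdef]
    ring

end LParam


/-! ### Translation of the curvature hypotheses to real coordinates -/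

/-- A field of matrices in real coordinates. -/
noncomputable def n4 (ν : Mat → Mat) (v : R4) : R4 := ofMat (ν (toMat v))

theorem ofMat_comp_toMat_comp (X : Plane → R4) : ofMat ∘ (toMat ∘ X) = X := by
  funext u; exact ofMat_toMat _

theorem coe4_image_sub (S : Set Hyp) : coe4 '' S ⊆ Hyp4 := by
  rintro _ ⟨x, _, rfl⟩; exact coe4_mem x

theorem IsUnitNormal.lNormal {S : Set Hyp} {ν : Mat → Mat} (h : IsUnitNormal S ν) :
    LNormal (coe4 '' S) (n4 ν) where
  sub := coe4_image_sub S
  continuousOn := by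
    refine continuous_ofMat.comp_continuousOn (h.continuousOn.comp continuous_toMat.continuousOn ?_)
    rw [image_val]
    exact Set.mapsTo_image _ _
  unit := by
    rintro _ ⟨x, hx, rfl⟩
    rw [n4, toMat_coe4, ← mink_ofMat (h.hermitian x hx) (h.hermitian x hx), h.unit x hx]
  tangent := by
    rintro _ ⟨x, hx, rfl⟩
    rw [n4, toMat_coe4, coe4, ← mink_ofMat (h.hermitian x hx) (hyp_herm x), h.tangent x hx]
  normal := by
    rintro _ ⟨x, hx, rfl⟩ X hX w
    have := h.normal x hx _ hX.isLocalParam w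
    rw [n4, toMat_coe4]
    rw [fderiv_toMat_comp hX.differentiableAt, mink_ofMat (h.hermitian x hx) (toMat_herm _),
      ofMat_toMat] at this
    exact this

theorem meanCurvature_eq {Y M : Plane → Mat} {Y' M' : Plane → R4} (hY : Y =ᶠ[𝓝 0] toMat ∘ Y')
    (hM : M =ᶠ[𝓝 0] toMat ∘ M') (hYd : DifferentiableAt ℝ Y' 0) (hMd : DifferentiableAt ℝ M' 0) :
    (∀ v w, firstForm Y v w = LParam.fst Y' v w) ∧
    (∀ v w, secondForm Y M v w = LParam.snd Y' M' v w) ∧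
    (0 < LParam.gram Y' → meanCurvature Y M = LParam.mc Y' M') := by
  have h1 : ∀ v w, firstForm Y v w = LParam.fst Y' v w := by
    intro v w
    rw [firstForm, hY.fderiv_eq, fderiv_toMat_comp hYd, fderiv_toMat_comp hYd, mink_toMat]
    rfl
  have h2 : ∀ v w, secondForm Y M v w = LParam.snd Y' M' v w := by
    intro v w
    rw [secondForm, hY.fderiv_eq, hM.fderiv_eq, fderiv_toMat_comp hYd, fderiv_toMat_comp hMd,
      mink_toMat]
    rfl
  refine ⟨h1, h2, fun hg => ?_⟩
  have hdet : (Matrix.of fun i j => firstForm Y (pb i) (pb j)).det = LParam.gram Y' := by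
    rw [Matrix.det_fin_two, LParam.gram]
    simp only [Matrix.of_apply, h1]
    rw [LParam.fst_symm Y' (pb 1) (pb 0)]
    ring
  have h3 : meanCurvature Y M = ((Matrix.of fun i j => firstForm Y (pb i) (pb j))⁻¹ *
    Matrix.of fun i j => secondForm Y M (pb i) (pb j)).trace / 2 := rfl
  rw [h3, Matrix.inv_def, hdet, Ring.inverse_eq_inv', Matrix.adjugate_fin_two, LParam.mc,
    Matrix.trace_fin_two]
  simp only [Matrix.smul_apply, Matrix.mul_apply, Fin.sum_univ_two, smul_eq_mul,
    Matrix.of_apply, h1, h2, Matrix.cons_val', Matrix.cons_val, Matrix.cons_val_fin_one]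
  rw [LParam.fst_symm Y' (pb 1) (pb 0)]
  field_simp
  ring

theorem IsUnitNormal.eventuallyEq {S : Set Hyp} {ν : Mat → Mat} (h : IsUnitNormal S ν) {x : Hyp}
    {X : Plane → Mat} (hX : IsLocalParam S x X) :
    ν ∘ X =ᶠ[𝓝 0] toMat ∘ (n4 ν ∘ (ofMat ∘ X)) := by
  filter_upwards [hX.eventually_mem] with u hu
  obtain ⟨y, hy, hyu⟩ := hu
  simp only [Function.comp_apply, n4]
  rw [← hyu, toMat_ofMat (hyp_herm y), toMat_ofMat (h.hermitian y hy)]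

/-- The geometry of a surface of constant mean curvature in real coordinates. -/
structure LSurface (T : Set R4) (n : R4 → R4) (H : ℝ) : Prop extends LNormal T n where
  param : ∀ x ∈ T, ∃ X, LParam T x X
  mean : ∀ x ∈ T, ∀ X, LParam T x X → LParam.mc X (n ∘ X) = H

theorem LSurface.of {S : Set Hyp} {ν : Mat → Mat} {H : ℝ} (hS : IsEmbeddedSurface S)
    (hν : IsUnitNormal S ν) (hH : HasConstMeanCurvature S ν H) :
    LSurface (coe4 '' S) (n4 ν) H where
  toLNormal := hν.lNormal
  param := by
    rintro _ ⟨x, hx, rfl⟩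
    obtain ⟨X, hX⟩ := hS x hx
    exact ⟨_, hX.lParam hx⟩
  mean := by
    rintro _ ⟨x, hx, rfl⟩ X hX
    rw [← hH x hx _ hX.isLocalParam]
    have e := hν.eventuallyEq hX.isLocalParam
    rw [ofMat_comp_toMat_comp] at e
    exact ((meanCurvature_eq (Filter.EventuallyEq.refl _ _) e hX.differentiableAt
      (hX.differentiableAt_normal hν.lNormal)).2.2 (hX.gram_pos (coe4_image_sub S)).2.2).symm

/-- The principal curvatures are in `(-1, 1)`. -/
def SmallForms (T : Set R4) (n : R4 → R4) : Prop :=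
  ∀ x ∈ T, ∀ X, LParam T x X → ∀ v : Plane, v ≠ 0 →
    |LParam.snd X (n ∘ X) v v| < LParam.fst X v v

namespace LParam

theorem fst_expand (X : Plane → R4) (v w : Plane) : fst X v w =
    fst X (pb 0) (pb 0) * (v 0 * w 0) + fst X (pb 0) (pb 1) * (v 0 * w 1 + v 1 * w 0) +
      fst X (pb 1) (pb 1) * (v 1 * w 1) := by
  conv_lhs => rw [plane_eq v, plane_eq w]
  simp only [fst, map_add, map_smul, eta_add_left, eta_add_right, eta_smul_left, eta_smul_right]
  rw [eta_comm (fderiv ℝ X 0 (pb 1)) (fderiv ℝ X 0 (pb 0))]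
  ring

theorem snd_expand {T : Set R4} {x : R4} {X : Plane → R4} {n : R4 → R4} (h : LParam T x X)
    (hn : LNormal T n) (v w : Plane) : snd X (n ∘ X) v w =
    snd X (n ∘ X) (pb 0) (pb 0) * (v 0 * w 0) +
      snd X (n ∘ X) (pb 0) (pb 1) * (v 0 * w 1 + v 1 * w 0) +
      snd X (n ∘ X) (pb 1) (pb 1) * (v 1 * w 1) := by
  have e := h.snd_symm hn (pb 0) (pb 1)
  conv_lhs => rw [plane_eq v, plane_eq w]
  simp only [snd, map_add, map_smul, eta_add_left, eta_add_right, eta_smul_left,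
    eta_smul_right] at *
  linear_combination -(v 1 * w 0) * e

end LParam

/-- The hypothesis concerns eigenvectors, while the algebra needs roots of the characteristic
polynomial: a root makes the pencil singular, and any kernel vector exhibits it as a principal
curvature. -/
theorem HasSmallPrincipalCurvatures.forms {S : Set Hyp} {ν : Mat → Mat} (hν : IsUnitNormal S ν)
    (h : HasSmallPrincipalCurvatures S ν) {x : R4} (hx : x ∈ coe4 '' S) {X : Plane → R4}
    (hX : LParam (coe4 '' S) x X) {E F G L M N : ℝ} (hE : E = LParam.fst X (pb 0) (pb 0))
    (hF : F = LParam.fst X (pb 0) (pb 1)) (hG : G = LParam.fst X (pb 1) (pb 1))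
    (hL : L = LParam.snd X (n4 ν ∘ X) (pb 0) (pb 0))
    (hM : M = LParam.snd X (n4 ν ∘ X) (pb 0) (pb 1))
    (hN : N = LParam.snd X (n4 ν ∘ X) (pb 1) (pb 1)) :
    (0 < E - L ∧ 0 < (E - L) * (G - N) - (F - M) ^ 2) ∧
      (0 < E + L ∧ 0 < (E + L) * (G + N) - (F + M) ^ 2) := by
  obtain ⟨x, hx, rfl⟩ := hx
  obtain ⟨h1, h2, h3⟩ := hX.gram_pos (coe4_image_sub S)
  rw [LParam.gram] at h3
  rw [← hE, ← hF, ← hG] at h3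
  rw [← hE] at h1
  rw [← hG] at h2
  refine form_abs_lt_of_eigenvalues h1 h2 h3 fun k hk => ?_
  have e := hν.eventuallyEq hX.isLocalParam
  rw [ofMat_comp_toMat_comp] at e
  obtain ⟨f1, f2, -⟩ := meanCurvature_eq (Filter.EventuallyEq.refl _ _) e hX.differentiableAt
      (hX.differentiableAt_normal hν.lNormal)
  have key : ∀ v : Plane, v ≠ 0 → (L - k * E) * v 0 + (M - k * F) * v 1 = 0 →
      (M - k * F) * v 0 + (N - k * G) * v 1 = 0 → k ∈ Set.Ioo (-1) 1 := by
    intro v hv e1 e2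
    refine h x hx _ hX.isLocalParam k ⟨v, hv, fun w => ?_⟩
    rw [f1, f2, LParam.fst_expand, hX.snd_expand hν.lNormal, ← hE, ← hF, ← hG, ← hL, ← hM, ← hN]
    linear_combination w 0 * e1 + w 1 * e2
  by_cases h0 : L - k * E = 0 ∧ M - k * F = 0
  · refine key (pb 0) ?_ ?_ ?_
    · intro h; simpa [pb] using congrArg (fun v : Plane => v 0) h
    · simp [pb, h0]
    · simp [pb, h0]
  -- The vector orthogonal to the first row of the singular matrix; the second equation is the
  -- vanishing of the determinant.
  · refine key (!₂[-(M - k * F), L - k * E]) ?_ ?_ ?_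
    · intro h
      apply h0
      have h1 := congrArg (fun v : Plane => v 0) h
      have h2 := congrArg (fun v : Plane => v 1) h
      simp at h1 h2
      exact ⟨by linarith, by linarith⟩
    · simp; ring
    · simp; linarith

theorem HasSmallPrincipalCurvatures.smallForms {S : Set Hyp} {ν : Mat → Mat}
    (hν : IsUnitNormal S ν) (h : HasSmallPrincipalCurvatures S ν) :
    SmallForms (coe4 '' S) (n4 ν) := by
  intro x hx X hX v hv
  obtain ⟨⟨h1, h2⟩, h3, h4⟩ := h.forms hν hx hX rfl rfl rfl rfl rfl rfl
  have hv' : ¬ (v 0 = 0 ∧ v 1 = 0) := by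
    rintro ⟨e1, e2⟩
    apply hv
    rw [plane_eq v, e1, e2]
    simp
  have p1 := form_pos h1 h2 hv'
  have p2 := form_pos h3 h4 hv'
  rw [LParam.fst_expand, hX.snd_expand hν.lNormal, abs_lt]
  constructor <;> linarith

theorem HasSmallPrincipalCurvatures.smallCurv {S : Set Hyp} {ν : Mat → Mat}
    (hν : IsUnitNormal S ν) (h : HasSmallPrincipalCurvatures S ν) {x : R4} (hx : x ∈ coe4 '' S)
    {X : Plane → R4} (hX : LParam (coe4 '' S) x X) :
    SmallCurv (LParam.mc X (n4 ν ∘ X)) (LParam.ec X (n4 ν ∘ X)) := by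
  obtain ⟨⟨h1, h2⟩, h3, h4⟩ := h.forms hν hx hX rfl rfl rfl rfl rfl rfl
  obtain ⟨hE, hG, ha⟩ := hX.gram_pos (coe4_image_sub S)
  have e := hX.snd_symm hν.lNormal (pb 0) (pb 1)
  have hd := discr_nonneg (L := LParam.snd X (n4 ν ∘ X) (pb 0) (pb 0))
    (M := LParam.snd X (n4 ν ∘ X) (pb 0) (pb 1)) (N := LParam.snd X (n4 ν ∘ X) (pb 1) (pb 1)) hE ha
  unfold LParam.mc LParam.ec LParam.gram at *
  rw [← e]
  generalize LParam.fst X (pb 0) (pb 0) = E at *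
  generalize LParam.fst X (pb 0) (pb 1) = F at *
  generalize LParam.fst X (pb 1) (pb 1) = G at *
  generalize LParam.snd X (n4 ν ∘ X) (pb 0) (pb 0) = L at *
  generalize LParam.snd X (n4 ν ∘ X) (pb 0) (pb 1) = M at *
  generalize LParam.snd X (n4 ν ∘ X) (pb 1) (pb 1) = N at *
  have hGN : 0 ≤ G - N := by
    by_contra hn
    push Not at hn
    nlinarith [mul_pos h1 (neg_pos.2 hn), sq_nonneg (F - M)]
  have hGN' : 0 ≤ G + N := by
    by_contra hn
    push Not at hn
    nlinarith [mul_pos h3 (neg_pos.2 hn), sq_nonneg (F + M)]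
  have t1 := trace_form_pos hE hG ha h1.le hGN h2.le
  have t2 := trace_form_pos hE hG ha h3.le hGN' h4.le
  set a := E * G - F ^ 2 with hadef
  set t := E * N + G * L - F * M - F * M with ht
  set d := L * N - M * M with hd
  have g1 : t ≤ 2 * a := by linarith
  have g2 : -(2 * a) ≤ t := by linarith
  have g3 : 0 < a - t + d := by linarith
  have g4 : 0 < a + t + d := by linarith
  have g5 : 4 * a * d ≤ t ^ 2 := by rw [hd, ht]; nlinarith
  have e1 : 1 - 2 * (t / (2 * a)) + d / a = (a - t + d) / a := by field_simp
  have e2 : 1 + 2 * (t / (2 * a)) + d / a = (a + t + d) / a := by field_simp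
  have e3 : d / a ≤ (t / (2 * a)) ^ 2 := by
    rw [div_pow, div_le_div_iff₀ ha (by positivity)]
    nlinarith
  refine ⟨?_, ?_, e3, by rw [e1]; positivity, by rw [e2]; positivity⟩
  -- Equality t = -2a would give d ≤ a by the discriminant and d > a by `g4`.
  · rw [lt_div_iff₀ (by positivity)]
    refine lt_of_le_of_ne (by linarith) fun h => ?_
    have : t = -(2 * a) := by linarith
    rw [this] at g5 g4
    nlinarith
  · rw [div_lt_one (by positivity)]
    refine lt_of_le_of_ne g1 fun h => ?_
    rw [h] at g5 g3
    nlinarith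

/-- The mean curvature of the equidistant surfaces. -/
theorem meanCurvature_equidist {S : Set Hyp} {ν : Mat → Mat}
    (hν : IsUnitNormal S ν) (h : HasSmallPrincipalCurvatures S ν) {x : Hyp} (hx : x ∈ S)
    {X : Plane → Mat} (hX : IsLocalParam S x X) (r : ℝ) :
    meanCurvature (equidist X (ν ∘ X) r) (equidistNormal X (ν ∘ X) r) =
      curvFun (LParam.mc (ofMat ∘ X) (n4 ν ∘ (ofMat ∘ X)))
        (LParam.ec (ofMat ∘ X) (n4 ν ∘ (ofMat ∘ X))) r := by
  have hX' := hX.lParam hx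
  have hs := h.smallCurv hν (Set.mem_image_of_mem _ hx) hX'
  have hd := hX'.differentiableAt
  have hdn := hX'.differentiableAt_normal hν.lNormal
  obtain ⟨hg, e⟩ := hX'.mc_zeta hν.lNormal r (hs.denom_pos r).ne'
  rw [← e]
  refine (meanCurvature_eq ?_ ?_ ?_ ?_).2.2 hg
  · filter_upwards [hX.eventuallyEq, hν.eventuallyEq hX] with u h1 h2
    simp only [Function.comp_apply] at h1 h2 ⊢
    simp only [equidist, geod, Function.comp_apply, zeta, toMat_sub, toMat_smul]
    rw [← h1, ← h2, smul_neg, sub_eq_add_neg]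
  · filter_upwards [hX.eventuallyEq, hν.eventuallyEq hX] with u h1 h2
    simp only [Function.comp_apply] at h1 h2 ⊢
    simp only [equidistNormal, Function.comp_apply, toMat_sub, toMat_smul]
    rw [← h1, ← h2]
  · exact (hd.const_smul (Real.cosh r)).sub (hdn.const_smul (Real.sinh r))
  · exact (hdn.const_smul (Real.cosh r)).sub (hd.const_smul (Real.sinh r))


/-! ### A mountain pass lemma -/

section MountainPass

variable {Z : Type*} [TopologicalSpace Z] {g : Z → ℝ}

/-- A path is compact, so it stays strictly below the level. Consequently the mountain pass level is
not itself a level at which the two points are joined. -/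
theorem exists_joinedIn_lt (hg : Continuous g) {c : ℝ} {p q : Z}
    (h : JoinedIn {z | g z < c} p q) : ∃ c' < c, JoinedIn {z | g z < c'} p q := by
  obtain ⟨γ, hγ⟩ := h
  obtain ⟨t, -, ht⟩ := isCompact_univ.exists_isMaxOn Set.univ_nonempty
    (hg.comp γ.continuous).continuousOn
  have h1 : g (γ t) < c := hγ t
  refine ⟨(g (γ t) + c) / 2, by linarith, γ, fun s => ?_⟩
  have h2 : g (γ s) ≤ g (γ t) := ht (Set.mem_univ s)
  show g (γ s) < _
  linarith

/-- If every point is a strict local minimum or regular, then there is at most one strict local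
minimum. -/
theorem eq_of_strict_min [T2Space Z] [ConnectedSpace Z] [LocallyPathConnectedSpace Z]
    (hg : Continuous g) (hc : ∀ c, IsCompact {z | g z ≤ c})
    (hz : ∀ z, (∀ᶠ y in 𝓝[≠] z, g z < g y) ∨ ∃ W, IsOpen W ∧ z ∈ W ∧
      IsPathConnected (W ∩ {y | g y < g z}) ∧
      W ∩ {y | g y ≤ g z} ⊆ closure (W ∩ {y | g y < g z}))
    {p q : Z} (hp : ∀ᶠ y in 𝓝[≠] p, g p < g y) (hq : ∀ᶠ y in 𝓝[≠] q, g q < g y) : p = q := by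
  by_contra hpq
  have hopen : ∀ c, IsOpen {z | g z < c} := fun c => isOpen_lt hg continuous_const
  -- The infimum `m` of these levels is the mountain pass level.
  set C := {c : ℝ | JoinedIn {z | g z < c} p q} with hC
  have hCne : C.Nonempty := by
    have : PathConnectedSpace Z := .of_locallyPathConnectedSpace
    obtain ⟨γ⟩ := PathConnectedSpace.joined p q
    obtain ⟨t, -, ht⟩ := isCompact_univ.exists_isMaxOn Set.univ_nonempty
      (hg.comp γ.continuous).continuousOn
    refine ⟨g (γ t) + 1, γ, fun s => ?_⟩
    have h2 : g (γ s) ≤ g (γ t) := ht (Set.mem_univ s)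
    show g (γ s) < _
    linarith
  have hCp : ∀ c ∈ C, g p < c := fun c hc =>
    (show JoinedIn {z | g z < c} p q from hc).source_mem
  have hCq : ∀ c ∈ C, g q < c := fun c hc =>
    (show JoinedIn {z | g z < c} p q from hc).target_mem
  have hbdd : BddBelow C := ⟨g p, fun c hc => (hCp c hc).le⟩
  set m := sInf C with hm
  have hgp : g p ≤ m := le_csInf hCne fun c hc => (hCp c hc).le
  have hgq : g q ≤ m := le_csInf hCne fun c hc => (hCq c hc).le
  have hnj : ¬ JoinedIn {z | g z < m} p q := fun h => by
    obtain ⟨c', h1, h2⟩ := exists_joinedIn_lt hg h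
    exact absurd (csInf_le hbdd (show c' ∈ C from h2)) (not_le.2 h1)
  set L := {z | g z ≤ m} with hL
  -- A relatively open and closed piece `D` of {g ≤ m} that contains p but not q: the closure of the
  -- path component of p in {g < m}, within {g ≤ m}. Strict minima at level m are not in that
  -- closure. At a regular point of it the strict sublevel set is locally connected, hence in the
  -- same component, and its closure fills the sublevel set locally.
  obtain ⟨D, hDL, hDcl, hpD, hqD, hDo⟩ : ∃ D ⊆ L, IsClosed D ∧ p ∈ D ∧ q ∉ D ∧
      ∀ z ∈ D, ∃ W, IsOpen W ∧ z ∈ W ∧ W ∩ L ⊆ D := by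
    have hLcl : IsClosed L := isClosed_le hg continuous_const
    rcases hgp.lt_or_eq with hlt | heq
    · set P := pathComponentIn {z | g z < m} p with hP
      have hPo : IsOpen P := (hopen m).pathComponentIn p
      have hPsub : P ⊆ {z | g z < m} := pathComponentIn_subset
      have hPmem : ∀ z ∈ closure P, g z < m → z ∈ P := by
        intro z hz hzm
        have ho := (hopen m).pathComponentIn z
        obtain ⟨y, hy1, hy2⟩ := mem_closure_iff.1 hz _ ho (mem_pathComponentIn_self hzm)
        exact JoinedIn.trans hy2 (JoinedIn.symm hy1)
      have hPstrict : ∀ z ∈ closure P, g z = m → ¬ ∀ᶠ y in 𝓝[≠] z, g z < g y := by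
        intro z hz hzm hs
        rw [eventually_nhdsWithin_iff] at hs
        obtain ⟨W, hW, hWo, hzW⟩ := eventually_nhds_iff.1 hs
        obtain ⟨y, hy1, hy2⟩ := mem_closure_iff.1 hz W hWo hzW
        have hym : g y < m := hPsub hy2
        have hne : y ≠ z := by rintro rfl; linarith
        have := hW y hy1 hne
        linarith
      refine ⟨L ∩ closure P, Set.inter_subset_left, hLcl.inter isClosed_closure,
        ⟨hgp, subset_closure (mem_pathComponentIn_self hlt)⟩, ?_, ?_⟩
      · rintro ⟨-, hqP⟩
        rcases hgq.lt_or_eq with hq1 | hq1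
        · exact hnj (hPmem q hqP hq1)
        · exact hPstrict q hqP hq1 hq
      · rintro z ⟨hzL, hzP⟩
        rcases (show g z ≤ m from hzL).lt_or_eq with hz1 | hz1
        · exact ⟨P, hPo, hPmem z hzP hz1, fun y hy => ⟨hy.2, subset_closure hy.1⟩⟩
        · obtain ⟨W, hWo, hzW, hWc, hWcl⟩ := (hz z).resolve_left (hPstrict z hzP hz1)
          rw [hz1] at hWc hWcl
          refine ⟨W, hWo, hzW, fun y hy => ⟨hy.2, ?_⟩⟩
          obtain ⟨w, hw1, hw2⟩ := mem_closure_iff.1 hzP W hWo hzW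
          have hsub : W ∩ {y | g y < m} ⊆ P := fun y' hy' =>
            JoinedIn.trans hw2 ((hWc.joinedIn w ⟨hw1, hPsub hw2⟩ y' hy').mono
              Set.inter_subset_right)
          exact closure_mono hsub (hWcl hy)
    -- If g p = m the open sublevel set does not contain p, and the strict minimum is by itself an
    -- isolated piece.
    · refine ⟨{p}, by simpa [hL] using hgp, ?_, rfl, fun h => hpq (by simpa using h.symm), ?_⟩
      · exact isClosed_singleton
      · rintro z rfl
        rw [eventually_nhdsWithin_iff] at hp
        obtain ⟨W, hW, hWo, hzW⟩ := eventually_nhds_iff.1 hp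
        refine ⟨W, hWo, hzW, fun y hy => ?_⟩
        by_contra hne
        have h1 := hW y hy.1 hne
        have h2 : g y ≤ m := hy.2
        linarith
  have hLD : IsClosed (L \ D) := by
    choose! W hW1 hW2 hW3 using hDo
    have : L \ D = L ∩ (⋃ z ∈ D, W z)ᶜ := by
      ext y
      simp only [Set.mem_sdiff, Set.mem_inter_iff, Set.mem_compl_iff, Set.mem_iUnion, not_exists]
      refine and_congr_right fun hy => ⟨fun h z hz hyW => h (hW3 z hz ⟨hyW, hy⟩),
        fun h hyD => h y hyD (hW2 y hyD)⟩
    rw [this]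
    exact (hc m).isClosed.inter (isOpen_biUnion fun z hz => hW1 z hz).isClosed_compl
  obtain ⟨U₁, U₂, hU₁, hU₂, hD₁, hD₂, hdisj⟩ := SeparatedNhds.of_isCompact_isCompact
    ((hc m).of_isClosed_subset hDcl hDL) ((hc m).of_isClosed_subset hLD Set.sdiff_subset)
    Set.disjoint_sdiff_right
  have hLU : L ⊆ U₁ ∪ U₂ := fun z hz => by
    by_cases h : z ∈ D
    · exact Or.inl (hD₁ h)
    · exact Or.inr (hD₂ ⟨hz, h⟩)
  -- By compactness, sublevel sets slightly above m still lie in the disjoint union of the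
  -- neighbourhoods of the two pieces, so a path from p to q at such a level would be disconnected.
  obtain ⟨c₁, hc₁, hcU⟩ : ∃ c₁ > m, {z | g z < c₁} ⊆ U₁ ∪ U₂ := by
    set A := {z | g z ≤ m + 1} \ (U₁ ∪ U₂) with hA
    have hAc : IsCompact A := (hc (m + 1)).diff (hU₁.union hU₂)
    rcases A.eq_empty_or_nonempty with h0 | h0
    · refine ⟨m + 1, by linarith, fun z hz => ?_⟩
      by_contra h
      have : z ∈ A := ⟨(show g z < m + 1 from hz).le, h⟩
      rw [h0] at this
      exact this
    · obtain ⟨a, ha, hmin⟩ := hAc.exists_isMinOn h0 hg.continuousOn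
      refine ⟨min (g a) (m + 1), ?_, fun z hz => ?_⟩
      · refine lt_min ?_ (by linarith)
        by_contra h
        exact ha.2 (hLU (not_lt.1 h))
      · by_contra h
        have hz' : g z < min (g a) (m + 1) := hz
        have : z ∈ A := ⟨(hz'.trans_le (min_le_right _ _)).le, h⟩
        exact absurd (hmin this) (not_le.2 (hz'.trans_le (min_le_left _ _)))
  obtain ⟨c, hcC, hcc⟩ := exists_lt_of_csInf_lt hCne hc₁
  obtain ⟨γ, hγ⟩ := (show JoinedIn {z | g z < c} p q from hcC)
  have hrange : Set.range γ ⊆ U₁ ∪ U₂ := by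
    rintro _ ⟨t, rfl⟩
    exact hcU (lt_trans (hγ t) hcc)
  have hpre : IsPreconnected (Set.range γ) := isPreconnected_range γ.continuous
  obtain ⟨z, -, hz1, hz2⟩ := hpre U₁ U₂ hU₁ hU₂ hrange ⟨p, ⟨0, γ.source⟩, hD₁ hpD⟩
    ⟨q, ⟨1, γ.target⟩, hD₂ ⟨hgq, hqD⟩⟩
  exact Set.disjoint_left.1 hdisj hz1 hz2

end MountainPass

/-! ### Local structure of functions on the plane -/

/-- The derivative of s ↦ h(su) is s B(u, u) up to an error of at most (m/2) s ‖u‖², where B ≥ m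
‖·‖²; so h increases strictly along each short ray. -/
theorem eventually_lt_of_hess_pos {h : Plane → ℝ} (h2 : ContDiffAt ℝ 2 h 0)
    (h1 : fderiv ℝ h 0 = 0) (hp : ∀ v, v ≠ 0 → 0 < fderiv ℝ (fderiv ℝ h) 0 v v) :
    ∀ᶠ u in 𝓝[≠] 0, h 0 < h u := by
  set B := fderiv ℝ (fderiv ℝ h) 0 with hB
  obtain ⟨m, hm, hmB⟩ : ∃ m > 0, ∀ v, m * ‖v‖ ^ 2 ≤ B v v := by
    have hc : Continuous fun v : Plane => B v v := by fun_prop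
    obtain ⟨v₀, hv₀, hmin⟩ := (isCompact_sphere (0 : Plane) 1).exists_isMinOn
      ⟨pb 0, by simp [pb]⟩ hc.continuousOn
    refine ⟨B v₀ v₀, hp _ (by rintro rfl; simp at hv₀), fun v => ?_⟩
    by_cases hv : v = 0
    · simp [hv]
    · have hn : ‖v‖ ≠ 0 := norm_ne_zero_iff.2 hv
      have hs : ‖v‖⁻¹ • v ∈ Metric.sphere (0 : Plane) 1 := by
        simp [norm_smul, hn]
      have h3 : B v₀ v₀ ≤ B (‖v‖⁻¹ • v) (‖v‖⁻¹ • v) := hmin hs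
      simp only [map_smul, smul_apply, smul_eq_mul] at h3
      have e : B v v = ‖v‖⁻¹ * (‖v‖⁻¹ * B v v) * ‖v‖ ^ 2 := by field_simp
      rw [e]
      gcongr
  have hd : HasFDerivAt (fderiv ℝ h) B 0 :=
    ((h2.fderiv_right (m := 1) (by norm_num)).differentiableAt (by norm_num)).hasFDerivAt
  have ho := (hasFDerivAt_iff_isLittleO_nhds_zero.1 hd).def (half_pos hm)
  simp only [zero_add, h1, sub_zero] at ho
  have hdiff : ∀ᶠ u in 𝓝 (0 : Plane), ContDiffAt ℝ 2 h u := h2.eventually (by norm_num)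
  obtain ⟨ε, hε, hball⟩ := Metric.eventually_nhds_iff_ball.1 (ho.and hdiff)
  rw [eventually_nhdsWithin_iff]
  filter_upwards [Metric.ball_mem_nhds (0 : Plane) hε] with u hu hu0
  have hmem : ∀ s ∈ Set.Icc (0 : ℝ) 1, s • u ∈ Metric.ball (0 : Plane) ε := by
    intro s hs
    rw [mem_ball_zero_iff] at hu ⊢
    rw [norm_smul, Real.norm_of_nonneg hs.1]
    exact lt_of_le_of_lt (mul_le_of_le_one_left (norm_nonneg _) hs.2) hu
  have hderiv : ∀ s ∈ Set.Icc (0 : ℝ) 1, HasDerivAt (fun s : ℝ => h (s • u))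
      (fderiv ℝ h (s • u) u) s := by
    intro s hs
    have hh := ((hball _ (hmem s hs)).2.differentiableAt (by norm_num)).hasFDerivAt
    have hl : HasDerivAt (fun s : ℝ => s • u) u s := by
      simpa using (hasDerivAt_id s).smul_const u
    exact hh.comp_hasDerivAt s hl
  have hmono : StrictMonoOn (fun s : ℝ => h (s • u)) (Set.Icc 0 1) := by
    refine strictMonoOn_of_deriv_pos (convex_Icc 0 1)
      (fun s hs => (hderiv s hs).continuousAt.continuousWithinAt) fun s hs => ?_
    rw [interior_Icc] at hs
    have hs' : s ∈ Set.Icc (0 : ℝ) 1 := ⟨hs.1.le, hs.2.le⟩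
    rw [(hderiv s hs').deriv]
    have h4 := (hball _ (hmem s hs')).1
    have h5 := (fderiv ℝ h (s • u) - B (s • u)).le_opNorm u
    have h6 : ‖(fderiv ℝ h (s • u) - B (s • u)) u‖ ≤ m / 2 * ‖s • u‖ * ‖u‖ :=
      h5.trans (by gcongr)
    rw [Real.norm_eq_abs, norm_smul, Real.norm_of_nonneg hs.1.le] at h6
    have h7 := (abs_le.1 h6).1
    simp only [sub_apply, map_smul, smul_apply,
      smul_eq_mul] at h7
    have h8 := hmB u
    have hu' : 0 < ‖u‖ := norm_pos_iff.2 hu0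
    have h9 : s * (m * ‖u‖ ^ 2) ≤ s * B u u := mul_le_mul_of_nonneg_left h8 hs.1.le
    have h10 : 0 < s * (m * ‖u‖ ^ 2) := by have := hs.1; positivity
    nlinarith
  have := hmono (Set.left_mem_Icc.2 zero_le_one) (Set.right_mem_Icc.2 zero_le_one) zero_lt_one
  simpa using this

/-- The implicit function theorem makes h a coordinate. The image of a small ball in these
coordinates works, since half a ball is convex and its closure contains the part at the critical
level. -/
theorem exists_regular_nhd {h : Plane → ℝ} (h2 : ContDiffAt ℝ 2 h 0) (h1 : fderiv ℝ h 0 ≠ 0)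
    {U : Set Plane} (hU : U ∈ 𝓝 0) : ∃ W ⊆ U, IsOpen W ∧ 0 ∈ W ∧
      IsPathConnected (W ∩ {u | h u < h 0}) ∧
      W ∩ {u | h u ≤ h 0} ⊆ closure (W ∩ {u | h u < h 0}) := by
  have hs : HasStrictFDerivAt h (fderiv ℝ h 0) 0 := h2.hasStrictFDerivAt (by norm_num)
  have hr : (fderiv ℝ h 0 : Plane →ₗ[ℝ] ℝ).range = ⊤ := by
    apply LinearMap.range_eq_top.2
    apply LinearMap.surjective
    intro h0
    apply h1
    ext v : 1
    exact LinearMap.congr_fun h0 v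
  set Φ := hs.implicitToOpenPartialHomeomorph h (fderiv ℝ h 0) hr with hΦ
  have hfst : ∀ u, (Φ u).1 = h u := hs.implicitToOpenPartialHomeomorph_fst hr
  have h0 : (0 : Plane) ∈ Φ.source := hs.mem_implicitToOpenPartialHomeomorph_source hr
  have hsymm : ContinuousAt Φ.symm (Φ 0) := Φ.continuousAt_symm (Φ.map_source h0)
  have hnear : ∀ᶠ z in 𝓝 (Φ 0), z ∈ Φ.target ∧ Φ.symm z ∈ U := by
    refine (Φ.open_target.eventually_mem (Φ.map_source h0)).and (hsymm ?_)
    rwa [Φ.left_inv h0]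
  obtain ⟨ε, hε, hb⟩ := Metric.eventually_nhds_iff_ball.1 hnear
  set b := Metric.ball (Φ 0) ε with hbdef
  have hbt : b ⊆ Φ.target := fun z hz => (hb z hz).1
  have himg : ∀ P : ℝ → Prop, Φ.symm '' b ∩ {u | P (h u)} = Φ.symm '' (b ∩ {z | P z.1}) := by
    intro P
    ext u
    constructor
    · rintro ⟨⟨z, hz, rfl⟩, hP⟩
      refine ⟨z, ⟨hz, ?_⟩, rfl⟩
      have := hfst (Φ.symm z)
      rw [Φ.right_inv (hbt hz)] at this
      show P z.1
      rw [this]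
      exact hP
    · rintro ⟨z, ⟨hz, hP⟩, rfl⟩
      refine ⟨⟨z, hz, rfl⟩, ?_⟩
      show P (h (Φ.symm z))
      rw [← hfst, Φ.right_inv (hbt hz)]
      exact hP
  have hconv : Convex ℝ (b ∩ {z | z.1 < h 0}) :=
    (convex_ball _ _).inter (convex_halfSpace_lt (LinearMap.fst ℝ ℝ _).isLinear _)
  have hbelow : ∀ z ∈ b, z.1 ≤ h 0 → ∀ δ : ℝ, 0 < δ → ∃ z' ∈ b, z'.1 < h 0 ∧ dist z' z < δ := by
    intro z hz hz1 δ hδ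
    obtain ⟨ρ, hρ, hρb⟩ := Metric.isOpen_ball.mem_nhds hz |> Metric.mem_nhds_iff.1
    have hdist : dist (z.1 - min ρ δ / 2, z.2) z = min ρ δ / 2 := by
      rw [Prod.dist_eq]
      have : 0 < min ρ δ := lt_min hρ hδ
      simp [abs_of_pos this]
      positivity
    have hpos : 0 < min ρ δ := lt_min hρ hδ
    refine ⟨(z.1 - min ρ δ / 2, z.2), hρb ?_, ?_, ?_⟩
    · rw [Metric.mem_ball, hdist]
      linarith [min_le_left ρ δ]
    · show z.1 - min ρ δ / 2 < h 0
      linarith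
    · rw [hdist]
      linarith [min_le_right ρ δ]
  refine ⟨Φ.symm '' b, ?_, ?_, ?_, ?_, ?_⟩
  · rintro _ ⟨z, hz, rfl⟩
    exact (hb z hz).2
  · exact Φ.symm.isOpen_image_of_subset_source Metric.isOpen_ball hbt
  · exact ⟨Φ 0, Metric.mem_ball_self hε, Φ.left_inv h0⟩
  · rw [himg (fun t => t < h 0)]
    refine IsPathConnected.image' (hconv.isPathConnected ?_)
      (Φ.continuousOn_symm.mono fun z hz => hbt hz.1)
    obtain ⟨z', h3, h4, -⟩ := hbelow (Φ 0) (Metric.mem_ball_self hε) (hfst 0).le 1 one_pos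
    exact ⟨z', h3, h4⟩
  · rw [himg (fun t => t < h 0), himg (fun t => t ≤ h 0)]
    rintro _ ⟨z, ⟨hz, hz1⟩, rfl⟩
    have hcl : z ∈ closure (b ∩ {z | z.1 < h 0}) := by
      rw [Metric.mem_closure_iff]
      intro δ hδ
      obtain ⟨z', h3, h4, h5⟩ := hbelow z hz hz1 δ hδ
      exact ⟨z', ⟨h3, h4⟩, by rwa [dist_comm]⟩
    exact mem_closure_image (Φ.continuousAt_symm (hbt hz)) hcl


/-! ### Distance functions on surfaces with small principal curvatures -/

namespace LParam

variable {T : Set R4} {x : R4} {X : Plane → R4} {n : R4 → R4}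

/-- The mountain pass lemma is applied to the surface as a space of its own, so parametrizations are
needed as open maps into the subtype. -/
theorem toSubtype (h : LParam T x X) : ∃ ξ : Plane → T, ∃ U : Set Plane, IsOpen U ∧ 0 ∈ U ∧
    ContinuousOn ξ U ∧ (∀ u ∈ U, (ξ u : R4) = X u) ∧
    (∀ W ⊆ U, IsOpen W → IsOpen (ξ '' W)) ∧ Set.InjOn ξ U := by
  classical
  obtain ⟨U, V, ψ, hUo, hVo, h0, hx, -, h1, h2, h3⟩ := h.chart univ_mem
  have hξ : ∀ u ∈ U, X u ∈ T := fun u hu => (h1 u hu).1.2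
  -- Away from the chart domain the value is irrelevant; the centre serves as default.
  set ξ : Plane → T := fun u => if hu : X u ∈ T then ⟨X u, hu⟩ else ⟨x, h.mem⟩ with hξdef
  have hval : ∀ u ∈ U, (ξ u : R4) = X u := fun u hu => by simp [hξdef, hξ u hu]
  refine ⟨ξ, U, hUo, h0, ?_, hval, ?_, ?_⟩
  · rw [Topology.IsEmbedding.subtypeVal.continuousOn_iff]
    exact ContinuousOn.congr (fun u hu => (h1 u hu).2.2.1.continuousAt.continuousWithinAt) hval
  · intro W hWU hW
    have : ξ '' W = Subtype.val ⁻¹' (V ∩ ψ ⁻¹' W) := by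
      ext z
      constructor
      · rintro ⟨u, hu, rfl⟩
        refine ⟨?_, ?_⟩
        · rw [hval u (hWU hu)]; exact (h1 u (hWU hu)).1.1
        · rw [Set.mem_preimage, hval u (hWU hu), (h1 u (hWU hu)).2.1]; exact hu
      · rintro ⟨hzV, hzW⟩
        refine ⟨ψ z, hzW, Subtype.ext ?_⟩
        rw [hval _ (hWU hzW)]
        exact (h2 z ⟨hzV, z.2⟩).2
    rw [this]
    have hψ : ContinuousOn ψ V := fun y hy => (h3 y hy).continuousAt.continuousWithinAt
    exact (hψ.isOpen_inter_preimage hVo hW).preimage continuous_subtype_val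
  · intro u hu v hv huv
    have := congrArg (fun z : T => ψ z) huv
    simp only [hval u hu, hval v hv] at this
    rwa [(h1 u hu).2.1, (h1 v hv).2.1] at this

end LParam

theorem locallyPathConnectedSpace_of_param {T : Set R4} (hT : ∀ x ∈ T, ∃ X, LParam T x X) :
    LocallyPathConnectedSpace T := by
  rw [locallyPathConnectedSpace_iff_pathComponentIn_mem_nhds]
  rintro ⟨x, hx⟩ u hu hxu
  obtain ⟨X, hX⟩ := hT x hx
  obtain ⟨ξ, U, hUo, h0, hξc, hval, hopen, -⟩ := hX.toSubtype
  have hξ0 : ξ 0 = ⟨x, hx⟩ := Subtype.ext (by rw [hval 0 h0, hX.map_zero])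
  have hW : U ∩ ξ ⁻¹' u ∈ 𝓝 0 :=
    (hξc.isOpen_inter_preimage hUo hu).mem_nhds ⟨h0, by rw [Set.mem_preimage, hξ0]; exact hxu⟩
  obtain ⟨ε, hε, hb⟩ := Metric.mem_nhds_iff.1 hW
  have hbU : Metric.ball 0 ε ⊆ U := fun v hv => (hb hv).1
  have hpc : IsPathConnected (ξ '' Metric.ball 0 ε) :=
    ((convex_ball (0 : Plane) ε).isPathConnected ⟨0, Metric.mem_ball_self hε⟩).image'
      (hξc.mono hbU)
  have hmem : (⟨x, hx⟩ : T) ∈ ξ '' Metric.ball 0 ε := ⟨0, Metric.mem_ball_self hε, hξ0⟩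
  refine mem_of_superset ((hopen _ hbU Metric.isOpen_ball).mem_nhds hmem) ?_
  refine hpc.subset_pathComponentIn hmem ?_
  rintro _ ⟨v, hv, rfl⟩
  exact (hb hv).2

namespace LParam

variable {T : Set R4} {x : R4} {X : Plane → R4} {n : R4 → R4}

/-- The critical points of the distance from `y` are the feet of the perpendiculars from `y`. -/
theorem exists_eq_zeta (h : LParam T x X) (hn : LNormal T n) {y : R4} (hy : y ∈ Hyp4)
    (hc : ∀ v, eta y (fderiv ℝ X 0 v) = 0) : ∃ t, y = zeta x (n x) t := by
  have hx := hn.sub h.mem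
  have hxx := eta_self_hyp4 hx
  have hyy := eta_self_hyp4 hy
  have hnx := hn.tangent x h.mem
  have hnn := hn.unit x h.mem
  set z := y + eta y x • x with hz
  have hz1 : z = eta z (n x) • n x := by
    refine eq_smul_normal hx (h.tangent_zero hn.sub (pb 0)) (h.tangent_zero hn.sub (pb 1)) hnx ?_
      (h.normal_zero hn _) (h.normal_zero hn _) ?_ ?_ hnn (indep_of_injective h.immersion)
    · rw [hz, eta_add_left, eta_smul_left, hxx]; ring
    · rw [hz, eta_add_left, eta_smul_left, hc, eta_comm x, h.tangent_zero hn.sub]; ring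
    · rw [hz, eta_add_left, eta_smul_left, hc, eta_comm x, h.tangent_zero hn.sub]; ring
  set b := eta z (n x) with hb
  set a := -eta y x with ha
  have ha1 : 1 ≤ a := one_le_neg_eta hy hx
  have hyab : y = a • x + b • n x := by
    rw [← hz1, hz, ha]; module
  refine ⟨-Real.arsinh b, ?_⟩
  have hab : a ^ 2 = 1 + b ^ 2 := by
    rw [hyab] at hyy
    simp only [eta_add_left, eta_add_right, eta_smul_left, eta_smul_right, hxx, hnn, hnx,
      eta_comm x (n x)] at hyy
    linarith
  rw [zeta, Real.cosh_neg, Real.sinh_neg, Real.sinh_arsinh, Real.cosh_arsinh, ← hab,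
    Real.sqrt_sq (by linarith)]
  conv_lhs => rw [hyab]
  module

theorem eta_zeta (h : LParam T x X) (hn : LNormal T n) (t : ℝ) (v : Plane) :
    eta (zeta x (n x) t) (fderiv ℝ X 0 v) = 0 := by
  rw [zeta, eta_sub_left, eta_smul_left, eta_smul_left, h.normal_zero hn, eta_comm x,
    h.tangent_zero hn.sub]
  ring

theorem height_contDiffAt (h : LParam T x X) (y : R4) :
    ContDiffAt ℝ 2 (fun u => -eta y (X u)) 0 :=
  (etaL y).contDiff.contDiffAt.comp (0 : Plane) h.contDiffAt |>.neg

theorem height_fderiv {y : R4} {u : Plane} (h : DifferentiableAt ℝ X u) :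
    fderiv ℝ (fun u => -eta y (X u)) u = -(etaL y).comp (fderiv ℝ X u) :=
  (((etaL y).hasFDerivAt.comp u h.hasFDerivAt).neg).fderiv

theorem height_hess (h : LParam T x X) (y : R4) (v w : Plane) :
    fderiv ℝ (fderiv ℝ (fun u => -eta y (X u))) 0 v w =
      -eta y (fderiv ℝ (fderiv ℝ X) 0 v w) := by
  have e : fderiv ℝ (fun u => -eta y (X u)) =ᶠ[𝓝 0]
      fun u => -(etaL y).comp (fderiv ℝ X u) := by
    filter_upwards [h.eventually_contDiffAt] with u hu
    exact height_fderiv (hu.differentiableAt (by norm_num))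
  rw [e.fderiv_eq]
  have hd : DifferentiableAt ℝ (fderiv ℝ X) 0 :=
    h.contDiffAt_fderiv.differentiableAt (by norm_num)
  have := ((((ContinuousLinearMap.compL ℝ Plane R4 ℝ) (etaL y)).hasFDerivAt.comp (0 : Plane)
    hd.hasFDerivAt).neg).fderiv
  exact congrArg (fun A : Plane →L[ℝ] Plane →L[ℝ] ℝ => A v w) this

/-- The Hessian of cosh d(y, ·) at a foot is cosh t · I + sinh t · II: this is where small principal
curvatures are decisive. -/
theorem height_hess_pos (h : LParam T x X) (hn : LNormal T n) (hs : SmallForms T n) (t : ℝ)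
    {v : Plane} (hv : v ≠ 0) :
    0 < fderiv ℝ (fderiv ℝ (fun u => -eta (zeta x (n x) t) (X u))) 0 v v := by
  rw [h.height_hess, zeta, eta_sub_left, eta_smul_left, eta_smul_left, h.eta_hess hn.sub,
    h.normal_hess hn]
  have h1 := abs_lt.1 (hs x h.mem X h v hv)
  have h2 := Real.cosh_pos t
  have h3 : |Real.sinh t| < Real.cosh t := by
    apply abs_lt_of_sq_lt_sq _ h2.le
    have := Real.cosh_sq t
    linarith
  have h4 := abs_lt.1 h3
  nlinarith

end LParam

/-- A point has only one foot on a connected closed surface with small principal curvatures. -/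
theorem foot_unique {T : Set R4} {n : R4 → R4} (hn : LNormal T n)
    (hT : ∀ x ∈ T, ∃ X, LParam T x X) (hcl : IsClosed T) (hconn : IsConnected T)
    (hs : SmallForms T n) {p q : R4} (hp : p ∈ T) (hq : q ∈ T) {t s : ℝ}
    (hpq : zeta p (n p) t = zeta q (n q) s) : p = q := by
  have : ConnectedSpace T := isConnected_iff_connectedSpace.1 hconn
  have := locallyPathConnectedSpace_of_param hT
  set y := zeta p (n p) t with hy
  have hyH : y ∈ Hyp4 := zeta_mem (hn.sub hp) (hn.tangent p hp) (hn.unit p hp) t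
  set g : T → ℝ := fun z => -eta y z with hg
  have hgc : Continuous g := by
    have : Continuous fun z : R4 => -eta y z :=
      (continuous_eta.comp (continuous_const.prodMk continuous_id)).neg
    exact this.comp continuous_subtype_val
  have hcomp : ∀ c, IsCompact {z | g z ≤ c} := by
    intro c
    have hy0 := pos_of_mem_hyp4 hyH
    have h1 := (isCompact_bounded (2 * (y 0 + y 1) * c)).inter_right hcl
    refine (hcl.isClosedEmbedding_subtypeVal.isCompact_preimage h1).of_isClosed_subset
      (isClosed_le hgc continuous_const) fun z hz => ⟨⟨hn.sub z.2, ?_⟩, z.2⟩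
    have h2 := add_le_mul_neg_eta (hn.sub z.2) hyH
    rw [eta_comm] at h2
    have h3 : -eta y z ≤ c := hz
    nlinarith
  have hcrit : ∀ z : T, (∃ r, y = zeta z (n z) r) → ∀ᶠ w in 𝓝[≠] z, g z < g w := by
    rintro ⟨z, hz⟩ ⟨r, hr⟩
    obtain ⟨X, hX⟩ := hT z hz
    obtain ⟨ξ, U, hUo, h0, hξc, hval, hopen, hinj⟩ := hX.toSubtype
    have hξ0 : ξ 0 = ⟨z, hz⟩ := Subtype.ext (by rw [hval 0 h0, hX.map_zero])
    have hmin : ∀ᶠ u in 𝓝[≠] (0 : Plane), -eta y (X 0) < -eta y (X u) := by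
      refine eventually_lt_of_hess_pos (hX.height_contDiffAt y) ?_ fun v hv => ?_
      · rw [LParam.height_fderiv hX.differentiableAt]
        ext v : 1
        have := hX.eta_zeta hn r v
        rw [← hr] at this
        simpa using this
      · have := hX.height_hess_pos hn hs r hv
        rw [← hr] at this
        exact this
    rw [eventually_nhdsWithin_iff] at hmin ⊢
    obtain ⟨W, hW, hWo, hW0⟩ := eventually_nhds_iff.1 hmin
    have hm : ξ '' (U ∩ W) ∈ 𝓝 (⟨z, hz⟩ : T) :=
      (hopen _ Set.inter_subset_left (hUo.inter hWo)).mem_nhds ⟨0, ⟨h0, hW0⟩, hξ0⟩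
    filter_upwards [hm]
    rintro w ⟨u, ⟨huU, huW⟩, rfl⟩ hne
    have hu0 : u ≠ 0 := by
      rintro rfl
      exact hne hξ0
    have h3 := hW u huW hu0
    show -eta y z < -eta y (ξ u)
    rwa [hval u huU, ← hX.map_zero]
  -- Critical points are feet of perpendiculars, hence strict minima by `hcrit`; all other points
  -- are regular.
  have hreg : ∀ z : T, (∀ᶠ w in 𝓝[≠] z, g z < g w) ∨ ∃ W, IsOpen W ∧ z ∈ W ∧
      IsPathConnected (W ∩ {w | g w < g z}) ∧
      W ∩ {w | g w ≤ g z} ⊆ closure (W ∩ {w | g w < g z}) := by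
    rintro ⟨z, hz⟩
    obtain ⟨X, hX⟩ := hT z hz
    by_cases hd : fderiv ℝ (fun u => -eta y (X u)) 0 = 0
    · left
      refine hcrit _ (hX.exists_eq_zeta hn hyH fun v => ?_)
      rw [LParam.height_fderiv hX.differentiableAt] at hd
      simpa using DFunLike.congr_fun hd v
    · right
      obtain ⟨ξ, U, hUo, h0, hξc, hval, hopen, hinj⟩ := hX.toSubtype
      have hξ0 : ξ 0 = ⟨z, hz⟩ := Subtype.ext (by rw [hval 0 h0, hX.map_zero])
      obtain ⟨W, hWU, hWo, hW0, hWc, hWcl⟩ :=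
        exists_regular_nhd (hX.height_contDiffAt y) hd (hUo.mem_nhds h0)
      have hgξ : ∀ u ∈ U, g (ξ u) = -eta y (X u) := fun u hu => by rw [hg, ← hval u hu]
      have hgz : g ⟨z, hz⟩ = -eta y (X 0) := by rw [← hξ0, hgξ 0 h0]
      have himg : ∀ P : ℝ → Prop, ξ '' W ∩ {w | P (g w)} =
          ξ '' (W ∩ {u | P (-eta y (X u))}) := by
        intro P
        ext w
        constructor
        · rintro ⟨⟨u, hu, rfl⟩, hP⟩
          have hP' : P (g (ξ u)) := hP
          rw [hgξ u (hWU hu)] at hP'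
          exact ⟨u, ⟨hu, hP'⟩, rfl⟩
        · rintro ⟨u, ⟨hu, hP⟩, rfl⟩
          refine ⟨⟨u, hu, rfl⟩, ?_⟩
          show P (g (ξ u))
          rw [hgξ u (hWU hu)]
          exact hP
      refine ⟨ξ '' W, hopen W hWU hWo, ⟨0, hW0, hξ0⟩, ?_, ?_⟩
      · rw [himg (fun c => c < _), hgz]
        exact hWc.image' (hξc.mono fun u hu => hWU hu.1)
      · rw [himg (fun c => c < _), himg (fun c => c ≤ _), hgz]
        rintro _ ⟨u, hu, rfl⟩
        exact mem_closure_image (hξc.continuousAt (hUo.mem_nhds (hWU hu.1))) (hWcl hu)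
  have := eq_of_strict_min hgc hcomp hreg (hcrit ⟨p, hp⟩ ⟨t, hy⟩) (hcrit ⟨q, hq⟩ ⟨s, hpq⟩)
  exact congrArg Subtype.val this


theorem _root_.Continuous.eta {α : Type*} [TopologicalSpace α] {f g : α → R4}
    (hf : Continuous f) (hg : Continuous g) : Continuous fun z => eta (f z) (g z) :=
  continuous_eta.comp (hf.prodMk hg)

/-! ### The topology of hyperbolic space -/

/-- The inverse of the global chart of the hyperboloid. -/
noncomputable def hypInv (p : ℝ × ℝ × ℝ) : R4 :=
  ![Real.sqrt (1 + p.1 ^ 2 + p.2.1 ^ 2 + p.2.2 ^ 2) + p.1,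
    Real.sqrt (1 + p.1 ^ 2 + p.2.1 ^ 2 + p.2.2 ^ 2) - p.1, p.2.1, p.2.2]

theorem hypInv_mem (p : ℝ × ℝ × ℝ) : hypInv p ∈ Hyp4 := by
  have h : Real.sqrt (1 + p.1 ^ 2 + p.2.1 ^ 2 + p.2.2 ^ 2) ^ 2 =
    1 + p.1 ^ 2 + p.2.1 ^ 2 + p.2.2 ^ 2 := Real.sq_sqrt (by positivity)
  have h2 : |p.1| < Real.sqrt (1 + p.1 ^ 2 + p.2.1 ^ 2 + p.2.2 ^ 2) := by
    apply Real.lt_sqrt_of_sq_lt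
    rw [sq_abs]
    nlinarith [sq_nonneg p.2.1, sq_nonneg p.2.2]
  have h3 := abs_lt.1 h2
  constructor
  · show 0 < Real.sqrt (1 + p.1 ^ 2 + p.2.1 ^ 2 + p.2.2 ^ 2) + p.1
    linarith
  · show (Real.sqrt (1 + p.1 ^ 2 + p.2.1 ^ 2 + p.2.2 ^ 2) + p.1) *
      (Real.sqrt (1 + p.1 ^ 2 + p.2.1 ^ 2 + p.2.2 ^ 2) - p.1) = 1 + p.2.1 ^ 2 + p.2.2 ^ 2
    linear_combination h

theorem continuous_hypInv : Continuous hypInv := by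
  refine continuous_pi fun i => ?_
  fin_cases i <;> simp [hypInv] <;> fun_prop

theorem hypInv_coe4 (x : Hyp) :
    hypInv ((coe4 x 0 - coe4 x 1) / 2, coe4 x 2, coe4 x 3) = coe4 x := by
  obtain ⟨h1, h2⟩ := pos_of_mem_hyp4 (coe4_mem x)
  have h3 := (coe4_mem x).2
  have h : Real.sqrt (1 + ((coe4 x 0 - coe4 x 1) / 2) ^ 2 + coe4 x 2 ^ 2 + coe4 x 3 ^ 2) =
      (coe4 x 0 + coe4 x 1) / 2 := by
    rw [Real.sqrt_eq_iff_mul_self_eq (by positivity) (by positivity)]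
    linear_combination -h3
  funext i
  fin_cases i
  · simp [hypInv, h]; ring
  · simp [hypInv, h]; ring
  · simp [hypInv]
  · simp [hypInv]

/-- Hyperbolic space is homeomorphic to Euclidean space. -/
noncomputable def hypHomeo : Hyp ≃ₜ ℝ × ℝ × ℝ where
  toFun x := ((coe4 x 0 - coe4 x 1) / 2, coe4 x 2, coe4 x 3)
  invFun p := ofHyp4 (hypInv p) (hypInv_mem p)
  left_inv x := coe4_injective ((coe4_ofHyp4 _ _).trans (hypInv_coe4 x))
  right_inv p := by
    have h : coe4 (ofHyp4 (hypInv p) (hypInv_mem p)) = hypInv p := coe4_ofHyp4 _ _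
    refine Prod.ext ?_ (Prod.ext ?_ ?_)
    · refine (congrArg (fun v : R4 => (v 0 - v 1) / 2) h).trans ?_
      simp [hypInv]
    · exact congrFun h 2
    · exact congrFun h 3
  continuous_toFun := by
    have : Continuous fun v : R4 => ((v 0 - v 1) / 2, v 2, v 3) := by fun_prop
    exact this.comp continuous_coe4
  continuous_invFun := by
    refine isEmbedding_coe4.continuous_iff.2 ?_
    have : coe4 ∘ (fun p => ofHyp4 (hypInv p) (hypInv_mem p)) = hypInv :=
      funext fun p => coe4_ofHyp4 _ _
    rw [this]
    exact continuous_hypInv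

instance : ContractibleSpace Hyp := hypHomeo.contractibleSpace

instance : LocallyPathConnectedSpace Hyp := hypHomeo.isOpenEmbedding.locallyPathConnectedSpace

instance : LocallyCompactSpace Hyp := hypHomeo.isClosedEmbedding.locallyCompactSpace

/-- Simply connected spaces are unicoherent. -/
theorem isPreconnected_inter_of_union_eq_univ {Y : Type*} [TopologicalSpace Y]
    [SimplyConnectedSpace Y] [LocallyPathConnectedSpace Y] [NormalSpace Y] {A B : Set Y}
    (hA : IsClosed A) (hB : IsClosed B) (hAc : IsPreconnected A) (hBc : IsPreconnected B)
    (hAB : A ∪ B = Set.univ) : IsPreconnected (A ∩ B) := by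
  classical
  rw [isPreconnected_iff_subset_of_disjoint_closed]
  intro u v hu hv huv hdisj
  by_contra! hcon
  obtain ⟨hnu, hnv⟩ := hcon
  obtain ⟨p, hp, hpu⟩ := Set.not_subset.1 hnu
  obtain ⟨q, hq, hqv⟩ := Set.not_subset.1 hnv
  have hpv : p ∈ v := (huv hp).resolve_left hpu
  have hqu : q ∈ u := (huv hq).resolve_right hqv
  obtain ⟨f, hf0, hf1, -⟩ := exists_continuous_zero_one_of_isClosed
    ((hA.inter hB).inter hu) ((hA.inter hB).inter hv) (by
      rw [Set.disjoint_left]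
      rintro z ⟨h1, h2⟩ ⟨-, h3⟩
      have : z ∈ A ∩ B ∩ (u ∩ v) := ⟨h1, h2, h3⟩
      rw [hdisj] at this
      exact this)
  -- The angles πf on `A` and -πf on `B` agree modulo 2π on the intersection, where f is 0 or 1. If
  -- the intersection were separated, going from p to q through `A` and back through `B` would wind
  -- once around the circle.
  set F : Y → Circle := fun y => if y ∈ A then Circle.exp (Real.pi * f y) else
    Circle.exp (-(Real.pi * f y)) with hF
  have hFA : ∀ y ∈ A, F y = Circle.exp (Real.pi * f y) := fun y hy => if_pos hy
  have hFB : ∀ y ∈ B, F y = Circle.exp (-(Real.pi * f y)) := by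
    intro y hy
    by_cases hyA : y ∈ A
    · rw [hFA y hyA, Circle.exp_eq_exp]
      rcases huv ⟨hyA, hy⟩ with h | h
      · have : f y = 0 := hf0 ⟨⟨hyA, hy⟩, h⟩
        exact ⟨0, by simp [this]⟩
      · have : f y = 1 := hf1 ⟨⟨hyA, hy⟩, h⟩
        exact ⟨1, by simp [this]; ring⟩
    · exact if_neg hyA
  have hFc : Continuous F := by
    rw [← continuousOn_univ, ← hAB]
    refine ContinuousOn.union_of_isClosed ?_ ?_ hA hB
    · exact ContinuousOn.congr (Continuous.continuousOn (by fun_prop)) hFA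
    · exact ContinuousOn.congr (Continuous.continuousOn (by fun_prop)) hFB
  obtain ⟨e, he⟩ : ∃ e : ℝ, Circle.exp e = F p :=
    ⟨Real.pi * f p, (hFA p hp.1).symm⟩
  obtain ⟨G, ⟨-, hG⟩, -⟩ := Circle.isCoveringMap_exp.existsUnique_continuousMap_lifts ⟨F, hFc⟩ p e he
  have hG' : ∀ y, Circle.exp (G y) = F y := fun y => congrFun hG y
  have hdiscr : IsDiscrete (AddSubgroup.zmultiples (2 * Real.pi) : Set ℝ) :=
    ⟨inferInstanceAs (DiscreteTopology (AddSubgroup.zmultiples (2 * Real.pi)))⟩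
  have hmem : ∀ a b : ℝ, Circle.exp a = Circle.exp b →
      a - b ∈ (AddSubgroup.zmultiples (2 * Real.pi) : Set ℝ) := by
    intro a b h
    obtain ⟨m, hm⟩ := Circle.exp_eq_exp.1 h
    exact AddSubgroup.mem_zmultiples_iff.2 ⟨m, by rw [hm]; simp⟩
  -- The lift differs from ±πf by a multiple of 2π, constant on each connected set. Comparing at p
  -- and q gives G p - G q = π and also -π.
  have hcA := hAc.constant_of_mapsTo hdiscr (f := fun y => G y - Real.pi * f y)
    (Continuous.continuousOn (by fun_prop))
    (fun y hy => hmem _ _ ((hG' y).trans (hFA y hy))) hp.1 hq.1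
  have hcB := hBc.constant_of_mapsTo hdiscr (f := fun y => G y - -(Real.pi * f y))
    (Continuous.continuousOn (by fun_prop))
    (fun y hy => hmem _ _ ((hG' y).trans (hFB y hy))) hp.2 hq.2
  have hfp : f p = 1 := hf1 ⟨hp, hpv⟩
  have hfq : f q = 0 := hf0 ⟨hq, hqu⟩
  rw [hfp, hfq] at hcA hcB
  have := Real.pi_pos
  linarith

theorem geod_coe4 {x : Hyp} {v : Mat} (hv : v.IsHermitian) (t : ℝ) :
    geod x v t = toMat (zeta (coe4 x) (ofMat v) (-t)) := by
  rw [zeta, toMat_sub, toMat_smul, toMat_smul, toMat_coe4, toMat_ofMat hv, geod, Real.cosh_neg,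
    Real.sinh_neg, neg_smul, sub_neg_eq_add]

theorem mem_image_val_iff {S : Set Hyp} {v : R4} (hv : v ∈ Hyp4) :
    toMat v ∈ Subtype.val '' S ↔ ofHyp4 v hv ∈ S := by
  constructor
  · rintro ⟨y, hy, hyv⟩
    have : y = ofHyp4 v hv := Subtype.ext hyv
    rwa [← this]
  · exact fun h => ⟨_, h, rfl⟩

/-! ### The normal exponential map is a homeomorphism -/

section Collar

variable {S : Set Hyp} {n : R4 → R4}

theorem LNormal.zeta_mem (hn : LNormal (coe4 '' S) n) {x : Hyp} (hx : x ∈ S) (t : ℝ) :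
    zeta (coe4 x) (n (coe4 x)) t ∈ Hyp4 :=
  QuasiFuchsian.zeta_mem (coe4_mem x) (hn.tangent _ (Set.mem_image_of_mem _ hx))
    (hn.unit _ (Set.mem_image_of_mem _ hx)) t

/-- The normal exponential map of a surface in hyperbolic space. -/
noncomputable def normalExp (hn : LNormal (coe4 '' S) n) (p : S × ℝ) : Hyp :=
  ofHyp4 (zeta (coe4 p.1) (n (coe4 p.1)) p.2) (hn.zeta_mem p.1.2 p.2)

theorem coe4_normalExp (hn : LNormal (coe4 '' S) n) (p : S × ℝ) :
    coe4 (normalExp hn p) = zeta (coe4 p.1) (n (coe4 p.1)) p.2 := coe4_ofHyp4 _ _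

theorem continuous_normalExp (hn : LNormal (coe4 '' S) n) : Continuous (normalExp hn) := by
  rw [isEmbedding_coe4.continuous_iff]
  have h1 : Continuous fun p : S × ℝ => coe4 p.1 :=
    continuous_coe4.comp (continuous_subtype_val.comp continuous_fst)
  have h2 : Continuous fun p : S × ℝ => n (coe4 p.1) :=
    hn.continuousOn.comp_continuous h1 fun p => Set.mem_image_of_mem _ p.1.2
  have : coe4 ∘ normalExp hn = fun p : S × ℝ =>
      Real.cosh p.2 • coe4 p.1 - Real.sinh p.2 • n (coe4 p.1) := by
    funext p; exact coe4_normalExp hn p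
  rw [this]
  exact ((Real.continuous_cosh.comp continuous_snd).smul h1).sub
    ((Real.continuous_sinh.comp continuous_snd).smul h2)

theorem eta_normalExp (hn : LNormal (coe4 '' S) n) (p : S × ℝ) :
    -eta (coe4 (normalExp hn p)) (coe4 p.1) = Real.cosh p.2 := by
  rw [coe4_normalExp, zeta, eta_sub_left, eta_smul_left, eta_smul_left,
    eta_self_hyp4 (coe4_mem _), hn.tangent _ (Set.mem_image_of_mem _ p.1.2)]
  ring

/-- The distance from `y` is proper on a closed set, so a nearest point exists, and `y` lies on the
normal geodesic through it. -/
theorem exists_foot (hn : LNormal (coe4 '' S) n) (hS : IsClosed S) (hne : S.Nonempty)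
    (hp : ∀ x ∈ coe4 '' S, ∃ X, LParam (coe4 '' S) x X) (y : Hyp) :
    ∃ p : S × ℝ, normalExp hn p = y ∧
      ∀ q ∈ S, -eta (coe4 y) (coe4 p.1) ≤ -eta (coe4 y) (coe4 q) := by
  have hcl : IsClosed (coe4 '' S) := isClosedEmbedding_coe4.isClosedMap S hS
  have hcont₀ : Continuous fun z : R4 => eta (coe4 y) z :=
    continuous_const.eta continuous_id
  have hcont : Continuous fun z : R4 => -eta (coe4 y) z := hcont₀.neg
  obtain ⟨q₀, hq₀⟩ := hne
  have hpos := pos_of_mem_hyp4 (coe4_mem y)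
  set R := 2 * (coe4 y 0 + coe4 y 1) * -eta (coe4 y) (coe4 q₀) with hR
  have hK := (isCompact_bounded R).inter_right hcl
  have hbd : ∀ q : Hyp, -eta (coe4 y) (coe4 q) ≤ -eta (coe4 y) (coe4 q₀) →
      coe4 q 0 + coe4 q 1 ≤ R := by
    intro q hq
    have := add_le_mul_neg_eta (coe4_mem q) (coe4_mem y)
    rw [eta_comm] at this
    refine this.trans ?_
    rw [hR]
    have h1 := hpos.1
    have h2 := hpos.2
    gcongr
  obtain ⟨z, ⟨hz1, hzT⟩, hzmin⟩ := hK.exists_isMinOn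
    ⟨coe4 q₀, ⟨coe4_mem q₀, hbd q₀ le_rfl⟩, Set.mem_image_of_mem _ hq₀⟩ hcont.continuousOn
  obtain ⟨p, hpS, rfl⟩ := hzT
  have hmin : ∀ q ∈ S, -eta (coe4 y) (coe4 p) ≤ -eta (coe4 y) (coe4 q) := by
    intro q hq
    rcases le_total (-eta (coe4 y) (coe4 q)) (-eta (coe4 y) (coe4 q₀)) with h | h
    · exact hzmin ⟨⟨coe4_mem q, hbd q h⟩, Set.mem_image_of_mem _ hq⟩
    · exact le_trans (hzmin ⟨⟨coe4_mem q₀, hbd q₀ le_rfl⟩, Set.mem_image_of_mem _ hq₀⟩) h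
  obtain ⟨X, hX⟩ := hp _ (Set.mem_image_of_mem _ hpS)
  have hloc : IsLocalMin (fun u => -eta (coe4 y) (X u)) 0 := by
    filter_upwards [hX.eventually_mem] with u hu
    obtain ⟨q, hq, hqu⟩ := hu
    rw [hX.map_zero, ← hqu]
    exact hmin q hq
  obtain ⟨t, ht⟩ := hX.exists_eq_zeta hn (coe4_mem y) fun v => by
    have := hloc.fderiv_eq_zero
    rw [LParam.height_fderiv hX.differentiableAt] at this
    simpa using DFunLike.congr_fun this v
  refine ⟨(⟨p, hpS⟩, t), ?_, hmin⟩
  apply coe4_injective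
  rw [coe4_normalExp, ht]

/-- The feet coincide by `foot_unique`; the product with the normal then recovers sinh t. -/
theorem normalExp_injective (hn : LNormal (coe4 '' S) n) (hS : IsClosed S) (hc : IsConnected S)
    (hp : ∀ x ∈ coe4 '' S, ∃ X, LParam (coe4 '' S) x X) (hs : SmallForms (coe4 '' S) n) :
    Function.Injective (normalExp hn) := by
  have hcl : IsClosed (coe4 '' S) := isClosedEmbedding_coe4.isClosedMap S hS
  rintro ⟨p, t⟩ ⟨q, s⟩ h
  have h' : zeta (coe4 p) (n (coe4 p)) t = zeta (coe4 q) (n (coe4 q)) s := by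
    have := congrArg coe4 h
    rwa [coe4_normalExp, coe4_normalExp] at this
  have hpq : coe4 p = coe4 q := foot_unique hn hp hcl
    (hc.image _ continuous_coe4.continuousOn) hs (Set.mem_image_of_mem _ p.2)
    (Set.mem_image_of_mem _ q.2) h'
  have hpq' : p = q := Subtype.ext (coe4_injective hpq)
  subst hpq'
  refine Prod.ext rfl ?_
  have h2 := congrArg (eta (n (coe4 p))) h'
  simp only [zeta, eta_sub_right, eta_smul_right, hn.unit _ (Set.mem_image_of_mem _ p.2),
    hn.tangent _ (Set.mem_image_of_mem _ p.2)] at h2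
  show t = s
  exact Real.sinh_injective (by linarith)

/-- The map is proper. By injectivity the only foot is the nearest point, so |t| is the distance to
the surface, which is bounded on a compact set by the distance to a fixed point of the surface. The
foot is then bounded too. -/
theorem isClosedMap_normalExp (hn : LNormal (coe4 '' S) n) (hS : IsClosed S) (hne : S.Nonempty)
    (hp : ∀ x ∈ coe4 '' S, ∃ X, LParam (coe4 '' S) x X) (hinj : Function.Injective (normalExp hn)) :
    IsClosedMap (normalExp hn) := by
  have hpr : IsProperMap (normalExp hn) := by
    rw [isProperMap_iff_isCompact_preimage]
    refine ⟨continuous_normalExp hn, fun K hK => ?_⟩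
    obtain ⟨q₀, hq₀⟩ := hne
    have c1 : Continuous fun y : Hyp => coe4 y 0 + coe4 y 1 :=
      ((continuous_apply 0).comp continuous_coe4).add ((continuous_apply 1).comp continuous_coe4)
    have c0 : Continuous fun y : Hyp => eta (coe4 y) (coe4 q₀) :=
      continuous_coe4.eta continuous_const
    have c2 : Continuous fun y : Hyp => -eta (coe4 y) (coe4 q₀) := c0.neg
    obtain ⟨R, hR⟩ := (hK.image c1).bddAbove
    obtain ⟨M, hM⟩ := (hK.image c2).bddAbove
    have hemb : Topology.IsClosedEmbedding fun p : S => coe4 p :=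
      isClosedEmbedding_coe4.comp hS.isClosedEmbedding_subtypeVal
    have hC := (hemb.isCompact_preimage (isCompact_bounded (2 * R * M))).prod
      (isCompact_Icc (a := -M) (b := M))
    refine hC.of_isClosed_subset (hK.isClosed.preimage (continuous_normalExp hn)) ?_
    rintro ⟨p, t⟩ hpt
    have hy : normalExp hn (p, t) ∈ K := hpt
    have h1 : coe4 (normalExp hn (p, t)) 0 + coe4 (normalExp hn (p, t)) 1 ≤ R :=
      hR (Set.mem_image_of_mem _ hy)
    have h2 : -eta (coe4 (normalExp hn (p, t))) (coe4 q₀) ≤ M := hM (Set.mem_image_of_mem _ hy)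
    have h3 := eta_normalExp hn (p, t)
    have h4 : Real.cosh t ≤ M := by
      obtain ⟨p', hp', hmin⟩ := exists_foot hn hS ⟨q₀, hq₀⟩ hp (normalExp hn (p, t))
      have := hinj hp'
      subst this
      have := hmin q₀ hq₀
      simp only at h3
      linarith
    have h5 := add_le_mul_neg_eta (coe4_mem p) (coe4_mem (normalExp hn (p, t)))
    rw [eta_comm, h3] at h5
    have h6 := pos_of_mem_hyp4 (coe4_mem (normalExp hn (p, t)))
    have h7 := Real.cosh_pos t
    refine ⟨⟨coe4_mem p, h5.trans ?_⟩, ?_⟩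
    · have h8 : 0 ≤ R := by linarith [h6.1, h6.2]
      have := h6.1
      have := h6.2
      simp only
      gcongr
    · have h8 : |t| ≤ Real.cosh t := by
        have h9 := Real.self_le_sinh_iff.2 (abs_nonneg t)
        have h10 := Real.sinh_lt_cosh |t|
        rw [Real.cosh_abs] at h10
        linarith
      exact abs_le.1 (h8.trans h4)
  exact hpr.isClosedMap

/-- The normal exponential map of a surface with small principal curvatures is a homeomorphism. -/
noncomputable def collar (hn : LNormal (coe4 '' S) n) (hS : IsClosed S) (hc : IsConnected S)
    (hp : ∀ x ∈ coe4 '' S, ∃ X, LParam (coe4 '' S) x X) (hs : SmallForms (coe4 '' S) n) :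
    S × ℝ ≃ₜ Hyp :=
  Equiv.toHomeomorphOfContinuousClosed
    (Equiv.ofBijective (normalExp hn) ⟨normalExp_injective hn hS hc hp hs, fun y =>
      (exists_foot hn hS hc.nonempty hp y).imp fun _ h => h.1⟩)
    (continuous_normalExp hn)
    (isClosedMap_normalExp hn hS hc.nonempty hp (normalExp_injective hn hS hc hp hs))

end Collar


/-! ### The two sides of the surface and Fermi coordinates -/

instance : NormalSpace Hyp := hypHomeo.isClosedEmbedding.normalSpace

/-- A surface with small principal curvatures, which disconnects hyperbolic space in `Up` and `Um`,
with unit normal `n` pointing towards `Up`. -/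
structure Sides (S Up Um : Set Hyp) (n : R4 → R4) : Prop where
  components : AreTwoComponents S Up Um
  normal : LNormal (coe4 '' S) n
  nonempty : S.Nonempty
  param : ∀ x ∈ coe4 '' S, ∃ X, LParam (coe4 '' S) x X
  small : SmallForms (coe4 '' S) n
  plus : ∀ x : S, ∀ᶠ t in 𝓝[>] (0 : ℝ), normalExp normal (x, -t) ∈ Up
  minus : ∀ x : S, ∀ᶠ t in 𝓝[>] (0 : ℝ), normalExp normal (x, t) ∈ Um

theorem AreTwoComponents.isClosed {X : Type*} [TopologicalSpace X] {C A B : Set X}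
    (h : AreTwoComponents C A B) : IsClosed C := by
  rw [← isOpen_compl_iff, ← h.union]
  exact h.open_left.union h.open_right

theorem AreTwoComponents.symm {X : Type*} [TopologicalSpace X] {C A B : Set X}
    (h : AreTwoComponents C A B) : AreTwoComponents C B A :=
  ⟨h.open_right, h.open_left, h.connected_right, h.connected_left, h.disjoint.symm,
    (Set.union_comm _ _).trans h.union⟩

theorem AreTwoComponents.union_eq_compl {X : Type*} [TopologicalSpace X] {C A B : Set X}
    (h : AreTwoComponents C A B) : A ∪ C = Bᶜ := by
  ext x
  have h1 : x ∈ A ∨ x ∈ B ↔ x ∉ C := by rw [← Set.mem_union, h.union, Set.mem_compl_iff]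
  have h2 : x ∈ A → x ∉ B := fun hA => Set.disjoint_left.1 h.disjoint hA
  rw [Set.mem_union, Set.mem_compl_iff]
  tauto

theorem AreTwoComponents.isPreconnected_union {X : Type*} [TopologicalSpace X] {C A B : Set X}
    (h : AreTwoComponents C A B) (hC : C ⊆ closure A) : IsPreconnected (A ∪ C) :=
  h.connected_left.isPreconnected.subset_closure Set.subset_union_left
    (Set.union_subset subset_closure hC)

/-- `A ∪ C` and `B ∪ C` are closed, connected and cover the space; their intersection is `C`, so
unicoherence applies. -/
theorem AreTwoComponents.isPreconnected {X : Type*} [TopologicalSpace X] [SimplyConnectedSpace X]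
    [LocallyPathConnectedSpace X] [NormalSpace X] {C A B : Set X} (h : AreTwoComponents C A B)
    (hA : C ⊆ closure A) (hB : C ⊆ closure B) : IsPreconnected C := by
  have h1 : (A ∪ C) ∩ (B ∪ C) = C := by
    rw [← Set.inter_union_distrib_right, h.disjoint.inter_eq, Set.empty_union]
  rw [← h1]
  refine isPreconnected_inter_of_union_eq_univ ?_ ?_ (h.isPreconnected_union hA)
    (h.symm.isPreconnected_union hB) ?_
  · rw [h.union_eq_compl]; exact h.open_right.isClosed_compl
  · rw [h.symm.union_eq_compl]; exact h.open_left.isClosed_compl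
  · rw [← Set.union_union_distrib_right, h.union, Set.compl_union_self]

namespace Sides

variable {S Up Um : Set Hyp} {n : R4 → R4} (h : Sides S Up Um n)

include h

theorem normalExp_zero (x : S) : normalExp h.normal (x, 0) = x := by
  apply coe4_injective
  rw [coe4_normalExp]
  simp [zeta]

theorem tendsto_normalExp (x : S) :
    Tendsto (fun t => normalExp h.normal (x, t)) (𝓝[>] 0) (𝓝 (x : Hyp)) := by
  have hc : Continuous fun t => normalExp h.normal (x, t) :=
    (continuous_normalExp h.normal).comp (continuous_const.prodMk continuous_id)
  have := hc.tendsto 0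
  rw [h.normalExp_zero] at this
  exact this.mono_left nhdsWithin_le_nhds

theorem tendsto_normalExp_neg (x : S) :
    Tendsto (fun t => normalExp h.normal (x, -t)) (𝓝[>] 0) (𝓝 (x : Hyp)) := by
  have hc : Continuous fun t : ℝ => normalExp h.normal (x, -t) :=
    (continuous_normalExp h.normal).comp (continuous_const.prodMk continuous_neg)
  have := hc.tendsto 0
  rw [neg_zero, h.normalExp_zero] at this
  exact this.mono_left nhdsWithin_le_nhds

theorem isClosed : IsClosed S := h.components.isClosed

/-- The normal geodesics show that each point of the surface is a limit of both sides. -/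
theorem isConnected : IsConnected S :=
  ⟨h.nonempty, h.components.isPreconnected
    (fun x hx => mem_closure_of_tendsto (h.tendsto_normalExp_neg ⟨x, hx⟩) (h.plus ⟨x, hx⟩))
    (fun x hx => mem_closure_of_tendsto (h.tendsto_normalExp ⟨x, hx⟩) (h.minus ⟨x, hx⟩))⟩

/-- Fermi coordinates: the foot point and the signed distance. -/
noncomputable def fermi : Hyp ≃ₜ S × ℝ :=
  (collar h.normal h.isClosed h.isConnected h.param h.small).symm

/-- The nearest point on the surface. -/
noncomputable def foot (y : Hyp) : S := (h.fermi y).1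

/-- The signed distance from the surface, positive on the side `Um`. -/
noncomputable def sd (y : Hyp) : ℝ := (h.fermi y).2

theorem continuous_sd : Continuous h.sd := continuous_snd.comp h.fermi.continuous

theorem normalExp_foot_sd (y : Hyp) : normalExp h.normal (h.foot y, h.sd y) = y :=
  h.fermi.symm_apply_apply y

theorem fermi_normalExp (p : S × ℝ) : h.fermi (normalExp h.normal p) = p :=
  h.fermi.apply_symm_apply p

theorem sd_normalExp (p : S × ℝ) : h.sd (normalExp h.normal p) = p.2 :=
  congrArg Prod.snd (h.fermi_normalExp p)

theorem foot_normalExp (p : S × ℝ) : h.foot (normalExp h.normal p) = p.1 :=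
  congrArg Prod.fst (h.fermi_normalExp p)

theorem sd_eq_zero_iff (y : Hyp) : h.sd y = 0 ↔ y ∈ S := by
  constructor
  · intro hy
    have := h.normalExp_foot_sd y
    rw [hy, h.normalExp_zero] at this
    exact this ▸ (h.foot y).2
  · intro hy
    have := h.sd_normalExp (⟨y, hy⟩, 0)
    rwa [h.normalExp_zero] at this

theorem cosh_sd (y : Hyp) : Real.cosh (h.sd y) = -eta (coe4 y) (coe4 (h.foot y)) := by
  have := eta_normalExp h.normal (h.foot y, h.sd y)
  rw [h.normalExp_foot_sd] at this
  exact this.symm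

theorem cosh_sd_le (y : Hyp) {q : Hyp} (hq : q ∈ S) :
    Real.cosh (h.sd y) ≤ -eta (coe4 y) (coe4 q) := by
  obtain ⟨p, hp, hmin⟩ := exists_foot h.normal h.isClosed h.nonempty h.param y
  have : h.foot y = p.1 := by rw [← hp, h.foot_normalExp]
  rw [h.cosh_sd, this]
  exact hmin q hq

theorem isPreconnected_sd_preimage {s : Set ℝ} (hs : IsPreconnected s) :
    IsPreconnected (h.sd ⁻¹' s) := by
  have hS : PreconnectedSpace S := isPreconnected_iff_preconnectedSpace.1 h.isConnected.isPreconnected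
  have h1 := ((isPreconnected_univ (α := S)).prod hs).image _ (continuous_normalExp h.normal).continuousOn
  convert h1 using 1
  ext y
  constructor
  · exact fun hy => ⟨(h.foot y, h.sd y), ⟨trivial, hy⟩, h.normalExp_foot_sd y⟩
  · rintro ⟨p, ⟨-, hp⟩, rfl⟩
    show h.sd _ ∈ s
    rwa [h.sd_normalExp]

/-- The set where the signed distance is positive is a connected image of S × (0, ∞) that misses the
surface; it is on the side which the normal geodesics enter for small positive times. -/
theorem mem_minus_of_pos {y : Hyp} (hy : 0 < h.sd y) : y ∈ Um := by
  obtain ⟨t, ht, ht0⟩ := ((h.minus (h.foot y)).and self_mem_nhdsWithin).exists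
  refine (h.isPreconnected_sd_preimage isPreconnected_Ioi).subset_left_of_subset_union
    h.components.open_right h.components.open_left h.components.disjoint.symm ?_
    ⟨_, ?_, ht⟩ hy
  · intro z hz
    rw [Set.union_comm, h.components.union, Set.mem_compl_iff, ← h.sd_eq_zero_iff]
    exact ne_of_gt hz
  · show 0 < h.sd _
    rw [h.sd_normalExp]
    exact ht0

theorem mem_plus_of_neg {y : Hyp} (hy : h.sd y < 0) : y ∈ Up := by
  obtain ⟨t, ht, ht0⟩ := ((h.plus (h.foot y)).and self_mem_nhdsWithin).exists
  refine (h.isPreconnected_sd_preimage isPreconnected_Iio).subset_left_of_subset_union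
    h.components.open_left h.components.open_right h.components.disjoint ?_
    ⟨_, ?_, ht⟩ hy
  · intro z hz
    rw [h.components.union, Set.mem_compl_iff, ← h.sd_eq_zero_iff]
    exact ne_of_lt hz
  · show h.sd _ < 0
    rw [h.sd_normalExp]
    exact neg_neg_of_pos ht0

theorem mem_minus_iff {y : Hyp} : y ∈ Um ↔ 0 < h.sd y := by
  refine ⟨fun hy => ?_, h.mem_minus_of_pos⟩
  have h1 : y ∉ S := fun hS => by
    have : y ∈ Up ∪ Um := Or.inr hy
    rw [h.components.union] at this
    exact this hS
  rcases lt_trichotomy (h.sd y) 0 with h2 | h2 | h2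
  · exact (Set.disjoint_left.1 h.components.disjoint (h.mem_plus_of_neg h2) hy).elim
  · exact (h1 ((h.sd_eq_zero_iff y).1 h2)).elim
  · exact h2

theorem mem_plus_iff {y : Hyp} : y ∈ Up ↔ h.sd y < 0 := by
  refine ⟨fun hy => ?_, h.mem_plus_of_neg⟩
  have h1 : y ∉ S := fun hS => by
    have : y ∈ Up ∪ Um := Or.inl hy
    rw [h.components.union] at this
    exact this hS
  rcases lt_trichotomy (h.sd y) 0 with h2 | h2 | h2
  · exact h2
  · exact (h1 ((h.sd_eq_zero_iff y).1 h2)).elim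
  · exact (Set.disjoint_left.1 h.components.disjoint hy (h.mem_minus_of_pos h2)).elim

end Sides

/-- Membership in the two sides along the normal geodesics, in real coordinates. -/
theorem geod_mem_iff {S A : Set Hyp} {ν : Mat → Mat} (hν : IsUnitNormal S ν) (x : S) (t : ℝ) :
    geod (x : Hyp) (ν (x : Hyp)) t ∈ Subtype.val '' A ↔
      normalExp hν.lNormal (x, -t) ∈ A := by
  have h1 : n4 ν (coe4 x) = ofMat (ν (x : Hyp)) := by
    rw [n4, toMat_coe4]
  rw [geod_coe4 (hν.hermitian _ x.2), ← h1]
  exact mem_image_val_iff (hν.lNormal.zeta_mem x.2 (-t))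

theorem IsCooriented.sides {Ωp Ωm : Set Ideal} {S Up Um : Set Hyp} {ν : Mat → Mat}
    (h : IsCooriented Ωp Ωm S Up Um ν) (hne : S.Nonempty) (hS : IsEmbeddedSurface S)
    (hs : HasSmallPrincipalCurvatures S ν) : Sides S Up Um (n4 ν) where
  components := h.components
  normal := h.unitNormal.lNormal
  nonempty := hne
  param := by
    rintro _ ⟨x, hx, rfl⟩
    obtain ⟨X, hX⟩ := hS x hx
    exact ⟨_, hX.lParam hx⟩
  small := hs.smallForms h.unitNormal
  plus x := by
    filter_upwards [h.points_plus x x.2] with t ht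
    exact (geod_mem_iff h.unitNormal x t).1 ht
  minus x := by
    filter_upwards [h.points_minus x x.2] with t ht
    simpa using (geod_mem_iff h.unitNormal x (-t)).1 ht


/-! ### The action of the group -/

theorem psl_smul_eq (γ : PSL(2, ℂ)) : ∃ A : SL(2, ℂ), ∀ x : Hyp, γ • x = A • x := by
  obtain ⟨A, rfl⟩ := QuotientGroup.mk_surjective γ
  exact ⟨A, fun x => rfl⟩

theorem eta_smul_smul (γ : PSL(2, ℂ)) (x y : Hyp) :
    eta (coe4 (γ • x)) (coe4 (γ • y)) = eta (coe4 x) (coe4 y) := by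
  obtain ⟨A, hA⟩ := psl_smul_eq γ
  rw [hA, hA, ← mink_coe4, ← mink_coe4, sl_smul_coe, sl_smul_coe, mink_conj]

instance : ContinuousConstSMul PSL(2, ℂ) Hyp where
  continuous_const_smul γ := by
    obtain ⟨A, hA⟩ := psl_smul_eq γ
    have : (fun x : Hyp => γ • x) = fun x => A • x := funext hA
    rw [this]
    refine Continuous.subtype_mk ?_ _
    exact (Continuous.mul continuous_const continuous_subtype_val).mul continuous_const

instance (Γ : Subgroup PSL(2, ℂ)) : ContinuousConstSMul Γ Hyp :=
  ⟨fun γ => continuous_const_smul (γ : PSL(2, ℂ))⟩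

/-- The trace of a point of hyperbolic space. -/
noncomputable def height (y : Hyp) : ℝ := coe4 y 0 + coe4 y 1

theorem continuous_height : Continuous height :=
  ((continuous_apply 0).comp continuous_coe4).add ((continuous_apply 1).comp continuous_coe4)

theorem height_pos (y : Hyp) : 0 < height y := by
  have := pos_of_mem_hyp4 (coe4_mem y)
  exact add_pos this.1 this.2

theorem isCompact_height_le (R : ℝ) : IsCompact {y : Hyp | height y ≤ R} := by
  convert isClosedEmbedding_coe4.isCompact_preimage (isCompact_bounded R) using 1
  ext y
  exact ⟨fun h => ⟨coe4_mem y, h⟩, fun h => h.2⟩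

theorem height_le (x y : Hyp) : height x ≤ 2 * height y * -eta (coe4 x) (coe4 y) :=
  add_le_mul_neg_eta (coe4_mem x) (coe4_mem y)

section Quotient

variable {Γ : Subgroup PSL(2, ℂ)}

theorem proj_eq_iff {x y : Hyp} : proj Γ x = proj Γ y ↔ ∃ γ ∈ Γ, γ • y = x := by
  refine Quotient.eq.trans ?_
  rw [MulAction.orbitRel_apply]
  constructor
  · rintro ⟨γ, hγ⟩
    exact ⟨γ, γ.2, hγ⟩
  · rintro ⟨γ, hγ, h⟩
    exact ⟨⟨γ, hγ⟩, h⟩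

theorem proj_smul {γ : PSL(2, ℂ)} (hγ : γ ∈ Γ) (x : Hyp) : proj Γ (γ • x) = proj Γ x :=
  proj_eq_iff.2 ⟨γ, hγ, rfl⟩

theorem proj_surjective (q : Mfd Γ) : ∃ x, proj Γ x = q := Quotient.exists_rep q

theorem continuous_proj : Continuous (proj Γ) := continuous_quot_mk

theorem isOpenMap_proj : IsOpenMap (proj Γ) := isOpenMap_quotient_mk'_mul

theorem smul_mem_lift {S : Set (Mfd Γ)} {γ : PSL(2, ℂ)} (hγ : γ ∈ Γ) {x : Hyp} :
    γ • x ∈ lift S ↔ x ∈ lift S := by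
  rw [lift, Set.mem_preimage, Set.mem_preimage, proj_smul hγ]

/-- Compact subsets of the quotient are images of bounded sets: the projection is open, so the
images of the sets of bounded height form a directed open cover. -/
theorem exists_height_le {C : Set (Mfd Γ)} (hC : IsCompact C) :
    ∃ R, ∀ q ∈ C, ∃ y, proj Γ y = q ∧ height y ≤ R := by
  obtain ⟨R, hR⟩ := hC.elim_directed_cover (fun R : ℝ => proj Γ '' {y | height y < R})
    (fun R => isOpenMap_proj _ (isOpen_lt continuous_height continuous_const))
    (fun q _ => by
      obtain ⟨y, rfl⟩ := proj_surjective q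
      exact Set.mem_iUnion.2 ⟨height y + 1, y, lt_add_one (height y), rfl⟩)
    (Monotone.directed_le fun R R' h => Set.image_mono fun y hy => lt_of_lt_of_le hy h)
  refine ⟨R, fun q hq => ?_⟩
  obtain ⟨y, hy, rfl⟩ := hR hq
  exact ⟨y, rfl, le_of_lt hy⟩

end Quotient

theorem pos_of_isPreconnected {X : Type*} [TopologicalSpace X] {f : X → ℝ} (hf : Continuous f)
    {s : Set X} (hs : IsPreconnected s) (h0 : ∀ x ∈ s, f x ≠ 0) {x y : X} (hx : x ∈ s) (hy : y ∈ s)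
    (hfx : 0 < f x) : 0 < f y := by
  by_contra! hcon
  obtain ⟨z, hz, hz0⟩ := hs.intermediate_value hy hx hf.continuousOn ⟨hcon, hfx.le⟩
  exact h0 z hz hz0

/-! ### Invariance of the signed distance under the group -/

namespace Sides

variable {Γ : Subgroup PSL(2, ℂ)} {S : Set (Mfd Γ)} {Up Um : Set Hyp} {n : R4 → R4}
  (h : Sides (lift S) Up Um n)

include h

/-- The translate of the foot is a competitor for the translated point; the inverse element gives
the opposite inequality. -/
theorem cosh_sd_smul_le {γ : PSL(2, ℂ)} (hγ : γ ∈ Γ) (y : Hyp) :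
    Real.cosh (h.sd (γ • y)) ≤ Real.cosh (h.sd y) := by
  have := h.cosh_sd_le (γ • y) ((smul_mem_lift hγ).2 (h.foot y).2)
  rwa [eta_smul_smul, ← h.cosh_sd] at this

theorem abs_sd_smul {γ : PSL(2, ℂ)} (hγ : γ ∈ Γ) (y : Hyp) : |h.sd (γ • y)| = |h.sd y| := by
  have h1 := h.cosh_sd_smul_le hγ y
  have h2 := h.cosh_sd_smul_le (Γ.inv_mem hγ) (γ • y)
  rw [inv_smul_smul] at h2
  exact le_antisymm (Real.cosh_le_cosh.1 h1) (Real.cosh_le_cosh.1 h2)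

theorem sd_smul_eq_zero_iff {γ : PSL(2, ℂ)} (hγ : γ ∈ Γ) (y : Hyp) :
    h.sd (γ • y) = 0 ↔ h.sd y = 0 := by
  rw [← abs_eq_zero, h.abs_sd_smul hγ, abs_eq_zero]

/-- Bounded neighbourhoods of the lift are compact modulo the group: move the foot to a bounded
region, and the point stays near it. -/
theorem exists_height_le_of_sd (hS : IsCompact S) (R : ℝ) :
    ∃ C, ∀ y, |h.sd y| ≤ R → ∃ γ ∈ Γ, height (γ • y) ≤ C := by
  obtain ⟨C, hC⟩ := exists_height_le hS
  refine ⟨2 * C * Real.cosh R, fun y hy => ?_⟩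
  obtain ⟨z, hz, hzC⟩ := hC (proj Γ (h.foot y)) (h.foot y).2
  obtain ⟨γ, hγ, hγz⟩ := proj_eq_iff.1 hz
  refine ⟨γ, hγ, (height_le (γ • y) (γ • (h.foot y : Hyp))).trans ?_⟩
  rw [eta_smul_smul, ← h.cosh_sd, hγz]
  have h1 : Real.cosh (h.sd y) ≤ Real.cosh R := Real.cosh_le_cosh.2 (hy.trans (le_abs_self R))
  have h2 := Real.cosh_pos (h.sd y)
  have h3 := height_pos z
  have h4 := h3.trans_le hzC
  gcongr

/-- If some element exchanged the sides, every point far from the surface would be equivalent to one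
in {sd > R}, which is connected. Its image in F × ℝ would reach both ends without meeting the slice
F × {0}, for R large. -/
theorem not_swap {F : Type*} [TopologicalSpace F] [CompactSpace F] [Nonempty F]
    (φ : F × ℝ ≃ₜ Mfd Γ) (hS : IsCompact S) {γ : PSL(2, ℂ)} (hγ : γ ∈ Γ) {y : Hyp}
    (hy : 0 < h.sd y) : 0 < h.sd (γ • y) := by
  by_contra! hcon
  have hpos : ∀ z, 0 < h.sd z → h.sd (γ • z) < 0 := by
    intro z hz
    have := pos_of_isPreconnected (f := fun z => -h.sd (γ • z))
      (h.continuous_sd.comp (continuous_const_smul γ)).neg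
      (h.isPreconnected_sd_preimage (isPreconnected_Ioi (a := 0)))
      (fun w hw => neg_ne_zero.2 fun h0 => (ne_of_gt hw) ((h.sd_smul_eq_zero_iff hγ w).1 h0))
      (x := y) (y := z) hy hz
      (neg_pos.2 (lt_of_le_of_ne hcon fun h0 => hy.ne' ((h.sd_smul_eq_zero_iff hγ y).1 h0)))
    linarith
  have hγ' := Γ.inv_mem hγ
  have hneg : ∀ z, h.sd z < 0 → 0 < h.sd (γ⁻¹ • z) := by
    intro z hz
    refine pos_of_isPreconnected (f := fun z => h.sd (γ⁻¹ • z))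
      (h.continuous_sd.comp (continuous_const_smul γ⁻¹))
      (h.isPreconnected_sd_preimage (isPreconnected_Iio (a := 0)))
      (fun w hw h0 => (ne_of_lt hw) ((h.sd_smul_eq_zero_iff hγ' w).1 h0))
      (x := γ • y) (y := z) (hpos y hy) hz ?_
    rwa [inv_smul_smul]
  have hmid : IsCompact (φ '' (Set.univ ×ˢ {(0 : ℝ)})) :=
    (isCompact_univ.prod isCompact_singleton).image φ.continuous
  obtain ⟨C₀, hC₀⟩ := exists_height_le hmid
  -- Chosen so that all lifts of the slice F × {0} have |sd| ≤ R.
  obtain ⟨R, hR⟩ := ((isCompact_height_le C₀).image h.continuous_sd.abs).bddAbove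
  have hZ : ∀ z, R < |h.sd z| → ∃ w, proj Γ w = proj Γ z ∧ R < h.sd w := by
    intro z hz
    rcases lt_or_ge (h.sd z) 0 with hz0 | hz0
    · refine ⟨γ⁻¹ • z, proj_smul hγ' z, ?_⟩
      rw [← abs_of_pos (hneg z hz0), h.abs_sd_smul hγ']
      exact hz
    · exact ⟨z, rfl, by rwa [abs_of_nonneg hz0] at hz⟩
  obtain ⟨C, hC⟩ := h.exists_height_le_of_sd hS R
  have hcomp : IsCompact (proj Γ '' {y | height y ≤ C}) :=
    (isCompact_height_le C).image continuous_proj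
  set f : Mfd Γ → ℝ := fun q => (φ.symm q).2 with hf
  have hfc : Continuous f := continuous_snd.comp φ.symm.continuous
  -- A bound for the ℝ-coordinate on the image of {|sd| ≤ R}: beyond it, points come from {sd > R}.
  obtain ⟨a, ha⟩ := (hcomp.image hfc.abs).bddAbove
  have hfar : ∀ q, a < |f q| → q ∈ proj Γ '' (h.sd ⁻¹' Set.Ioi R) := by
    intro q hq
    obtain ⟨z, rfl⟩ := proj_surjective q
    have hz : R < |h.sd z| := by
      by_contra! hz
      obtain ⟨g, hg, hgz⟩ := hC z hz
      exact absurd (ha (Set.mem_image_of_mem _ (Set.mem_image_of_mem _ hgz)))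
        (not_le.2 (by rwa [proj_smul hg]))
    obtain ⟨w, hw, hwR⟩ := hZ z hz
    exact ⟨w, hwR, hw⟩
  obtain ⟨p⟩ := ‹Nonempty F›
  have hfφ : ∀ t, f (φ (p, t)) = t := fun t => by simp [hf]
  have := pos_of_isPreconnected hfc
    ((h.isPreconnected_sd_preimage (isPreconnected_Ioi (a := R))).image _
      (continuous_proj (Γ := Γ)).continuousOn) (x := φ (p, |a| + 1)) (y := φ (p, -(|a| + 1))) ?_
      (hfar _ ?_) (hfar _ ?_) ?_
  · rw [hfφ] at this
    linarith [abs_nonneg a]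
  · rintro _ ⟨z, hz, rfl⟩ h0
    have hz' : proj Γ z ∈ φ '' (Set.univ ×ˢ {(0 : ℝ)}) :=
      ⟨φ.symm (proj Γ z), ⟨trivial, h0⟩, φ.apply_symm_apply _⟩
    obtain ⟨w, hw, hwC⟩ := hC₀ _ hz'
    obtain ⟨g, hg, rfl⟩ := proj_eq_iff.1 hw
    have h1 := hR (Set.mem_image_of_mem _ hwC)
    simp only [h.abs_sd_smul hg] at h1
    have h2 : R < h.sd z := hz
    exact absurd (h2.trans_le (le_abs_self _)) (not_lt.2 h1)
  · rw [hfφ, abs_of_nonneg (by positivity)]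
    linarith [le_abs_self a]
  · rw [hfφ, abs_neg, abs_of_nonneg (by positivity)]
    linarith [le_abs_self a]
  · rw [hfφ]; positivity

theorem sd_smul {F : Type*} [TopologicalSpace F] [CompactSpace F] [Nonempty F]
    (φ : F × ℝ ≃ₜ Mfd Γ) (hS : IsCompact S) {γ : PSL(2, ℂ)} (hγ : γ ∈ Γ) (y : Hyp) :
    h.sd (γ • y) = h.sd y := by
  have h1 := h.abs_sd_smul hγ y
  rcases lt_trichotomy (h.sd y) 0 with h2 | h2 | h2
  · have h3 : h.sd (γ • y) ≤ 0 := by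
      by_contra! h3
      have := h.not_swap φ hS (Γ.inv_mem hγ) h3
      rw [inv_smul_smul] at this
      linarith
    rw [abs_of_neg h2, abs_of_nonpos h3] at h1
    linarith
  · rw [h2, h.sd_smul_eq_zero_iff hγ, h2]
  · have h3 := h.not_swap φ hS hγ h2
    rwa [abs_of_pos h2, abs_of_pos h3] at h1

/-- The distance in the quotient is an infimum over lifts. The foot attains it, and invariance of
|sd| gives the lower bound for all other lifts. -/
theorem sInf_mdist (y : Hyp) : sInf (mdist (proj Γ y) '' S) = |h.sd y| := by
  have hlow : ∀ x z : Hyp, proj Γ x = proj Γ y → proj Γ z ∈ S → |h.sd y| ≤ hdist x z := by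
    intro x z hx hz
    obtain ⟨γ, hγ, rfl⟩ := proj_eq_iff.1 hx
    rw [← h.abs_sd_smul hγ, hdist_eq, ← Real.arcosh_cosh (abs_nonneg _), Real.cosh_abs,
      Real.arcosh_le_arcosh (Real.cosh_pos _)
        (zero_lt_one.trans_le (one_le_neg_eta (coe4_mem _) (coe4_mem _)))]
    exact h.cosh_sd_le _ hz
  have hlow' : ∀ p ∈ S, |h.sd y| ≤ mdist (proj Γ y) p := by
    intro p hp
    obtain ⟨z, rfl⟩ := proj_surjective p
    refine le_csInf ⟨_, y, z, rfl, rfl, rfl⟩ ?_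
    rintro _ ⟨x, z', hx, hz', rfl⟩
    exact hlow x z' hx (hz' ▸ hp)
  refine le_antisymm ?_ ?_
  · have h1 : mdist (proj Γ y) (proj Γ (h.foot y)) ≤ |h.sd y| := by
      refine csInf_le ⟨|h.sd y|, ?_⟩ ⟨y, h.foot y, rfl, rfl, ?_⟩
      · rintro _ ⟨x, z, hx, hz, rfl⟩
        exact hlow x z hx (hz ▸ (h.foot y).2)
      · rw [hdist_eq, ← h.cosh_sd, ← Real.cosh_abs, Real.arcosh_cosh (abs_nonneg _)]
    refine (csInf_le ⟨|h.sd y|, ?_⟩ (Set.mem_image_of_mem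
      (mdist (proj Γ y)) (show proj Γ (h.foot y) ∈ S from (h.foot y).2))).trans h1
    rintro _ ⟨p, hp, rfl⟩
    exact hlow' p hp
  · refine le_csInf ⟨_, Set.mem_image_of_mem _ (show proj Γ (h.foot y) ∈ S from (h.foot y).2)⟩ ?_
    rintro _ ⟨p, hp, rfl⟩
    exact hlow' p hp

theorem signedDist_proj {F : Type*} [TopologicalSpace F] [CompactSpace F] [Nonempty F]
    (φ : F × ℝ ≃ₜ Mfd Γ) (hS : IsCompact S) (y : Hyp) :
    signedDist S Up (proj Γ y) = h.sd y := by
  have h1 : proj Γ y ∈ proj Γ '' Up ↔ h.sd y < 0 := by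
    constructor
    · rintro ⟨x, hx, hxy⟩
      obtain ⟨γ, hγ, rfl⟩ := proj_eq_iff.1 hxy
      rwa [h.mem_plus_iff, h.sd_smul φ hS hγ] at hx
    · exact fun hy => ⟨y, h.mem_plus_iff.2 hy, rfl⟩
  rw [signedDist, h.sInf_mdist]
  split_ifs with h2
  · rw [abs_of_neg (h1.1 h2), neg_neg]
  · exact abs_of_nonneg (not_lt.1 fun h3 => h2 (h1.2 h3))

end Sides


/-! ### The Klein model -/

/-- The Klein model in real coordinates. -/
noncomputable def klein4 (y : Hyp) : R4 := (height y)⁻¹ • coe4 y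

theorem klein_eq (y : Hyp) : klein y = toMat (klein4 y) := by
  have h : (y : Mat).trace = ((height y : ℝ) : ℂ) := by
    rw [← toMat_coe4 y, Matrix.trace_fin_two]
    simp [toMat, height]
  rw [klein, klein4, toMat_smul, toMat_coe4, h, ← Complex.ofReal_inv]
  ext i j
  simp

theorem ofMat_klein (y : Hyp) : ofMat (klein y) = klein4 y := by rw [klein_eq, ofMat_toMat]

theorem klein4_add (y : Hyp) : klein4 y 0 + klein4 y 1 = 1 := by
  have := (height_pos y).ne'
  simp only [klein4, Pi.smul_apply, smul_eq_mul]
  rw [← mul_add]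
  exact inv_mul_cancel₀ this

theorem eta_klein4 (x y : Hyp) :
    eta (klein4 x) (klein4 y) = (height x)⁻¹ * (height y)⁻¹ * eta (coe4 x) (coe4 y) := by
  rw [klein4, klein4, eta_smul_left, eta_smul_right]; ring

theorem two_le_height (y : Hyp) : 2 ≤ height y := by
  obtain ⟨h1, h2⟩ := pos_of_mem_hyp4 (coe4_mem y)
  have h3 := (coe4_mem y).2
  rw [height]
  nlinarith [sq_nonneg (coe4 y 0 - coe4 y 1), sq_nonneg (coe4 y 2), sq_nonneg (coe4 y 3)]

/-- Changing the sign of the off-diagonal coordinates of `y` gives another point `y'` of the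
hyperboloid, and -η(x, y) - η(x, y') = x₀y₁ + x₁y₀. -/
theorem neg_eta_le (x y : Hyp) : -eta (coe4 x) (coe4 y) ≤ height x * height y := by
  obtain ⟨h1, h2⟩ := pos_of_mem_hyp4 (coe4_mem x)
  obtain ⟨h3, h4⟩ := pos_of_mem_hyp4 (coe4_mem y)
  have h5 : ![coe4 y 0, coe4 y 1, -coe4 y 2, -coe4 y 3] ∈ Hyp4 :=
    ⟨h3, by simpa using (coe4_mem y).2⟩
  have h6 := one_le_neg_eta (coe4_mem x) h5
  simp only [eta, Matrix.cons_val] at h6 ⊢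
  rw [height, height]
  nlinarith [mul_pos h1 h3, mul_pos h2 h4]

/-- Points at bounded hyperbolic distance become close in the Klein ball near its boundary.
Normalized matrices have trace one, so their difference is traceless and the Minkowski form is
Euclidean on it. -/
theorem sq_klein4_sub_le (x y : Hyp) (i : Fin 4) :
    (klein4 x i - klein4 y i) ^ 2 ≤ (height x)⁻¹ * -eta (coe4 x) (coe4 y) := by
  have hx := klein4_add x
  have hy := klein4_add y
  have h1 : eta (klein4 x - klein4 y) (klein4 x - klein4 y) ≤
      (height x)⁻¹ * -eta (coe4 x) (coe4 y) := by
    simp only [eta_sub_left, eta_sub_right, eta_klein4, eta_self_hyp4 (coe4_mem _)]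
    rw [eta_comm (coe4 y) (coe4 x)]
    have e := one_le_neg_eta (coe4_mem x) (coe4_mem y)
    have i1 : 0 < (height x)⁻¹ := inv_pos.2 (height_pos x)
    have i2 : 0 < (height y)⁻¹ := inv_pos.2 (height_pos y)
    have i3 : (height y)⁻¹ ≤ 2⁻¹ := inv_anti₀ two_pos (two_le_height y)
    have h2 : (height x)⁻¹ * -eta (coe4 x) (coe4 y) * (2 * (height y)⁻¹) ≤
        (height x)⁻¹ * -eta (coe4 x) (coe4 y) * 1 := by
      apply mul_le_mul_of_nonneg_left
      · linarith
      · apply mul_nonneg i1.le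
        linarith
    nlinarith [sq_nonneg (height x)⁻¹, sq_nonneg (height y)⁻¹]
  refine le_trans ?_ h1
  have h2 : klein4 x 1 - klein4 y 1 = -(klein4 x 0 - klein4 y 0) := by linarith
  simp only [eta, Pi.sub_apply]
  rw [h2]
  fin_cases i
  · show (klein4 x 0 - klein4 y 0) ^ 2 ≤ _
    nlinarith [sq_nonneg (klein4 x 2 - klein4 y 2), sq_nonneg (klein4 x 3 - klein4 y 3)]
  · show (klein4 x 1 - klein4 y 1) ^ 2 ≤ _
    rw [h2]
    nlinarith [sq_nonneg (klein4 x 2 - klein4 y 2), sq_nonneg (klein4 x 3 - klein4 y 3)]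
  · show (klein4 x 2 - klein4 y 2) ^ 2 ≤ _
    nlinarith [sq_nonneg (klein4 x 0 - klein4 y 0), sq_nonneg (klein4 x 3 - klein4 y 3)]
  · show (klein4 x 3 - klein4 y 3) ^ 2 ≤ _
    nlinarith [sq_nonneg (klein4 x 0 - klein4 y 0), sq_nonneg (klein4 x 2 - klein4 y 2)]

theorem Ideal.toMat_ofMat (P : Ideal) : toMat (ofMat P) = P :=
  QuasiFuchsian.toMat_ofMat P.2.1.isHermitian

theorem mem_closure_klein_iff (P : Ideal) (A : Set Hyp) :
    (P : Mat) ∈ closure (klein '' A) ↔ ofMat P ∈ closure (klein4 '' A) := by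
  constructor
  · intro h
    have := mem_closure_image continuous_ofMat.continuousAt h
    rwa [Set.image_image, Set.image_congr fun y _ => ofMat_klein y] at this
  · intro h
    have := mem_closure_image continuous_toMat.continuousAt h
    rwa [Set.image_image, P.toMat_ofMat, Set.image_congr fun y _ => (klein_eq y).symm] at this

theorem Ideal.eta_self (P : Ideal) : eta (ofMat P) (ofMat P) = 0 := by
  rw [← mink_ofMat P.2.1.isHermitian P.2.1.isHermitian, mink, Matrix.mul_adjugate, P.2.2.2]
  simp

/-- The points of the domain of discontinuity are far from sets with compact quotient. -/
theorem notMem_closure_klein {Γ : Subgroup PSL(2, ℂ)} {P : Ideal} (hP : P ∉ limitSet Γ)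
    {T : Set Hyp} {C : ℝ} (hT : ∀ y ∈ T, ∃ γ ∈ Γ, height (γ • y) ≤ C) :
    ofMat P ∉ closure (klein4 '' T) := by
  intro hcl
  apply hP
  obtain ⟨u, hu, hlim⟩ := mem_closure_iff_seq_limit.1 hcl
  choose y hyT hyu using hu
  have hu' : u = fun k => klein4 (y k) := funext fun k => (hyu k).symm
  subst hu'
  -- If `y k` in `T` converged to `P`, then γₖ⁻¹ o would stay at bounded distance from `y k`, hence
  -- converge to `P` as well, and `P` would be a limit point.
  set o : Hyp := hypHomeo.symm (0, 0, 0)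
  refine ⟨o, (mem_closure_klein_iff _ _).2 ?_⟩
  choose γ hγ hγC using fun k => hT (y k) (hyT k)
  have hdist : ∀ k, -eta (coe4 (y k)) (coe4 ((γ k)⁻¹ • o)) ≤ C * height o := by
    intro k
    rw [← eta_smul_smul (γ k), smul_inv_smul]
    refine (neg_eta_le _ _).trans ?_
    exact mul_le_mul_of_nonneg_right (hγC k) (height_pos o).le
  -- Convergence to an ideal point forces the height to infinity: the Minkowski square of the
  -- normalized point is -height⁻², and it tends to 0.
  have hinv : Tendsto (fun k => (height (y k))⁻¹) atTop (𝓝 0) := by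
    have h1 : Tendsto (fun k => -eta (klein4 (y k)) (klein4 (y k))) atTop (𝓝 0) := by
      have hc : Continuous fun z : R4 => eta z z := continuous_id.eta continuous_id
      have := (hc.tendsto (ofMat (P : Mat))).comp hlim
      rw [P.eta_self] at this
      have h1 := this.neg
      rw [neg_zero] at h1
      exact h1
    have h2 := (Real.continuous_sqrt.tendsto 0).comp h1
    rw [Real.sqrt_zero] at h2
    refine h2.congr fun k => ?_
    simp only [Function.comp_apply]
    rw [eta_klein4, eta_self_hyp4 (coe4_mem _)]
    have : -((height (y k))⁻¹ * (height (y k))⁻¹ * -1) = (height (y k))⁻¹ ^ 2 := by ring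
    rw [this, Real.sqrt_sq (inv_pos.2 (height_pos _)).le]
  refine mem_closure_of_tendsto (f := fun k => klein4 ((γ k)⁻¹ • o)) (b := atTop) ?_
    (Eventually.of_forall fun k => Set.mem_image_of_mem _
      ⟨⟨(γ k)⁻¹, Γ.inv_mem (hγ k)⟩, rfl⟩)
  rw [tendsto_pi_nhds] at hlim ⊢
  intro i
  have h3 : Tendsto (fun k => klein4 (y k) i - klein4 ((γ k)⁻¹ • o) i) atTop (𝓝 0) := by
    rw [tendsto_zero_iff_abs_tendsto_zero]
    have h4 : Tendsto (fun k => √((height (y k))⁻¹ * (C * height o))) atTop (𝓝 0) := by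
      have := (Real.continuous_sqrt.tendsto _).comp (hinv.mul_const (C * height o))
      rwa [zero_mul, Real.sqrt_zero] at this
    refine squeeze_zero (fun k => abs_nonneg _) (fun k => ?_) h4
    apply Real.abs_le_sqrt
    refine (sq_klein4_sub_le _ _ i).trans ?_
    exact mul_le_mul_of_nonneg_left (hdist k) (inv_pos.2 (height_pos _)).le
  have := (hlim i).sub h3
  simpa using this

/-- Geodesics are chords in the Klein model: the segment between two points consists of timelike
vectors and can be normalized back to the hyperboloid. -/
theorem isPreconnected_klein4_preimage {B : Set R4} (hB : Convex ℝ B) :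
    IsPreconnected (klein4 ⁻¹' B) := by
  refine isPreconnected_of_forall_pair fun x hx y hy => ?_
  set v : ℝ → R4 := fun s => (1 - s) • klein4 x + s • klein4 y with hv
  have hvc : Continuous v := by fun_prop
  have hi : ∀ z : Hyp, 0 < (height z)⁻¹ := fun z => inv_pos.2 (height_pos z)
  have hq : ∀ s : Set.Icc (0 : ℝ) 1, 0 < -eta (v s) (v s) := by
    rintro ⟨s, hs0, hs1⟩
    simp only [hv, eta_add_left, eta_add_right, eta_smul_left, eta_smul_right, eta_klein4,
      eta_self_hyp4 (coe4_mem _)]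
    rw [eta_comm (coe4 y) (coe4 x)]
    have e := one_le_neg_eta (coe4_mem x) (coe4_mem y)
    have h1 := hi x
    have h2 := hi y
    set a := (height x)⁻¹
    set b := (height y)⁻¹
    -- With D = -η(x, y), the quantity is ((1 - s)a + sb)² + 2 (1 - s)a · sb · (D - 1).
    have h3 : 0 < ((1 - s) * a + s * b) ^ 2 := by
      have : 0 < (1 - s) * a + s * b := by
        rcases hs0.eq_or_lt with h | h
        · rw [← h]; simpa using h1
        · have : 0 ≤ (1 - s) * a := mul_nonneg (by linarith) h1.le
          positivity
      positivity
    have h4 : 0 ≤ ((1 - s) * a) * (s * b) * (-eta (coe4 x) (coe4 y) - 1) := by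
      have : 0 ≤ 1 - s := by linarith
      have : 0 ≤ -eta (coe4 x) (coe4 y) - 1 := by linarith
      positivity
    nlinarith
  have hpos : ∀ s : Set.Icc (0 : ℝ) 1, 0 < v s 0 := by
    rintro ⟨s, hs0, hs1⟩
    have h1 : 0 < klein4 x 0 := mul_pos (hi x) (pos_of_mem_hyp4 (coe4_mem x)).1
    have h2 : 0 < klein4 y 0 := mul_pos (hi y) (pos_of_mem_hyp4 (coe4_mem y)).1
    show 0 < (1 - s) * klein4 x 0 + s * klein4 y 0
    rcases hs0.eq_or_lt with h | h
    · rw [← h]; simpa using h1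
    · have : 0 ≤ (1 - s) * klein4 x 0 := mul_nonneg (by linarith) h1.le
      positivity
  have hmem : ∀ s : Set.Icc (0 : ℝ) 1, (√(-eta (v s) (v s)))⁻¹ • v s ∈ Hyp4 := by
    intro s
    have h1 : 0 < √(-eta (v s) (v s)) := Real.sqrt_pos.2 (hq s)
    have h2 : √(-eta (v s) (v s)) ^ 2 = -eta (v s) (v s) := Real.sq_sqrt (hq s).le
    have h3 : eta ((√(-eta (v s) (v s)))⁻¹ • v s) ((√(-eta (v s) (v s)))⁻¹ • v s) = -1 := by
      rw [eta_smul_left, eta_smul_right]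
      field_simp
      linarith
    refine ⟨mul_pos (inv_pos.2 h1) (hpos s), ?_⟩
    simp only [eta] at h3 ⊢
    linarith
  set g : Set.Icc (0 : ℝ) 1 → Hyp := fun s => ofHyp4 _ (hmem s) with hg
  have hcg : ∀ s, coe4 (g s) = (√(-eta (v s) (v s)))⁻¹ • v s := fun s => coe4_ofHyp4 _ _
  have hgc : Continuous g := by
    rw [isEmbedding_coe4.continuous_iff]
    have : coe4 ∘ g = fun s : Set.Icc (0 : ℝ) 1 => (√(-eta (v s) (v s)))⁻¹ • v s := funext hcg
    rw [this]
    have hvs : Continuous fun s : Set.Icc (0 : ℝ) 1 => v s := hvc.comp continuous_subtype_val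
    exact ((hvs.eta hvs).neg.sqrt.inv₀ fun s => (Real.sqrt_pos.2 (hq s)).ne').smul hvs
  have hkg : ∀ s, klein4 (g s) = v s := by
    intro s
    have h1 : 0 < √(-eta (v s) (v s)) := Real.sqrt_pos.2 (hq s)
    have h2 : height (g s) = (√(-eta (v s) (v s)))⁻¹ := by
      rw [height, hcg]
      have : v s 0 + v s 1 = 1 := by
        have := klein4_add x
        have := klein4_add y
        simp only [hv, Pi.add_apply, Pi.smul_apply, smul_eq_mul]
        linear_combination (1 - (s : ℝ)) * klein4_add x + (s : ℝ) * klein4_add y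
      simp only [Pi.smul_apply, smul_eq_mul]
      rw [← mul_add, this, mul_one]
    rw [klein4, h2, hcg, inv_inv, smul_inv_smul₀ h1.ne']
  have hinj : ∀ z w : Hyp, klein4 z = klein4 w → z = w := by
    intro z w h
    have h1 : (height z)⁻¹ = (height w)⁻¹ := by
      have h2 := eta_klein4 z z
      have h3 := eta_klein4 w w
      rw [eta_self_hyp4 (coe4_mem _)] at h2 h3
      rw [h] at h2
      refine (sq_eq_sq₀ (hi z).le (hi w).le).1 ?_
      linarith
    apply coe4_injective
    rw [klein4, klein4, h1] at h
    exact smul_right_injective _ (hi w).ne' h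
  refine ⟨Set.range g, ?_, ⟨⟨0, by simp⟩, ?_⟩, ⟨⟨1, by simp⟩, ?_⟩, isPreconnected_range hgc⟩
  · rintro _ ⟨s, rfl⟩
    show klein4 (g s) ∈ B
    rw [hkg]
    exact hB hx hy (by linarith [s.2.2]) s.2.1 (by ring)
  · apply hinj
    rw [hkg]
    simp [hv]
  · apply hinj
    rw [hkg]
    simp [hv]

/-- If a connected set `W` contains the part of `A` far from `S`, and does not meet `S'`, it is on
the side of `S'` accumulating at an ideal point of `A`. -/
theorem Sides.subset_of_ideal {Γ : Subgroup PSL(2, ℂ)} {S S' : Set (Mfd Γ)} {Up Um : Set Hyp}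
    {n : R4 → R4} (h : Sides (lift S) Up Um n) (hS : IsCompact S) (hS' : IsCompact S')
    {A A' B' W : Set Hyp} {R : ℝ} {P : Ideal} (hP : P ∉ limitSet Γ)
    (hPA : (P : Mat) ∈ closure (klein '' A)) (hPA' : (P : Mat) ∈ closure (klein '' A'))
    (hcomp : AreTwoComponents (lift S') A' B') (hW : IsPreconnected W)
    (hWS : Disjoint W (lift S')) (hAW : ∀ y ∈ A, R < |h.sd y| → y ∈ W) : W ⊆ A' := by
  obtain ⟨C, hC⟩ := h.exists_height_le_of_sd hS R
  obtain ⟨C', hC'⟩ := exists_height_le hS'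
  have hCs : ∀ y ∈ lift S', ∃ γ ∈ Γ, height (γ • y) ≤ C' := by
    intro y hy
    obtain ⟨z, hz, hzC⟩ := hC' _ hy
    obtain ⟨γ, hγ, rfl⟩ := proj_eq_iff.1 hz
    exact ⟨γ, hγ, hzC⟩
  have h1 := notMem_closure_klein hP (T := {y | |h.sd y| ≤ R}) hC
  have h2 := notMem_closure_klein hP hCs
  -- A ball around `P` in the Klein model that misses both {|sd| ≤ R} and the second surface. Its
  -- trace on hyperbolic space is connected, so it lies in `A'`; it also contains a point of `A`,
  -- which is far from the first surface and hence in `W`.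
  obtain ⟨ε, hε, hball⟩ := Metric.isOpen_iff.1
    (isClosed_closure.isOpen_compl.inter isClosed_closure.isOpen_compl) (ofMat (P : Mat)) ⟨h1, h2⟩
  have hB1 : ∀ y, klein4 y ∈ Metric.ball (ofMat (P : Mat)) ε → R < |h.sd y| := by
    intro y hy
    by_contra! hcon
    exact (hball hy).1 (subset_closure (Set.mem_image_of_mem _ hcon))
  have hB2 : ∀ y, klein4 y ∈ Metric.ball (ofMat (P : Mat)) ε → y ∉ lift S' :=
    fun y hy hcon => (hball hy).2 (subset_closure (Set.mem_image_of_mem _ hcon))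
  obtain ⟨_, hyB, y, hyA, rfl⟩ := mem_closure_iff.1 ((mem_closure_klein_iff _ _).1 hPA) _
    Metric.isOpen_ball (Metric.mem_ball_self hε)
  obtain ⟨_, hzB, z, hzA, rfl⟩ := mem_closure_iff.1 ((mem_closure_klein_iff _ _).1 hPA') _
    Metric.isOpen_ball (Metric.mem_ball_self hε)
  have hsub := (isPreconnected_klein4_preimage (convex_ball (ofMat (P : Mat)) ε)
    ).subset_left_of_subset_union hcomp.open_left hcomp.open_right hcomp.disjoint
    (fun w hw => by rw [hcomp.union]; exact hB2 w hw) ⟨z, hzB, hzA⟩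
  refine hW.subset_left_of_subset_union hcomp.open_left hcomp.open_right hcomp.disjoint
    (fun w hw => by rw [hcomp.union]; exact Set.disjoint_left.1 hWS hw)
    ⟨y, hAW y hyA (hB1 y hyB), hsub hyB⟩


/-! ### Comparison of tangent surfaces -/

/-- The linear projection which restricts to a global chart of the hyperboloid. -/
noncomputable def hypProj : R4 →L[ℝ] ℝ × ℝ × ℝ :=
  LinearMap.toContinuousLinearMap
    { toFun := fun v => ((v 0 - v 1) / 2, v 2, v 3)
      map_add' := fun v w => by
        refine Prod.ext ?_ rfl
        show (v 0 + w 0 - (v 1 + w 1)) / 2 = (v 0 - v 1) / 2 + (w 0 - w 1) / 2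
        ring
      map_smul' := fun a v => by
        refine Prod.ext ?_ rfl
        show (a * v 0 - a * v 1) / 2 = a * ((v 0 - v 1) / 2)
        ring }

theorem hypProj_apply (v : R4) : hypProj v = ((v 0 - v 1) / 2, v 2, v 3) := rfl

theorem hypProj_injOn : Set.InjOn hypProj Hyp4 := by
  intro v hv w hw h
  have h1 := hypInv_coe4 (ofHyp4 v hv)
  have h2 := hypInv_coe4 (ofHyp4 w hw)
  rw [coe4_ofHyp4, ← hypProj_apply] at h1 h2
  rw [← h1, h, h2]

/-- The kernel of the projection consists of multiples of the identity matrix, which are timelike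
unless zero, so it meets no tangent space of the hyperboloid. -/
theorem eq_zero_of_hypProj {x v : R4} (hx : x ∈ Hyp4) (hv : eta v x = 0) (h : hypProj v = 0) :
    v = 0 := by
  rw [hypProj_apply, Prod.mk_eq_zero, Prod.mk_eq_zero] at h
  obtain ⟨h1, h2, h3⟩ := h
  obtain ⟨k1, k2⟩ := pos_of_mem_hyp4 hx
  have h4 : v 1 = v 0 := by linarith
  simp only [eta, h2, h3, h4] at hv
  have h5 : v 0 * (x 0 + x 1) = 0 := by linarith
  have h6 : v 0 = 0 := (mul_eq_zero.1 h5).resolve_right (by positivity)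
  funext i
  fin_cases i
  · exact h6
  · exact h4.trans h6
  · exact h2
  · exact h3

namespace LParam

variable {T : Set R4} {x : R4} {X : Plane → R4} {n : R4 → R4}

theorem eta_fderiv_normal (h : LParam T x X) (hn : LNormal T n) (v : Plane) :
    eta (fderiv ℝ (n ∘ X) 0 v) x = 0 ∧ eta (fderiv ℝ (n ∘ X) 0 v) (n x) = 0 := by
  have hd := h.differentiableAt_normal hn
  constructor
  · have := fderiv_eta_of_eventuallyEq hd h.differentiableAt
      (h.eventually_mem.mono fun u hu => (hn.tangent _ hu : eta ((n ∘ X) u) (X u) = 0)) v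
    rw [Function.comp_apply, h.map_zero, h.normal_zero hn] at this
    linarith
  · have := fderiv_eta_of_eventuallyEq hd hd
      (h.eventually_mem.mono fun u hu => (hn.unit _ hu : eta ((n ∘ X) u) ((n ∘ X) u) = 1)) v
    rw [Function.comp_apply, h.map_zero, eta_comm (n x)] at this
    linarith

/-- The derivative of the equidistant immersion. -/
noncomputable def dz (X N : Plane → R4) (r : ℝ) (v : Plane) : R4 :=
  Real.cosh r • fderiv ℝ X 0 v - Real.sinh r • fderiv ℝ N 0 v

/-- The product is cosh r · I + sinh r · II, so the equidistant maps are immersions at every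
distance. -/
theorem eta_dz_pos (h : LParam T x X) (hs : SmallForms T n) (r : ℝ) {v : Plane}
    (hv : v ≠ 0) : 0 < eta (dz X (n ∘ X) r v) (fderiv ℝ X 0 v) := by
  have h1 := abs_lt.1 (hs x h.mem X h v hv)
  have h2 := Real.cosh_pos r
  have h3 : |Real.sinh r| < Real.cosh r := by
    rw [Real.abs_sinh, ← Real.cosh_abs]; exact Real.sinh_lt_cosh _
  have h4 := abs_lt.1 h3
  have h5 : eta (dz X (n ∘ X) r v) (fderiv ℝ X 0 v) =
      Real.cosh r * fst X v v + Real.sinh r * snd X (n ∘ X) v v := by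
    rw [dz, eta_sub_left, eta_smul_left, eta_smul_left, fst, snd]; ring
  rw [h5]
  nlinarith

theorem hasFDerivAt_zeta (h : LParam T x X) (hn : LNormal T n) (r : ℝ) :
    ∃ D : Plane × ℝ →L[ℝ] R4,
      HasFDerivAt (fun p : Plane × ℝ => zeta (X p.1) (n (X p.1)) p.2) D (0, r) ∧
      ∀ v s, D (v, s) = dz X (n ∘ X) r v + s • (Real.sinh r • x - Real.cosh r • n x) := by
  have hX : HasFDerivAt (fun p : Plane × ℝ => X p.1)
      ((fderiv ℝ X 0).comp (ContinuousLinearMap.fst ℝ Plane ℝ)) (0, r) :=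
    HasFDerivAt.comp (g := X) (0, r) h.differentiableAt.hasFDerivAt hasFDerivAt_fst
  have hN : HasFDerivAt (fun p : Plane × ℝ => n (X p.1))
      ((fderiv ℝ (n ∘ X) 0).comp (ContinuousLinearMap.fst ℝ Plane ℝ)) (0, r) :=
    HasFDerivAt.comp (g := n ∘ X) (0, r) (h.differentiableAt_normal hn).hasFDerivAt hasFDerivAt_fst
  have hc : HasFDerivAt (fun p : Plane × ℝ => Real.cosh p.2)
      (Real.sinh r • (ContinuousLinearMap.snd ℝ Plane ℝ)) (0, r) :=
    HasDerivAt.comp_hasFDerivAt (f := fun p : Plane × ℝ => p.2) ((0 : Plane), r)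
      (Real.hasDerivAt_cosh r) hasFDerivAt_snd
  have hsn : HasFDerivAt (fun p : Plane × ℝ => Real.sinh p.2)
      (Real.cosh r • (ContinuousLinearMap.snd ℝ Plane ℝ)) (0, r) :=
    HasDerivAt.comp_hasFDerivAt (f := fun p : Plane × ℝ => p.2) ((0 : Plane), r)
      (Real.hasDerivAt_sinh r) hasFDerivAt_snd
  refine ⟨_, (hc.smul hX).sub (hsn.smul hN), fun v s => ?_⟩
  simp only [sub_apply, add_apply, smul_apply, ContinuousLinearMap.comp_apply,
    ContinuousLinearMap.smulRight_apply, ContinuousLinearMap.coe_fst',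
    ContinuousLinearMap.coe_snd', h.map_zero, dz, smul_eq_mul]
  module

/-- A surface near a point of an equidistant surface is a graph in Fermi coordinates. -/
theorem exists_fermi (h : LParam T x X) (hn : LNormal T n) (hs : SmallForms T n) {r : ℝ}
    {Y : Plane → R4} (hY : ContDiffAt ℝ 2 Y 0) (hY0 : Y 0 = zeta x (n x) r)
    (hYm : ∀ᶠ w in 𝓝 0, Y w ∈ Hyp4) :
    ∃ U : Plane → Plane, ∃ t : Plane → ℝ, ContDiffAt ℝ 1 U 0 ∧ ContDiffAt ℝ 1 t 0 ∧ U 0 = 0 ∧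
      t 0 = r ∧ ∀ᶠ w in 𝓝 0, Y w = zeta (X (U w)) (n (X (U w))) (t w) := by
  have hx := hn.sub h.mem
  obtain ⟨D, hD, hDv⟩ := h.hasFDerivAt_zeta hn r
  set Z : Plane × ℝ → R4 := fun p => zeta (X p.1) (n (X p.1)) p.2 with hZ
  have hZ1 : ContDiffAt ℝ 1 Z (0, r) := by
    have h1 : ContDiffAt ℝ 1 (fun p : Plane × ℝ => X p.1) (0, r) :=
      ContDiffAt.comp (g := X) (0, r) (h.contDiffAt.of_le (by norm_num)) contDiffAt_fst
    have h2 : ContDiffAt ℝ 1 (fun p : Plane × ℝ => n (X p.1)) (0, r) :=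
      ContDiffAt.comp (g := n ∘ X) (0, r) (h.contDiffAt_normal hn) contDiffAt_fst
    exact (contDiffAt_snd.cosh.smul h1).sub (contDiffAt_snd.sinh.smul h2)
  have htan : eta (Real.sinh r • x - Real.cosh r • n x) (zeta x (n x) r) = 0 := by
    simp only [zeta, eta_sub_left, eta_sub_right, eta_smul_left, eta_smul_right,
      eta_self_hyp4 hx, hn.unit _ h.mem, hn.tangent _ h.mem, eta_comm x (n x)]
    ring
  have hzt : ∀ v, eta (dz X (n ∘ X) r v) (zeta x (n x) r) = 0 := by
    intro v
    obtain ⟨e1, e2⟩ := h.eta_fderiv_normal hn v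
    have e3 := h.tangent_zero hn.sub v
    have e4 := h.normal_zero hn v
    rw [eta_comm] at e4
    simp only [dz, zeta, eta_sub_left, eta_sub_right, eta_smul_left, eta_smul_right, e1, e2, e3, e4]
    ring
  -- The linear projection replaces the hyperboloid by a space of dimension three, so that the
  -- inverse function theorem applies. Products with dX v and then with the normal show that nothing
  -- is in the kernel.
  have hinj : Function.Injective (hypProj.comp D) := by
    rw [injective_iff_map_eq_zero]
    rintro ⟨v, s⟩ hvs
    rw [ContinuousLinearMap.comp_apply, hDv] at hvs
    have h0 := eq_zero_of_hypProj
      (zeta_mem hx (hn.tangent _ h.mem) (hn.unit _ h.mem) r) (by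
        rw [eta_add_left, eta_smul_left, htan, hzt]; ring) hvs
    have hv : v = 0 := by
      by_contra hv
      have h1 := h.eta_dz_pos hs r hv
      have h2 := congrArg (fun z => eta z (fderiv ℝ X 0 v)) h0
      simp only [eta_add_left, eta_smul_left, eta_sub_left, eta_zero_left, h.normal_zero hn,
        eta_comm x, h.tangent_zero hn.sub] at h2
      linarith
    subst hv
    have hs0 : s = 0 := by
      have h2 := congrArg (fun z => eta z (n x)) h0
      simp only [dz, _root_.map_zero, smul_zero, sub_zero, zero_add, eta_smul_left, eta_sub_left,
        eta_zero_left, hn.unit _ h.mem, eta_comm x, hn.tangent _ h.mem] at h2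
      have := Real.cosh_pos r
      have h3 : s * Real.cosh r = 0 := by linarith
      exact (mul_eq_zero.1 h3).resolve_right this.ne'
    rw [hs0]; rfl
  set e : (Plane × ℝ) ≃L[ℝ] ℝ × ℝ × ℝ :=
    (LinearMap.linearEquivOfInjective (hypProj.comp D : (Plane × ℝ) →ₗ[ℝ] ℝ × ℝ × ℝ) hinj
      (by simp)).toContinuousLinearEquiv with he
  have hΦ : ContDiffAt ℝ 1 (hypProj ∘ Z) (0, r) := hypProj.contDiff.contDiffAt.comp _ hZ1
  have hΦd : HasFDerivAt (hypProj ∘ Z) (e : (Plane × ℝ) →L[ℝ] ℝ × ℝ × ℝ) (0, r) := by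
    have := hypProj.hasFDerivAt.comp (0, r) hD
    refine this.congr_fderiv ?_
    ext p <;> rfl
  have hstrict := hΦ.hasStrictFDerivAt' hΦd (by norm_num)
  set g := hΦ.localInverse hΦd (by norm_num) with hg
  have hg1 : ContDiffAt ℝ 1 g ((hypProj ∘ Z) (0, r)) := hΦ.to_localInverse hΦd (by norm_num)
  have hg0 : g ((hypProj ∘ Z) (0, r)) = (0, r) := hΦ.localInverse_apply_image hΦd (by norm_num)
  have hgr : ∀ᶠ z in 𝓝 ((hypProj ∘ Z) (0, r)), (hypProj ∘ Z) (g z) = z :=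
    hstrict.eventually_right_inverse
  have hZ0 : (hypProj ∘ Z) (0, r) = hypProj (Y 0) := by
    rw [hY0, Function.comp_apply, hZ]
    simp only [h.map_zero]
  rw [hZ0] at hg1 hg0 hgr
  have hgY : ContDiffAt ℝ 1 (fun w => g (hypProj (Y w))) 0 :=
    ContDiffAt.comp (g := g) (f := fun w => hypProj (Y w)) 0 hg1
      (hypProj.contDiff.contDiffAt.comp _ (hY.of_le (by norm_num)))
  have hYc : ContinuousAt (fun w => hypProj (Y w)) 0 :=
    hypProj.continuous.continuousAt.comp hY.continuousAt
  refine ⟨fun w => (g (hypProj (Y w))).1, fun w => (g (hypProj (Y w))).2, contDiffAt_fst.comp _ hgY,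
    contDiffAt_snd.comp _ hgY, by simp only [hg0], by simp only [hg0], ?_⟩
  have hU0 : Tendsto (fun w => (g (hypProj (Y w))).1) (𝓝 0) (𝓝 0) := by
    have := (continuous_fst.continuousAt.comp hgY.continuousAt :
      ContinuousAt (fun w => (g (hypProj (Y w))).1) 0)
    have h2 := this.tendsto
    simp only [Function.comp_apply, hg0] at h2
    exact h2
  filter_upwards [hYm, hYc.eventually hgr, hU0.eventually h.eventually_mem] with w h1 h2 h3
  exact hypProj_injOn h1 (zeta_mem (hn.sub h3) (hn.tangent _ h3) (hn.unit _ h3) _) h2.symm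

end LParam


/-- If the second derivative were positive, the point would also be a local minimum, the function
locally constant, and the second derivative zero. Only a derivative `k` near 0, itself
differentiable at 0, is required, because the distance in Fermi coordinates is merely known to be
C¹. -/
theorem second_deriv_nonpos {g k : ℝ → ℝ} {κ : ℝ} (hg : ∀ᶠ s in 𝓝 0, HasDerivAt g (k s) s)
    (hk : HasDerivAt k κ 0) (hmax : IsLocalMax g 0) : κ ≤ 0 := by
  by_contra! hκ
  have e : deriv g =ᶠ[𝓝 0] k := hg.mono fun s hs => hs.deriv
  have h2 : deriv (deriv g) 0 = κ := by rw [e.deriv_eq]; exact hk.deriv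
  have hmin : IsLocalMin g 0 := isLocalMin_of_deriv_deriv_pos (h2 ▸ hκ) hmax.deriv_eq_zero
    hg.self_of_nhds.continuousAt
  have hc : g =ᶠ[𝓝 0] fun _ => g 0 := (hmax.and hmin).mono fun s hs => le_antisymm hs.1 hs.2
  have h3 : deriv g =ᶠ[𝓝 0] fun _ => 0 := by
    have := hc.deriv
    simpa using this
  rw [h3.deriv_eq] at h2
  simp at h2
  exact hκ.ne h2

theorem second_deriv_nonneg {g k : ℝ → ℝ} {κ : ℝ} (hg : ∀ᶠ s in 𝓝 0, HasDerivAt g (k s) s)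
    (hk : HasDerivAt k κ 0) (hmin : IsLocalMin g 0) : 0 ≤ κ := by
  have := second_deriv_nonpos (g := fun s => -g s) (k := fun s => -k s)
    (hg.mono fun s hs => hs.neg) hk.neg hmin.neg
  linarith

namespace LParam

variable {T : Set R4} {x : R4} {X : Plane → R4} {n : R4 → R4}

theorem comp_equiv (h : LParam T x X) (L : Plane ≃L[ℝ] Plane) : LParam T x (X ∘ L) where
  contDiffAt := by
    have h0 : ContDiffAt ℝ 2 X (L 0) := by rw [_root_.map_zero L]; exact h.contDiffAt
    exact h0.comp (0 : Plane) L.contDiff.contDiffAt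
  map_zero := by rw [Function.comp_apply, _root_.map_zero L, h.map_zero]
  immersion := by
    have h0 : HasFDerivAt X (fderiv ℝ X 0) (L 0) := by
      rw [_root_.map_zero L]; exact h.differentiableAt.hasFDerivAt
    rw [(h0.comp (0 : Plane) L.hasFDerivAt).fderiv]
    exact h.immersion.comp L.injective
  map_nhds := by
    have h0 : map L (𝓝 0) = 𝓝 0 := by
      have := L.toHomeomorph.map_nhds_eq 0
      simpa using this
    rw [← Filter.map_map, h0, h.map_nhds]

theorem fderiv_comp_equiv {N : Plane → R4} (hN : DifferentiableAt ℝ N 0) (L : Plane ≃L[ℝ] Plane)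
    (v : Plane) : fderiv ℝ (N ∘ L) 0 v = fderiv ℝ N 0 (L v) := by
  have h0 : HasFDerivAt N (fderiv ℝ N 0) (L 0) := by
    rw [_root_.map_zero L]; exact hN.hasFDerivAt
  rw [(h0.comp (0 : Plane) L.hasFDerivAt).fderiv]
  rfl

/-- The first forms agree, so the difference of mean curvatures is half the trace of a nonnegative
form. Symmetry of the second forms is not needed: the off-diagonal entries are averaged. -/
theorem mc_le {Z N Y M : Plane → R4} (hE : 0 < fst Z (pb 0) (pb 0)) (hG : 0 < fst Z (pb 1) (pb 1))
    (hg : 0 < gram Z) (hf : ∀ v, fderiv ℝ Y 0 v = fderiv ℝ Z 0 v)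
    (hs : ∀ v, snd Z N v v ≤ snd Y M v v) : mc Z N ≤ mc Y M := by
  have e1 : ∀ v w, fst Y v w = fst Z v w := fun v w => by rw [fst, fst, hf, hf]
  have e2 : gram Y = gram Z := by simp only [gram, e1]
  rw [mc, mc, e2]
  simp only [e1]
  refine div_le_div_of_nonneg_right ?_ (by positivity)
  have key : ∀ a b : ℝ, 0 ≤ a ^ 2 * (snd Y M (pb 0) (pb 0) - snd Z N (pb 0) (pb 0)) +
      2 * (a * b) * ((snd Y M (pb 0) (pb 1) + snd Y M (pb 1) (pb 0) - snd Z N (pb 0) (pb 1) -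
        snd Z N (pb 1) (pb 0)) / 2) +
      b ^ 2 * (snd Y M (pb 1) (pb 1) - snd Z N (pb 1) (pb 1)) := by
    intro a b
    have := hs (a • pb 0 + b • pb 1)
    simp only [snd, map_add, map_smul, eta_add_left, eta_add_right, eta_smul_left,
      eta_smul_right] at this ⊢
    linarith
  have hl := key 1 0
  have hn := key 0 1
  have hd := discrim_le_zero (a := snd Y M (pb 1) (pb 1) - snd Z N (pb 1) (pb 1))
    (b := snd Y M (pb 0) (pb 1) + snd Y M (pb 1) (pb 0) - snd Z N (pb 0) (pb 1) -
        snd Z N (pb 1) (pb 0)) (c := snd Y M (pb 0) (pb 0) - snd Z N (pb 0) (pb 0))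
    (fun b => by have := key 1 b; linarith)
  rw [discrim] at hd
  have := trace_form_pos hE hG hg (l := snd Y M (pb 0) (pb 0) - snd Z N (pb 0) (pb 0))
    (n := snd Y M (pb 1) (pb 1) - snd Z N (pb 1) (pb 1))
    (m := (snd Y M (pb 0) (pb 1) + snd Y M (pb 1) (pb 0) - snd Z N (pb 0) (pb 1) -
        snd Z N (pb 1) (pb 0)) / 2) (by linarith) (by linarith) (by linarith)
  linarith

/-- The derivative of the distance from a surface, in Fermi coordinates. -/
theorem fermi_fderiv (h : LParam T x X) (hn : LNormal T n) {Y : Plane → R4} {U : Plane → Plane} {t : Plane → ℝ}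
    (hY : ContDiffAt ℝ 2 Y 0) (hU : ContDiffAt ℝ 1 U 0) (ht : ContDiffAt ℝ 1 t 0) (hU0 : U 0 = 0)
    (heq : ∀ᶠ w in 𝓝 0, Y w = zeta (X (U w)) (n (X (U w))) (t w)) :
    ∀ᶠ w in 𝓝 0, ∀ v,
      Real.cosh (t w) * fderiv ℝ t w v = -eta (fderiv ℝ Y w v) (n (X (U w))) := by
  have hUt : Tendsto U (𝓝 0) (𝓝 0) := by simpa only [hU0] using hU.continuousAt.tendsto
  have hM : ContDiffAt ℝ 1 (fun w => n (X (U w))) 0 := by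
    have h0 : ContDiffAt ℝ 1 (n ∘ X) (U 0) := by rw [hU0]; exact h.contDiffAt_normal hn
    exact ContDiffAt.comp (g := n ∘ X) 0 h0 hU
  have hmem := hUt.eventually h.eventually_mem
  have e1 : ∀ᶠ w in 𝓝 0, eta (n (X (U w))) (n (X (U w))) = 1 :=
    hmem.mono fun w hw => hn.unit _ hw
  have e2 : ∀ᶠ w in 𝓝 0, eta (X (U w)) (n (X (U w))) = 0 :=
    hmem.mono fun w hw => by rw [eta_comm]; exact hn.tangent _ hw
  -- Differentiating this identity, the derivative of the normal contributes nothing, being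
  -- orthogonal to `Y`. The resulting formula for dt contains only C¹ quantities and can be
  -- differentiated again.
  have e3 : ∀ᶠ w in 𝓝 0, Real.sinh (t w) = -eta (Y w) (n (X (U w))) := by
    filter_upwards [e1, e2, heq] with w h1 h2 h3
    rw [h3, zeta, eta_sub_left, eta_smul_left, eta_smul_left, h1, h2]
    ring
  filter_upwards [hM.eventually (by norm_num), hU.eventually (by norm_num),
    ht.eventually (by norm_num), hY.eventually (by norm_num), hUt.eventually h.eventually_contDiffAt,
    hUt.eventually (h.eventually_normal hn), e1.eventually_nhds, e2.eventually_nhds,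
    e3.eventually_nhds, heq, e2] with w dM dU dt dY dX hnor i1 i2 i3 i4 i5 v
  have dM := dM.differentiableAt (by norm_num)
  have dU := dU.differentiableAt (by norm_num)
  have dt := dt.differentiableAt (by norm_num)
  have dY := dY.differentiableAt (by norm_num)
  have dX := dX.differentiableAt (by norm_num)
  have dXU : HasFDerivAt (fun w => X (U w)) ((fderiv ℝ X (U w)).comp (fderiv ℝ U w)) w :=
    HasFDerivAt.comp (g := X) w dX.hasFDerivAt dU.hasFDerivAt
  have j1 := fderiv_eta_of_eventuallyEq dM dM i1 v
  have j2 := fderiv_eta_of_eventuallyEq dXU.differentiableAt dM i2 v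
  rw [dXU.fderiv, ContinuousLinearMap.comp_apply, eta_comm _ (n (X (U w))), hnor] at j2
  have j3 : (fun z => Real.sinh (t z)) =ᶠ[𝓝 w] fun z => -eta (Y z) (n (X (U z))) := i3
  have j4 := DFunLike.congr_fun (j3.fderiv_eq (𝕜 := ℝ)) v
  rw [dt.hasFDerivAt.sinh.fderiv, fderiv_fun_neg] at j4
  have j5 : Real.cosh (t w) * fderiv ℝ t w v =
      -(fderiv ℝ (fun z => eta (Y z) (n (X (U z)))) w v) := j4
  rw [fderiv_eta dY dM] at j5
  have j6 : eta (Y w) (fderiv ℝ (fun w => n (X (U w))) w v) = 0 := by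
    rw [i4, zeta, eta_sub_left, eta_smul_left, eta_smul_left]
    rw [eta_comm _ (n (X (U w)))] at j1
    have j7 : eta (n (X (U w))) (fderiv ℝ (fun w => n (X (U w))) w v) = 0 := by linarith
    have j8 : eta (X (U w)) (fderiv ℝ (fun w => n (X (U w))) w v) = 0 := by linarith
    rw [j7, j8]; ring
  rw [j5, j6]; ring

theorem fermi_fderiv_zero (h : LParam T x X) (hn : LNormal T n) {Y : Plane → R4} {U : Plane → Plane} {t : Plane → ℝ}
    {r : ℝ} (hU : ContDiffAt ℝ 1 U 0) (ht : ContDiffAt ℝ 1 t 0) (hU0 : U 0 = 0)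
    (ht0 : t 0 = r) (heq : ∀ᶠ w in 𝓝 0, Y w = zeta (X (U w)) (n (X (U w))) (t w))
    (hdt : fderiv ℝ t 0 = 0) (v : Plane) :
    fderiv ℝ Y 0 v = dz X (n ∘ X) r (fderiv ℝ U 0 v) := by
  obtain ⟨D, hD, hDv⟩ := h.hasFDerivAt_zeta hn r
  have hUt : HasFDerivAt (fun w => (U w, t w)) ((fderiv ℝ U 0).prod (fderiv ℝ t 0)) 0 :=
    (hU.differentiableAt (by norm_num)).hasFDerivAt.prodMk
      (ht.differentiableAt (by norm_num)).hasFDerivAt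
  have hD' : HasFDerivAt (fun p : Plane × ℝ => zeta (X p.1) (n (X p.1)) p.2) D (U 0, t 0) := by
    rw [hU0, ht0]; exact hD
  have h1 := hD'.comp (0 : Plane) hUt
  have h2 : Y =ᶠ[𝓝 0] (fun p : Plane × ℝ => zeta (X p.1) (n (X p.1)) p.2) ∘
    fun w => (U w, t w) := heq
  rw [h2.fderiv_eq, h1.fderiv, ContinuousLinearMap.comp_apply, ContinuousLinearMap.prod_apply, hDv,
    hdt]
  simp

/-- The derivative of the normal of the equidistant immersion. -/
noncomputable def dn (X N : Plane → R4) (r : ℝ) (v : Plane) : R4 :=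
  Real.cosh r • fderiv ℝ N 0 v - Real.sinh r • fderiv ℝ X 0 v

/-- The second derivative of the distance from a surface on another one, at a critical point. -/
theorem fermi_second_deriv (h : LParam T x X) (hn : LNormal T n) {T' : Set R4} {q : R4}
    {Y : Plane → R4} {U : Plane → Plane} {n' : R4 → R4} {t : Plane → ℝ} {r : ℝ} (hY : LParam T' q Y)
    (hn' : LNormal T' n') (hU : ContDiffAt ℝ 1 U 0) (ht : ContDiffAt ℝ 1 t 0) (hU0 : U 0 = 0)
    (ht0 : t 0 = r) (heq : ∀ᶠ w in 𝓝 0, Y w = zeta (X (U w)) (n (X (U w))) (t w))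
    (hdt : fderiv ℝ t 0 = 0) (hnq : n' q = Real.cosh r • n x - Real.sinh r • x) (v : Plane) :
    ∃ k : ℝ → ℝ, (∀ᶠ s in 𝓝 0, HasDerivAt (fun s : ℝ => t (s • v)) (k s) s) ∧
      HasDerivAt k (-eta (dn X (n ∘ X) r (fderiv ℝ U 0 v)) (dz X (n ∘ X) r (fderiv ℝ U 0 v)) -
        snd Y (n' ∘ Y) v v) 0 := by
  have hc := Real.cosh_pos r
  have hline : ∀ s : ℝ, HasDerivAt (fun s : ℝ => s • v) v s := fun s => by
    simpa using (hasDerivAt_id s).smul_const v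
  have hl0 : Tendsto (fun s : ℝ => s • v) (𝓝 0) (𝓝 0) := by
    have := (hline 0).continuousAt.tendsto
    rwa [zero_smul] at this
  have hfd := h.fermi_fderiv hn hY.contDiffAt hU ht hU0 heq
  refine ⟨fun s => -eta (fderiv ℝ Y (s • v) v) (n (X (U (s • v)))) / Real.cosh (t (s • v)), ?_, ?_⟩
  · filter_upwards [hl0.eventually hfd, hl0.eventually (ht.eventually (by norm_num))] with s h1 h2
    have h3 := (h2.differentiableAt (by norm_num)).hasFDerivAt.comp_hasDerivAt s (hline s)
    rw [← h1 v, mul_div_cancel_left₀ _ (Real.cosh_pos _).ne']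
    exact h3
  · have hq : q = zeta x (n x) r := by
      have := heq.self_of_nhds
      rwa [hY.map_zero, hU0, h.map_zero, ht0] at this
    -- Inverting the hyperbolic rotation along the perpendicular expresses the normal at the foot
    -- through the point and normal of the second surface, so that the second derivative of `Y` is
    -- read off by `eta_hess` and `normal_hess`.
    have hnx : n x = Real.cosh r • n' q + Real.sinh r • q := by
      rw [hnq, hq, zeta]
      have := Real.cosh_sq r
      funext i
      simp only [Pi.add_apply, Pi.sub_apply, Pi.smul_apply, smul_eq_mul]
      linear_combination -(n x i) * this
    set A : Plane → ℝ := fun w => eta (fderiv ℝ Y w v) (n (X (U w))) with hA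
    have hM : HasFDerivAt (fun w => n (X (U w))) ((fderiv ℝ (n ∘ X) 0).comp (fderiv ℝ U 0)) 0 := by
      have h0 : HasFDerivAt (n ∘ X) (fderiv ℝ (n ∘ X) 0) (U 0) := by
        rw [hU0]; exact (h.differentiableAt_normal hn).hasFDerivAt
      exact HasFDerivAt.comp (g := n ∘ X) 0 h0 (hU.differentiableAt (by norm_num)).hasFDerivAt
    have hdY := (hY.contDiffAt_fderiv_apply v).differentiableAt (by norm_num)
    have hA1 := (hasFDerivAt_eta hdY.hasFDerivAt hM)
    have hA2 : HasDerivAt (fun s : ℝ => A (s • v)) _ 0 :=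
      HasFDerivAt.comp_hasDerivAt (l := A) (0 : ℝ) (by rw [zero_smul]; exact hA1) (hline 0)
    have ht1 : HasDerivAt (fun s : ℝ => t (s • v)) (fderiv ℝ t 0 v) 0 :=
      HasFDerivAt.comp_hasDerivAt (l := t) (0 : ℝ)
        (by rw [zero_smul]; exact (ht.differentiableAt (by norm_num)).hasFDerivAt) (hline 0)
    have hk := hA2.neg.div ht1.cosh (Real.cosh_pos _).ne'
    refine hk.congr_deriv ?_
    rw [zero_smul, ht0, hdt]
    simp only [add_apply, ContinuousLinearMap.comp_apply, zero_apply, mul_zero, sub_zero, hU0,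
      h.map_zero]
    have e1 : (etaL (fderiv ℝ Y 0 v)) (fderiv ℝ (n ∘ X) 0 (fderiv ℝ U 0 v)) =
      eta (fderiv ℝ Y 0 v) (fderiv ℝ (n ∘ X) 0 (fderiv ℝ U 0 v)) := rfl
    have e2 : (etaL.flip (n x)) (fderiv ℝ (fun w => fderiv ℝ Y w v) 0 v) =
      eta (fderiv ℝ (fun w => fderiv ℝ Y w v) 0 v) (n x) := rfl
    rw [e1, e2, hY.fderiv_fderiv_apply, hnx, eta_comm _ (_ + _), eta_add_left, eta_smul_left,
      eta_smul_left, hY.eta_hess hn'.sub, hY.normal_hess hn', fst,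
      h.fermi_fderiv_zero hn hU ht hU0 ht0 heq hdt]
    have e3 := Real.cosh_sq r
    rw [dn, dz]
    simp only [eta_sub_left, eta_sub_right, eta_smul_left, eta_smul_right]
    rw [eta_comm (fderiv ℝ (n ∘ X) 0 _) (fderiv ℝ X 0 _)]
    generalize eta (fderiv ℝ X 0 (fderiv ℝ U 0 v)) (fderiv ℝ X 0 (fderiv ℝ U 0 v)) = a
    generalize eta (fderiv ℝ X 0 (fderiv ℝ U 0 v)) (fderiv ℝ (n ∘ X) 0 (fderiv ℝ U 0 v)) = b
    generalize eta (fderiv ℝ (n ∘ X) 0 (fderiv ℝ U 0 v)) (fderiv ℝ (n ∘ X) 0 (fderiv ℝ U 0 v)) = d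
    generalize snd Y (n' ∘ Y) v v = e
    generalize Real.cosh r = c at *
    generalize Real.sinh r = s at *
    field_simp
    linear_combination (b * c - s * d) * e3

end LParam


namespace LParam

variable {T : Set R4} {x : R4} {X : Plane → R4} {n : R4 → R4}

theorem fderiv_zeta (h : LParam T x X) (hn : LNormal T n) (r : ℝ) (v : Plane) :
    fderiv ℝ (fun u => zeta (X u) (n (X u)) r) 0 v = dz X (n ∘ X) r v := by
  have := ((h.differentiableAt.hasFDerivAt.const_smul (Real.cosh r)).sub
    ((h.differentiableAt_normal hn).hasFDerivAt.const_smul (Real.sinh r))).fderiv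
  exact DFunLike.congr_fun this v

theorem fderiv_zeta_normal (h : LParam T x X) (hn : LNormal T n) (r : ℝ) (v : Plane) :
    fderiv ℝ (fun u => Real.cosh r • n (X u) - Real.sinh r • X u) 0 v = dn X (n ∘ X) r v := by
  have := (((h.differentiableAt_normal hn).hasFDerivAt.const_smul (Real.cosh r)).sub
    (h.differentiableAt.hasFDerivAt.const_smul (Real.sinh r))).fderiv
  exact DFunLike.congr_fun this v

end LParam

namespace Sides

variable {S Up Um : Set Hyp} {n : R4 → R4} (h : Sides S Up Um n)

include h

/-- The unit normal of the equidistant surface through a point. -/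
noncomputable def equiNormal (q : Hyp) : R4 :=
  Real.cosh (h.sd q) • n (coe4 (h.foot q)) - Real.sinh (h.sd q) • coe4 (h.foot q)

theorem coe4_eq (q : Hyp) : coe4 q = zeta (coe4 (h.foot q)) (n (coe4 (h.foot q))) (h.sd q) := by
  conv_lhs => rw [← h.normalExp_foot_sd q]
  exact coe4_normalExp _ _

theorem eta_equiNormal (q : Hyp) :
    eta (h.equiNormal q) (h.equiNormal q) = 1 ∧ eta (h.equiNormal q) (coe4 q) = 0 := by
  have hm := Set.mem_image_of_mem coe4 (h.foot q).2
  have h1 := h.normal.unit _ hm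
  have h2 := h.normal.tangent _ hm
  have h3 := eta_self_hyp4 (coe4_mem (h.foot q))
  have h4 := Real.cosh_sq (h.sd q)
  constructor
  · simp only [equiNormal, eta_sub_left, eta_sub_right, eta_smul_left, eta_smul_right, h1, h2, h3,
      eta_comm (coe4 (h.foot q)) (n _)]
    linarith
  · rw [h.coe4_eq q]
    simp only [equiNormal, zeta, eta_sub_left, eta_sub_right, eta_smul_left, eta_smul_right, h1, h2,
      h3, eta_comm (coe4 (h.foot q)) (n _)]
    ring

/-- Two surfaces in contact: the second one touches an equidistant surface of the first one. -/
theorem exists_tangent {S' : Set Hyp} {n' : R4 → R4} (hn' : LNormal (coe4 '' S') n')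
    (hp' : ∀ x ∈ coe4 '' S', ∃ X, LParam (coe4 '' S') x X) {q : Hyp} (hq : q ∈ S')
    (hext : (∀ y ∈ S', h.sd y ≤ h.sd q) ∨ ∀ y ∈ S', h.sd q ≤ h.sd y)
    (hside : n' (coe4 q) ≠ -h.equiNormal q) :
    ∃ X Y : Plane → R4, LParam (coe4 '' S) (coe4 (h.foot q)) X ∧ LParam (coe4 '' S') (coe4 q) Y ∧
      (∀ v, fderiv ℝ Y 0 v = LParam.dz X (n ∘ X) (h.sd q) v) ∧
      ((∀ y ∈ S', h.sd y ≤ h.sd q) → ∀ v, -eta (LParam.dn X (n ∘ X) (h.sd q) v)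
        (LParam.dz X (n ∘ X) (h.sd q) v) ≤ LParam.snd Y (n' ∘ Y) v v) ∧
      ((∀ y ∈ S', h.sd q ≤ h.sd y) → ∀ v, LParam.snd Y (n' ∘ Y) v v ≤
        -eta (LParam.dn X (n ∘ X) (h.sd q) v) (LParam.dz X (n ∘ X) (h.sd q) v)) := by
  set p := h.foot q with hp
  set r := h.sd q with hr
  have hn := h.normal
  obtain ⟨X, hX⟩ := h.param _ (Set.mem_image_of_mem coe4 p.2)
  obtain ⟨Y, hY⟩ := hp' _ (Set.mem_image_of_mem coe4 hq)
  have hqz : coe4 q = zeta (coe4 p) (n (coe4 p)) r := h.coe4_eq q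
  obtain ⟨U, t, hU, ht, hU0, ht0, heq⟩ := hX.exists_fermi hn h.small hY.contDiffAt
    (hY.map_zero.trans hqz) (hY.eventually_mem.mono fun w hw => hn'.sub hw)
  have htsd : ∀ᶠ w in 𝓝 0, ∃ y ∈ S', t w = h.sd y := by
    have hUt : Tendsto U (𝓝 0) (𝓝 0) := by simpa only [hU0] using hU.continuousAt.tendsto
    filter_upwards [heq, hY.eventually_mem, hUt.eventually hX.eventually_mem] with w h1 h2 h3
    obtain ⟨y, hy, hyY⟩ := h2
    obtain ⟨p', hp', hpX⟩ := h3
    refine ⟨y, hy, ?_⟩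
    have : y = normalExp hn (⟨p', hp'⟩, t w) := by
      apply coe4_injective
      rw [coe4_normalExp, hyY, h1, hpX]
    rw [this, h.sd_normalExp]
  have hmax : (∀ y ∈ S', h.sd y ≤ r) → IsLocalMax t 0 := fun hm => by
    filter_upwards [htsd] with w hw
    obtain ⟨y, hy, hyt⟩ := hw
    rw [hyt, ht0]
    exact hm y hy
  have hmin : (∀ y ∈ S', r ≤ h.sd y) → IsLocalMin t 0 := fun hm => by
    filter_upwards [htsd] with w hw
    obtain ⟨y, hy, hyt⟩ := hw
    rw [hyt, ht0]
    exact hm y hy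
  have hdt : fderiv ℝ t 0 = 0 := hext.elim (fun hm => (hmax hm).fderiv_eq_zero)
    fun hm => (hmin hm).fderiv_eq_zero
  have hdY := fun v => hX.fermi_fderiv_zero hn hU ht hU0 ht0 heq hdt v
  obtain ⟨k1, k2⟩ := h.eta_equiNormal q
  have horth : ∀ v, eta (h.equiNormal q) (fderiv ℝ Y 0 v) = 0 := by
    intro v
    have h1 := (hX.fermi_fderiv hn hY.contDiffAt hU ht hU0 heq).self_of_nhds v
    rw [hdt, hU0, hX.map_zero] at h1
    have h2 : eta (fderiv ℝ Y 0 v) (n (coe4 p)) = 0 := by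
      simp only [zero_apply, mul_zero] at h1
      linarith
    have h3 : eta (coe4 p) (fderiv ℝ Y 0 v) = 0 := by
      obtain ⟨e1, -⟩ := hX.eta_fderiv_normal hn (fderiv ℝ U 0 v)
      rw [hdY, LParam.dz, eta_comm, eta_sub_left, eta_smul_left, eta_smul_left, e1,
        hX.tangent_zero hn.sub]
      ring
    rw [equiNormal, ← hp, eta_sub_left, eta_smul_left, eta_smul_left, h3, eta_comm, h2]
    ring
  have hqT := hY.mem
  -- At a critical point of the distance the tangent planes coincide, so the unit normals agree up
  -- to sign; `hside` excludes the opposite one.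
  have hnq : n' (coe4 q) = h.equiNormal q := by
    have h1 := eq_smul_normal (coe4_mem q) (hY.tangent_zero hn'.sub (pb 0))
      (hY.tangent_zero hn'.sub (pb 1)) (hn'.tangent _ hqT) k2 (hY.normal_zero hn' _)
      (hY.normal_zero hn' _) (horth _) (horth _) (hn'.unit _ hqT)
      (indep_of_injective hY.immersion)
    set a := eta (h.equiNormal q) (n' (coe4 q)) with ha
    have h2 : a = 1 ∨ a = -1 := by
      rw [h1, eta_smul_left, eta_smul_right, hn'.unit _ hqT] at k1
      exact mul_self_eq_one_iff.1 (by linarith)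
    rcases h2 with h2 | h2
    · rw [h1, h2, one_smul]
    · refine absurd ?_ hside
      rw [h1, h2, neg_smul, one_smul, neg_neg]
  have hJ : Function.Injective (fderiv ℝ U 0) := by
    rw [injective_iff_map_eq_zero]
    intro v hv
    apply hY.immersion
    rw [map_zero, hdY, hv, LParam.dz, map_zero, map_zero, smul_zero, smul_zero, sub_zero]
  -- Reparametrizing `X` by this linear isomorphism makes the equidistant immersion and `Y` have the
  -- same differential, so that their second forms are compared on the same vectors.
  set J : Plane ≃L[ℝ] Plane :=
    (LinearMap.linearEquivOfInjective (fderiv ℝ U 0 : Plane →ₗ[ℝ] Plane) hJ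
      rfl).toContinuousLinearEquiv with hJdef
  have hJv : ∀ v, J v = fderiv ℝ U 0 v := fun v => rfl
  have d1 : ∀ v, fderiv ℝ (X ∘ J) 0 v = fderiv ℝ X 0 (fderiv ℝ U 0 v) := fun v =>
    LParam.fderiv_comp_equiv hX.differentiableAt J v
  have d2 : ∀ v, fderiv ℝ (n ∘ X ∘ J) 0 v = fderiv ℝ (n ∘ X) 0 (fderiv ℝ U 0 v) := fun v =>
    LParam.fderiv_comp_equiv (hX.differentiableAt_normal hn) J v
  have d3 : ∀ v, LParam.dz (X ∘ J) (n ∘ X ∘ J) r v = LParam.dz X (n ∘ X) r (fderiv ℝ U 0 v) :=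
    fun v => by rw [LParam.dz, d1, d2, LParam.dz]
  have d4 : ∀ v, LParam.dn (X ∘ J) (n ∘ X ∘ J) r v = LParam.dn X (n ∘ X) r (fderiv ℝ U 0 v) :=
    fun v => by rw [LParam.dn, d1, d2, LParam.dn]
  have hline : ∀ v : Plane, Tendsto (fun s : ℝ => s • v) (𝓝 0) (𝓝 0) := fun v => by
    have : Continuous fun s : ℝ => s • v := by fun_prop
    simpa using this.tendsto 0
  refine ⟨X ∘ J, Y, hX.comp_equiv J, hY, fun v => by rw [d3, hdY], fun hm v => ?_, fun hm v => ?_⟩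
  · obtain ⟨k, hk1, hk2⟩ := hX.fermi_second_deriv hn hY hn' hU ht hU0 ht0 heq hdt hnq v
    rw [d3, d4]
    have hl : IsLocalMax (fun s : ℝ => t (s • v)) 0 := by
      have := (hline v).eventually (hmax hm)
      simpa [IsLocalMax, IsMaxFilter] using this
    linarith [second_deriv_nonpos hk1 hk2 hl]
  · obtain ⟨k, hk1, hk2⟩ := hX.fermi_second_deriv hn hY hn' hU ht hU0 ht0 heq hdt hnq v
    rw [d3, d4]
    have hl : IsLocalMin (fun s : ℝ => t (s • v)) 0 := by
      have := (hline v).eventually (hmin hm)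
      simpa [IsLocalMin, IsMinFilter] using this
    linarith [second_deriv_nonneg hk1 hk2 hl]

/-- The comparison principle for mean curvatures. -/
theorem exists_mc_comparison {S' : Set Hyp} {n' : R4 → R4} {H' : ℝ}
    (hS' : LSurface (coe4 '' S') n' H') {q : Hyp} (hq : q ∈ S')
    (hext : (∀ y ∈ S', h.sd y ≤ h.sd q) ∨ ∀ y ∈ S', h.sd q ≤ h.sd y)
    (hside : n' (coe4 q) ≠ -h.equiNormal q)
    (hsc : ∀ x ∈ coe4 '' S, ∀ X, LParam (coe4 '' S) x X →
      SmallCurv (LParam.mc X (n ∘ X)) (LParam.ec X (n ∘ X))) :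
    ∃ X : Plane → R4, LParam (coe4 '' S) (coe4 (h.foot q)) X ∧
      ((∀ y ∈ S', h.sd y ≤ h.sd q) →
        curvFun (LParam.mc X (n ∘ X)) (LParam.ec X (n ∘ X)) (h.sd q) ≤ H') ∧
      ((∀ y ∈ S', h.sd q ≤ h.sd y) →
        H' ≤ curvFun (LParam.mc X (n ∘ X)) (LParam.ec X (n ∘ X)) (h.sd q)) := by
  obtain ⟨X, Y, hX, hY, hd, hmax, hmin⟩ := h.exists_tangent hS'.toLNormal hS'.param hq hext hside
  have hD := (hsc _ hX.mem X hX).denom_pos (h.sd q)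
  obtain ⟨hg, hmc⟩ := hX.mc_zeta h.normal (h.sd q) hD.ne'
  have hz := hX.fderiv_zeta h.normal (h.sd q)
  have hzn := hX.fderiv_zeta_normal h.normal (h.sd q)
  obtain ⟨g1, g2, g3⟩ := hY.gram_pos hS'.sub
  have hYm := hS'.mean _ hY.mem Y hY
  have hd' : ∀ v, fderiv ℝ Y 0 v =
      fderiv ℝ (fun u => zeta (X u) (n (X u)) (h.sd q)) 0 v := fun v => by rw [hd, hz]
  have hf : ∀ v w, LParam.fst (fun u => zeta (X u) (n (X u)) (h.sd q)) v w = LParam.fst Y v w :=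
    fun v w => by rw [LParam.fst, LParam.fst, hd', hd']
  refine ⟨X, hX, fun hm => ?_, fun hm => ?_⟩
  · rw [← hmc, ← hYm]
    refine LParam.mc_le (by rw [hf]; exact g1) (by rw [hf]; exact g2) hg hd' fun v => ?_
    refine le_trans (le_of_eq ?_) (hmax hm v)
    rw [LParam.snd, hz, hzn]
  · rw [← hmc, ← hYm]
    refine LParam.mc_le g1 g2 g3 (fun v => (hd' v).symm) fun v => ?_
    refine le_trans (hmin hm v) (le_of_eq ?_)
    rw [LParam.snd, hz, hzn]

end Sides


/-! ### The extrinsic curvature -/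

namespace LParam

variable {T : Set R4} {x : R4} {X : Plane → R4} {n : R4 → R4}

/-- Under a linear change of parameters both determinants are multiplied by the square of the same
determinant. -/
theorem ec_of_comp {X N Y M : Plane → R4} {L : Plane →L[ℝ] Plane}
    (h1 : ∀ v, fderiv ℝ Y 0 v = fderiv ℝ X 0 (L v)) (h2 : ∀ v, fderiv ℝ M 0 v = fderiv ℝ N 0 (L v))
    (hY : 0 < gram Y) : ec Y M = ec X N := by
  have f1 : ∀ v w, fst Y v w = fst X (L v) (L w) := fun v w => by rw [fst, fst, h1, h1]
  have s1 : ∀ v w, snd Y M v w = snd X N (L v) (L w) := fun v w => by rw [snd, snd, h1, h2]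
  have s2 : ∀ v w, snd X N v w = snd X N (pb 0) (pb 0) * (v 0 * w 0) +
      snd X N (pb 0) (pb 1) * (v 0 * w 1) + snd X N (pb 1) (pb 0) * (v 1 * w 0) +
      snd X N (pb 1) (pb 1) * (v 1 * w 1) := by
    intro v w
    conv_lhs => rw [plane_eq v, plane_eq w]
    simp only [snd, map_add, map_smul, eta_add_left, eta_add_right, eta_smul_left, eta_smul_right]
    ring
  set d := (L (pb 0) 0 * L (pb 1) 1 - L (pb 0) 1 * L (pb 1) 0) ^ 2 with hd
  have hg : gram Y = gram X * d := by
    rw [gram, f1, f1, f1, fst_expand X (L (pb 0)) (L (pb 0)), fst_expand X (L (pb 0)) (L (pb 1)),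
      fst_expand X (L (pb 1)) (L (pb 1)), gram, hd]
    ring
  have hdpos : d ≠ 0 := by
    rintro h0
    rw [hg, h0, mul_zero] at hY
    exact hY.false
  have hnum : snd Y M (pb 0) (pb 0) * snd Y M (pb 1) (pb 1) -
      snd Y M (pb 0) (pb 1) * snd Y M (pb 1) (pb 0) =
      (snd X N (pb 0) (pb 0) * snd X N (pb 1) (pb 1) -
        snd X N (pb 0) (pb 1) * snd X N (pb 1) (pb 0)) * d := by
    rw [s1, s1, s1, s1, s2 (L (pb 0)) (L (pb 0)), s2 (L (pb 0)) (L (pb 1)),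
      s2 (L (pb 1)) (L (pb 0)), s2 (L (pb 1)) (L (pb 1)), hd]
    ring
  rw [ec, hg, hnum, mul_div_mul_right _ _ hdpos, ec]

/-- The extrinsic curvature does not depend on the parametrization. -/
theorem ec_eq (h : LParam T x X) (hn : LNormal T n) {Y : Plane → R4} (hY : LParam T x Y) :
    ec Y (n ∘ Y) = ec X (n ∘ X) := by
  obtain ⟨U, V, ψ, -, hVo, h0, hxV, -, h1, h2, h3⟩ := h.chart univ_mem
  set τ : Plane → Plane := fun u => ψ (Y u) with hτ
  have hτ0 : τ 0 = 0 := by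
    rw [hτ]
    simp only [hY.map_zero]
    rw [← h.map_zero, (h1 0 h0).2.1]
  have hτd : DifferentiableAt ℝ τ 0 := by
    have h4 : DifferentiableAt ℝ ψ (Y 0) := by
      rw [hY.map_zero]; exact (h3 x hxV).differentiableAt (by norm_num)
    exact h4.comp (0 : Plane) hY.differentiableAt
  have he : ∀ᶠ u in 𝓝 0, X (τ u) = Y u := by
    have h5 : ∀ᶠ u in 𝓝 0, Y u ∈ V := hY.contDiffAt.continuousAt.eventually_mem
      (by rw [hY.map_zero]; exact hVo.mem_nhds hxV)
    filter_upwards [h5, hY.eventually_mem] with u h6 h7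
    exact (h2 _ ⟨h6, h7⟩).2
  have hcomp : ∀ {N : Plane → R4} {M : Plane → R4}, DifferentiableAt ℝ N 0 →
      (∀ᶠ u in 𝓝 0, N (τ u) = M u) → ∀ v, fderiv ℝ M 0 v = fderiv ℝ N 0 (fderiv ℝ τ 0 v) := by
    intro N M hN hNM v
    have e1 : M =ᶠ[𝓝 0] N ∘ τ := hNM.mono fun u hu => hu.symm
    have hN' : HasFDerivAt N (fderiv ℝ N 0) (τ 0) := by rw [hτ0]; exact hN.hasFDerivAt
    rw [e1.fderiv_eq, (hN'.comp (0 : Plane) hτd.hasFDerivAt).fderiv]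
    rfl
  refine ec_of_comp (L := fderiv ℝ τ 0) (hcomp h.differentiableAt he)
    (hcomp (h.differentiableAt_normal hn) (he.mono fun u hu => ?_))
    (hY.gram_pos hn.sub).2.2
  simp only [Function.comp_apply, hu]

/-- The second form is η(n, d²X), which is continuous because `X` is C² and the normal is
continuous. -/
theorem eventually_lt_ec (h : LParam T x X) (hn : LNormal T n) {c : ℝ} (hc : c < ec X (n ∘ X)) :
    ∀ᶠ u in 𝓝 0, ∃ Y, LParam T (X u) Y ∧ c < ec Y (n ∘ Y) := by
  set f : Plane → Plane → Plane → ℝ := fun u v w => eta (fderiv ℝ X u v) (fderiv ℝ X u w) with hf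
  set s : Plane → Plane → Plane → ℝ := fun u v w =>
    eta (n (X u)) (fderiv ℝ (fderiv ℝ X) u v w) with hs
  have hfst : ∀ u v w, fst (fun z => X (u + z)) v w = f u v w := by
    intro u v w
    rw [fst, fderiv_comp_add_left, add_zero]
  have hsnd : ∀ u, LParam T (X u) (fun z => X (u + z)) → ∀ v w,
      snd (fun z => X (u + z)) (n ∘ fun z => X (u + z)) v w = s u v w := by
    intro u hu v w
    rw [← hu.normal_hess hn]
    have : fderiv ℝ (fun z => X (u + z)) = fun z => fderiv ℝ X (u + z) :=
      funext fun z => fderiv_comp_add_left u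
    rw [this, fderiv_comp_add_left, add_zero]
  have c1 : ContinuousAt (fderiv ℝ X) 0 := h.contDiffAt_fderiv.continuousAt
  have c2 : ContinuousAt (fderiv ℝ (fderiv ℝ X)) 0 :=
    (h.contDiffAt_fderiv.fderiv_right (m := 0) (by norm_num)).continuousAt
  have c3 : ContinuousAt (fun u => n (X u)) 0 := (h.contDiffAt_normal hn).continuousAt
  have ceta : ∀ {g k : Plane → R4}, ContinuousAt g 0 → ContinuousAt k 0 →
      ContinuousAt (fun u => eta (g u) (k u)) 0 := fun hg hk =>
    ContinuousAt.comp (g := fun p : R4 × R4 => eta p.1 p.2) continuous_eta.continuousAt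
      (hg.prodMk hk)
  have cf : ∀ v w, ContinuousAt (fun u => f u v w) 0 := fun v w =>
    ceta (c1.clm_apply continuousAt_const) (c1.clm_apply continuousAt_const)
  have cs : ∀ v w, ContinuousAt (fun u => s u v w) 0 := fun v w =>
    ceta c3 ((c2.clm_apply continuousAt_const).clm_apply continuousAt_const)
  set g : Plane → ℝ := fun u =>
    (s u (pb 0) (pb 0) * s u (pb 1) (pb 1) - s u (pb 0) (pb 1) * s u (pb 1) (pb 0)) /
      (f u (pb 0) (pb 0) * f u (pb 1) (pb 1) - f u (pb 0) (pb 1) ^ 2) with hg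
  have hgec : ∀ u, LParam T (X u) (fun z => X (u + z)) →
      ec (fun z => X (u + z)) (n ∘ fun z => X (u + z)) = g u := by
    intro u hu
    rw [ec, gram]
    simp only [hsnd u hu, hfst, hg]
  have hX0 : (fun z => X (0 + z)) = X := by funext z; rw [zero_add]
  have hg0 : ec X (n ∘ X) = g 0 := by
    have := hgec 0 (by rw [hX0, h.map_zero]; exact h)
    rwa [hX0] at this
  have hden : f 0 (pb 0) (pb 0) * f 0 (pb 1) (pb 1) - f 0 (pb 0) (pb 1) ^ 2 ≠ 0 :=
    (h.gram_pos hn.sub).2.2.ne'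
  have hgc : ContinuousAt g 0 :=
    (((cs _ _).mul (cs _ _)).sub ((cs _ _).mul (cs _ _))).div
      (((cf _ _).mul (cf _ _)).sub ((cf _ _).pow 2)) hden
  rw [hg0] at hc
  filter_upwards [hgc.eventually (lt_mem_nhds hc), h.recenter] with u h1 h2
  exact ⟨_, h2.2, by rwa [hgec u h2.2]⟩

end LParam

/-! ### Isometries -/

theorem eq_zero_of_eta {v : R4} (h : ∀ w, eta v w = 0) : v = 0 := by
  have h0 := h ![1, 0, 0, 0]
  have h1 := h ![0, 1, 0, 0]
  have h2 := h ![0, 0, 1, 0]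
  have h3 := h ![0, 0, 0, 1]
  simp [eta] at h0 h1 h2 h3
  funext i
  fin_cases i <;> assumption

theorem ofMat_add (Y Z : Mat) : ofMat (Y + Z) = ofMat Y + ofMat Z := by
  funext i
  fin_cases i <;> simp [ofMat]

theorem ofMat_smul (a : ℝ) (Y : Mat) : ofMat (a • Y) = a • ofMat Y := by
  funext i
  fin_cases i <;> simp [ofMat]

/-- Isometries of hyperbolic space are restrictions of Lorentz transformations. -/
theorem exists_lorentz (γ : PSL(2, ℂ)) : ∃ g : R4 ≃L[ℝ] R4,
    (∀ v w, eta (g v) (g w) = eta v w) ∧ ∀ x : Hyp, coe4 (γ • x) = g (coe4 x) := by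
  obtain ⟨A, hA⟩ := psl_smul_eq γ
  have hherm : ∀ v : R4, ((A : Mat) * toMat v * (A : Mat)ᴴ).IsHermitian := fun v =>
    Matrix.isHermitian_mul_mul_conjTranspose _ (toMat_herm v)
  set g : R4 →ₗ[ℝ] R4 :=
    { toFun := fun v => ofMat ((A : Mat) * toMat v * (A : Mat)ᴴ)
      map_add' := fun v w => by
        rw [toMat_add, Matrix.mul_add, Matrix.add_mul, ofMat_add]
      map_smul' := fun a v => by
        rw [RingHom.id_apply, toMat_smul, Matrix.mul_smul, Matrix.smul_mul, ofMat_smul] } with hg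
  have hgv : ∀ v, g v = ofMat ((A : Mat) * toMat v * (A : Mat)ᴴ) := fun v => rfl
  have heta : ∀ v w, eta (g v) (g w) = eta v w := fun v w => by
    rw [hgv, hgv, ← mink_ofMat (hherm v) (hherm w), mink_conj, mink_toMat]
  have hinj : Function.Injective g := by
    rw [injective_iff_map_eq_zero]
    intro v hv
    exact eq_zero_of_eta fun w => by rw [← heta, hv, eta_zero_left]
  refine ⟨(LinearMap.linearEquivOfInjective g hinj rfl).toContinuousLinearEquiv, heta, fun x => ?_⟩
  rw [hA]
  show ofMat ((A • x : Hyp) : Mat) = ofMat ((A : Mat) * toMat (coe4 x) * (A : Mat)ᴴ)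
  rw [sl_smul_coe, toMat_coe4]

namespace LParam

variable {T : Set R4} {x : R4} {X : Plane → R4} {n : R4 → R4}

theorem fderiv_lorentz (h : LParam T x X) (g : R4 ≃L[ℝ] R4) (v : Plane) :
    fderiv ℝ (g ∘ X) 0 v = g (fderiv ℝ X 0 v) := by
  rw [(g.hasFDerivAt.comp (0 : Plane) h.differentiableAt.hasFDerivAt).fderiv]
  rfl

theorem lorentz (h : LParam T x X) (g : R4 ≃L[ℝ] R4) (hT : g '' T = T) :
    LParam T (g x) (g ∘ X) where
  contDiffAt := g.contDiff.contDiffAt.comp (0 : Plane) h.contDiffAt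
  map_zero := by rw [Function.comp_apply, h.map_zero]
  immersion := by
    have : ⇑(fderiv ℝ (g ∘ X) 0) = g ∘ fderiv ℝ X 0 := funext (h.fderiv_lorentz g)
    rw [this]
    exact g.injective.comp h.immersion
  map_nhds := by
    rw [← Filter.map_map, h.map_nhds]
    have := g.toHomeomorph.isEmbedding.map_nhdsWithin_eq T x
    exact this.trans (by congr 1)

/-- An isometry preserving the surface sends the unit normal to ± the unit normal. The second form
changes at most by that sign, which the determinant does not see. -/
theorem ec_lorentz (h : LParam T x X) (hn : LNormal T n) (g : R4 ≃L[ℝ] R4) (hT : g '' T = T)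
    (hg : ∀ v w, eta (g v) (g w) = eta v w) :
    ec (g ∘ X) (n ∘ (g ∘ X)) = ec X (n ∘ X) := by
  have h' := h.lorentz g hT
  have hf : ∀ v w, fst (g ∘ X) v w = fst X v w := fun v w => by
    rw [fst, fst, h.fderiv_lorentz, h.fderiv_lorentz, hg]
  have hgx := hn.sub h'.mem
  have hsm := eq_smul_normal (n := g (n x)) (y := n (g x)) hgx (h'.tangent_zero hn.sub (pb 0))
    (h'.tangent_zero hn.sub (pb 1)) (by rw [hg, hn.tangent _ h.mem]) (hn.tangent _ h'.mem)
    (by rw [h.fderiv_lorentz, hg, h.normal_zero hn]) (by rw [h.fderiv_lorentz, hg, h.normal_zero hn])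
    (h'.normal_zero hn _) (h'.normal_zero hn _) (by rw [hg, hn.unit _ h.mem])
    (indep_of_injective h'.immersion)
  set a := eta (n (g x)) (g (n x)) with ha
  have ha2 : a * a = 1 := by
    have := hn.unit _ h'.mem
    rw [hsm, eta_smul_left, eta_smul_right, hg, hn.unit _ h.mem] at this
    linarith
  have hs : ∀ v w, snd (g ∘ X) (n ∘ (g ∘ X)) v w = a * snd X (n ∘ X) v w := by
    intro v w
    have e1 := h'.height_hess (n (g x)) v w
    have e2 := h.height_hess (a • n x) v w
    -- The same height function, seen from either parametrization; its Hessian gives both second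
    -- forms.
    have e3 : (fun u => -eta (n (g x)) ((g ∘ X) u)) = fun u => -eta (a • n x) (X u) := by
      funext u
      rw [hsm, Function.comp_apply, eta_smul_left, hg, eta_smul_left]
    rw [e3, e2, h'.normal_hess hn, eta_smul_left, h.normal_hess hn] at e1
    linarith
  rw [ec, ec, gram, gram]
  simp only [hf, hs]
  congr 1
  linear_combination (snd X (n ∘ X) (pb 0) (pb 0) * snd X (n ∘ X) (pb 1) (pb 1) -
    snd X (n ∘ X) (pb 0) (pb 1) * snd X (n ∘ X) (pb 1) (pb 0)) * ha2

end LParam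

/-- A uniform lower bound on the extrinsic curvature of surfaces with compact quotient. -/
theorem exists_lt_ec {Γ : Subgroup PSL(2, ℂ)} {S : Set (Mfd Γ)} (hS : IsCompact S)
    (hcl : IsClosed (lift S)) {n : R4 → R4} (hn : LNormal (coe4 '' lift S) n)
    (hp : ∀ x ∈ coe4 '' lift S, ∃ X, LParam (coe4 '' lift S) x X) {c₀ : ℝ}
    (hc : ∀ x ∈ coe4 '' lift S, ∀ X, LParam (coe4 '' lift S) x X → c₀ < LParam.ec X (n ∘ X)) :
    ∃ c, c₀ < c ∧ ∀ x ∈ coe4 '' lift S, ∀ X, LParam (coe4 '' lift S) x X →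
      c < LParam.ec X (n ∘ X) := by
  obtain ⟨C, hC⟩ := exists_height_le hS
  have hK : IsCompact ({y : Hyp | height y ≤ C} ∩ lift S) :=
    (isCompact_height_le C).inter_right hcl
  obtain ⟨c, hc0, hcK⟩ : ∃ c, c₀ < c ∧ ∀ y ∈ {y : Hyp | height y ≤ C} ∩ lift S,
      ∃ X, LParam (coe4 '' lift S) (coe4 y) X ∧ c < LParam.ec X (n ∘ X) := by
    refine hK.induction_on (p := fun s => ∃ c, c₀ < c ∧ ∀ y ∈ s,
      ∃ X, LParam (coe4 '' lift S) (coe4 y) X ∧ c < LParam.ec X (n ∘ X)) ?_ ?_ ?_ ?_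
    · exact ⟨c₀ + 1, by linarith, by simp⟩
    · rintro s t hst ⟨c, h1, h2⟩
      exact ⟨c, h1, fun y hy => h2 y (hst hy)⟩
    · rintro s t ⟨c, h1, h2⟩ ⟨d, k1, k2⟩
      refine ⟨min c d, lt_min h1 k1, fun y hy => ?_⟩
      rcases hy with hy | hy
      · obtain ⟨X, hX, hXc⟩ := h2 y hy
        exact ⟨X, hX, (min_le_left _ _).trans_lt hXc⟩
      · obtain ⟨X, hX, hXc⟩ := k2 y hy
        exact ⟨X, hX, (min_le_right _ _).trans_lt hXc⟩
    · rintro x ⟨-, hx⟩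
      obtain ⟨X, hX⟩ := hp _ (Set.mem_image_of_mem coe4 hx)
      obtain ⟨c, h1, h2⟩ := exists_between (hc _ hX.mem X hX)
      refine ⟨{y | ∃ X, LParam (coe4 '' lift S) (coe4 y) X ∧ c < LParam.ec X (n ∘ X)}, ?_, c, h1,
        fun y hy => hy⟩
      have h3 : {z | ∃ X, LParam (coe4 '' lift S) z X ∧ c < LParam.ec X (n ∘ X)} ∈
          𝓝[coe4 '' lift S] (coe4 x) := by
        rw [← hX.map_nhds]
        exact hX.eventually_lt_ec hn h2
      have h4 : Tendsto coe4 (𝓝[{y : Hyp | height y ≤ C} ∩ lift S] x)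
          (𝓝[coe4 '' lift S] (coe4 x)) :=
        continuous_coe4.continuousWithinAt.tendsto_nhdsWithin
          fun y hy => Set.mem_image_of_mem _ hy.2
      exact h4 h3
  -- The bound on a bounded part of the lift extends to the whole lift by isometries of the group
  -- and independence of the parametrization.
  refine ⟨c, hc0, ?_⟩
  rintro _ ⟨x, hx, rfl⟩ X hX
  obtain ⟨y, hy, hyC⟩ := hC _ hx
  obtain ⟨γ, hγ, rfl⟩ := proj_eq_iff.1 hy
  obtain ⟨g, hg, hgx⟩ := exists_lorentz γ
  have hT : g '' (coe4 '' lift S) = coe4 '' lift S := by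
    rw [Set.image_image]
    ext z
    constructor
    · rintro ⟨w, hw, rfl⟩
      exact ⟨γ • w, (smul_mem_lift hγ).2 hw, hgx w⟩
    · rintro ⟨w, hw, rfl⟩
      exact ⟨γ⁻¹ • w, (smul_mem_lift (Γ.inv_mem hγ)).2 hw, (hgx _).symm.trans (by rw [smul_inv_smul])⟩
  obtain ⟨Y, hY, hYc⟩ := hcK (γ • x) ⟨hyC, (smul_mem_lift hγ).2 hx⟩
  rw [← hX.ec_lorentz hn g hT hg]
  have hX' := hX.lorentz g hT
  rw [← hgx] at hX'
  rwa [hY.ec_eq hn hX']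


/-! ### Extrema of the signed distance -/

section FiberSurface

variable {Γ : Subgroup PSL(2, ℂ)} {F : Type*} [TopologicalSpace F] {φ : F × ℝ ≃ₜ Mfd Γ}
  {S : Set (Mfd Γ)}

theorem IsFiberSurface.isCompact [CompactSpace F] (h : IsFiberSurface φ S) : IsCompact S := by
  obtain ⟨ι, -, rfl, -⟩ := h.homotopic
  exact isCompact_range ι.continuous

theorem IsFiberSurface.nonempty [Nonempty F] (h : IsFiberSurface φ S) : (lift S).Nonempty := by
  obtain ⟨ι, -, rfl, -⟩ := h.homotopic
  obtain ⟨p⟩ := ‹Nonempty F›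
  obtain ⟨y, hy⟩ := proj_surjective (ι p)
  exact ⟨y, p, hy.symm⟩

end FiberSurface

namespace Sides

section Extrema

variable {Γ : Subgroup PSL(2, ℂ)} {S S' : Set (Mfd Γ)} {Up Um : Set Hyp} {n : R4 → R4}
  (h : Sides (lift S) Up Um n) {F : Type*} [TopologicalSpace F] [CompactSpace F] [Nonempty F]

include h

/-- The signed distance is invariant and the lift is compact modulo the group, so it suffices to
optimize over a bounded part. -/
theorem exists_extrema (φ : F × ℝ ≃ₜ Mfd Γ) (hS : IsCompact S) (hS' : IsCompact S')
    (hcl : IsClosed (lift S')) (hne : (lift S').Nonempty) :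
    (∃ q ∈ lift S', ∀ y ∈ lift S', h.sd y ≤ h.sd q) ∧
      ∃ q ∈ lift S', ∀ y ∈ lift S', h.sd q ≤ h.sd y := by
  obtain ⟨C, hC⟩ := exists_height_le hS'
  have hK : IsCompact ({y : Hyp | height y ≤ C} ∩ lift S') :=
    (isCompact_height_le C).inter_right hcl
  have hmove : ∀ y ∈ lift S', ∃ z ∈ {y : Hyp | height y ≤ C} ∩ lift S', h.sd z = h.sd y := by
    intro y hy
    obtain ⟨z, hz, hzC⟩ := hC _ hy
    obtain ⟨γ, hγ, rfl⟩ := proj_eq_iff.1 hz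
    exact ⟨_, ⟨hzC, (smul_mem_lift hγ).2 hy⟩, h.sd_smul φ hS hγ y⟩
  have hKne : ({y : Hyp | height y ≤ C} ∩ lift S').Nonempty := by
    obtain ⟨y, hy⟩ := hne
    obtain ⟨z, hz, -⟩ := hmove y hy
    exact ⟨z, hz⟩
  obtain ⟨q, hq, hmax⟩ := hK.exists_isMaxOn hKne h.continuous_sd.continuousOn
  obtain ⟨p, hp, hmin⟩ := hK.exists_isMinOn hKne h.continuous_sd.continuousOn
  refine ⟨⟨q, hq.2, fun y hy => ?_⟩, p, hp.2, fun y hy => ?_⟩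
  · obtain ⟨z, hz, hzy⟩ := hmove y hy
    rw [← hzy]
    exact hmax hz
  · obtain ⟨z, hz, hzy⟩ := hmove y hy
    rw [← hzy]
    exact hmin hz

end Extrema

/-- With opposite normals, the normal geodesic of the second surface is that of the first one run
backwards. -/
theorem sd_normalExp_of_eq_neg {S S' Up Um : Set Hyp} {n n' : R4 → R4} (h : Sides S Up Um n)
    (hn' : LNormal (coe4 '' S') n') (q : S') (hq : n' (coe4 q) = -h.equiNormal q) (t : ℝ) :
    h.sd (normalExp hn' (q, t)) = h.sd q - t := by
  have : normalExp hn' (q, t) = normalExp h.normal (h.foot q, h.sd q - t) := by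
    apply coe4_injective
    rw [coe4_normalExp, coe4_normalExp]
    simp only
    rw [hq, equiNormal, h.coe4_eq q]
    simp only [zeta, Real.cosh_sub, Real.sinh_sub]
    module
  rw [this, h.sd_normalExp]

section Bounds

variable {Γ : Subgroup PSL(2, ℂ)} {Ωp Ωm : Set Ideal} {S S' : Set (Mfd Γ)}
  {Up Um Up' Um' : Set Hyp} {n : R4 → R4} {ν ν' : Mat → Mat} (h : Sides (lift S) Up Um n)

include h

/-- The region beyond the maximum is connected, misses the second surface and reaches ideal points
of Ω⁻, so it lies in the minus side of that surface. An opposite normal would point into this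
region, whereas the normal points into the plus side. -/
theorem normal_ne_of_max (hΩ : AreTwoComponents (limitSet Γ) Ωp Ωm) (hS : IsCompact S)
    (hS' : IsCompact S') (hν : IsCooriented Ωp Ωm (lift S) Up Um ν)
    (hν' : IsCooriented Ωp Ωm (lift S') Up' Um' ν') {q : Hyp} (hq : q ∈ lift S')
    (hmax : ∀ y ∈ lift S', h.sd y ≤ h.sd q) : n4 ν' (coe4 q) ≠ -h.equiNormal q := by
  intro hneg
  obtain ⟨P, hP⟩ := hΩ.connected_right.nonempty
  have hPL : P ∈ (limitSet Γ)ᶜ := hΩ.union ▸ Or.inr hP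
  have hsub : h.sd ⁻¹' Set.Ioi (h.sd q) ⊆ Um' :=
    h.subset_of_ideal hS hS' (A := Um) (R := |h.sd q|) hPL
      (hν.minus_side (Set.mem_image_of_mem _ hP)) (hν'.minus_side (Set.mem_image_of_mem _ hP))
      hν'.components.symm (h.isPreconnected_sd_preimage isPreconnected_Ioi)
      (Set.disjoint_left.2 fun y hy hyS => not_lt.2 (hmax y hyS) hy)
      (fun y hy hyR => by
        rw [abs_of_pos (h.mem_minus_iff.1 hy)] at hyR
        exact (le_abs_self _).trans_lt hyR)
  obtain ⟨t, ht, ht0⟩ := ((hν'.points_plus q hq).and self_mem_nhdsWithin).exists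
  have h1 := (geod_mem_iff hν'.unitNormal ⟨q, hq⟩ t).1 ht
  have h2 := h.sd_normalExp_of_eq_neg hν'.unitNormal.lNormal ⟨q, hq⟩ hneg (-t)
  refine Set.disjoint_left.1 hν'.components.disjoint h1 (hsub ?_)
  show h.sd q < h.sd _
  rw [h2]
  have : 0 < t := ht0
  linarith

theorem normal_ne_of_min (hΩ : AreTwoComponents (limitSet Γ) Ωp Ωm) (hS : IsCompact S)
    (hS' : IsCompact S') (hν : IsCooriented Ωp Ωm (lift S) Up Um ν)
    (hν' : IsCooriented Ωp Ωm (lift S') Up' Um' ν') {q : Hyp} (hq : q ∈ lift S')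
    (hmin : ∀ y ∈ lift S', h.sd q ≤ h.sd y) : n4 ν' (coe4 q) ≠ -h.equiNormal q := by
  intro hneg
  obtain ⟨P, hP⟩ := hΩ.connected_left.nonempty
  have hPL : P ∈ (limitSet Γ)ᶜ := hΩ.union ▸ Or.inl hP
  have hsub : h.sd ⁻¹' Set.Iio (h.sd q) ⊆ Up' :=
    h.subset_of_ideal hS hS' (A := Up) (R := |h.sd q|) hPL
      (hν.plus_side (Set.mem_image_of_mem _ hP)) (hν'.plus_side (Set.mem_image_of_mem _ hP))
      hν'.components (h.isPreconnected_sd_preimage isPreconnected_Iio)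
      (Set.disjoint_left.2 fun y hy hyS => not_lt.2 (hmin y hyS) hy)
      (fun y hy hyR => by
        rw [abs_of_neg (h.mem_plus_iff.1 hy)] at hyR
        show h.sd y < h.sd q
        linarith [neg_abs_le (h.sd q)])
  obtain ⟨t, ht, ht0⟩ := ((hν'.points_minus q hq).and self_mem_nhdsWithin).exists
  have h1 := (geod_mem_iff hν'.unitNormal ⟨q, hq⟩ (-t)).1 ht
  have h2 := h.sd_normalExp_of_eq_neg hν'.unitNormal.lNormal ⟨q, hq⟩ hneg t
  rw [neg_neg] at h1
  refine Set.disjoint_left.1 hν'.components.disjoint (hsub ?_) h1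
  show h.sd _ < h.sd q
  rw [h2]
  have : 0 < t := ht0
  linarith

end Bounds

end Sides

/-! ### Curvature bounds -/

/-- The mean curvatures of the equidistant surfaces have uniform bounds. -/
theorem exists_curvatureBounds {Γ : Subgroup PSL(2, ℂ)} {S : Set (Mfd Γ)} {ν : Mat → Mat} {H : ℝ}
    (hS : IsCompact S) (hcl : IsClosed (lift S)) (hne : (lift S).Nonempty)
    (hemb : IsEmbeddedSurface (lift S)) (hν : IsUnitNormal (lift S) ν)
    (hH : HasConstMeanCurvature (lift S) ν H) (hsmall : HasSmallPrincipalCurvatures (lift S) ν) :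
    ∃ fm fp : ℝ → ℝ, AreCurvatureBounds (lift S) ν H fm fp := by
  have hL := LSurface.of hemb hν hH
  have hsc : ∀ x ∈ coe4 '' lift S, ∀ X, LParam (coe4 '' lift S) x X →
      SmallCurv H (LParam.ec X (n4 ν ∘ X)) := fun x hx X hX => by
    have := hsmall.smallCurv hν hx hX
    rwa [hL.mean x hx X hX] at this
  -- The two inequalities 1 ± 2H + K > 0 say exactly that K > 2|H| - 1. A uniform gap above this
  -- constant keeps the lower bound c itself admissible.
  obtain ⟨c, hc0, hc⟩ := exists_lt_ec hS hcl hν.lNormal hL.param (c₀ := 2 * |H| - 1)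
    fun x hx X hX => by
      have := hsc x hx X hX
      rcases abs_cases H with ⟨h1, -⟩ | ⟨h1, -⟩ <;> rw [h1] <;> linarith [this.sub_pos, this.add_pos]
  obtain ⟨x, hx⟩ := hne
  obtain ⟨X, hX⟩ := hL.param _ (Set.mem_image_of_mem coe4 hx)
  have h0 := hsc _ hX.mem X hX
  have hm : SmallCurv H c := ⟨h0.lower, h0.upper, (hc _ hX.mem X hX).le.trans h0.le_sq,
    by linarith [le_abs_self H], by linarith [neg_abs_le H]⟩
  have hp : SmallCurv H (H ^ 2) := ⟨h0.lower, h0.upper, le_rfl, by nlinarith [h0.upper],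
    by nlinarith [h0.lower]⟩
  refine ⟨curvFun H c, curvFun H (H ^ 2), hm.differentiable, hp.differentiable, curvFun_zero _ _,
    curvFun_zero _ _, hm.deriv_pos, hp.deriv_pos, fun r y hy Y hY => ?_⟩
  have hY' := hY.lParam hy
  rw [meanCurvature_equidist hν hsmall hy hY, hL.mean _ hY'.mem _ hY']
  exact (hsc _ hY'.mem _ hY').mem_uIcc hm (hc _ hY'.mem _ hY').le r

theorem AreCurvatureBounds.curvFun_mem {S : Set Hyp} {ν : Mat → Mat} {H : ℝ} {fm fp : ℝ → ℝ}
    (h : AreCurvatureBounds S ν H fm fp) (hν : IsUnitNormal S ν)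
    (hsmall : HasSmallPrincipalCurvatures S ν) {x : Hyp} (hx : x ∈ S) {X : Plane → R4}
    (hX : LParam (coe4 '' S) (coe4 x) X) (r : ℝ) :
    curvFun (LParam.mc X (n4 ν ∘ X)) (LParam.ec X (n4 ν ∘ X)) r ∈ Set.uIcc (fm r) (fp r) := by
  have h1 := h.between r x hx _ hX.isLocalParam
  rwa [meanCurvature_equidist hν hsmall hx hX.isLocalParam, ofMat_comp_toMat_comp] at h1

theorem le_extInv {f : ℝ → ℝ} {s y : ℝ} (h : f s ≤ y) : (s : EReal) ≤ extInv f y :=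
  le_sSup ⟨s, h, rfl⟩

theorem extInv_le {f : ℝ → ℝ} (hf : StrictMono f) {s y : ℝ} (h : y ≤ f s) :
    extInv f y ≤ (s : EReal) := by
  refine sSup_le ?_
  rintro _ ⟨r, hr, rfl⟩
  have hr' : f r ≤ y := hr
  exact EReal.coe_le_coe_iff.2 (hf.le_iff_le.1 (hr'.trans h))

/-- Which of the two functions is larger depends on the point, so each end is controlled by the
maximum or minimum and a case distinction. -/
theorem mem_uIcc_extInv {fm fp : ℝ → ℝ} (hm : StrictMono fm) (hp : StrictMono fp) {a b s y : ℝ}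
    (ha : y ≤ max (fm a) (fp a)) (hb : min (fm b) (fp b) ≤ y) (has : a ≤ s) (hsb : s ≤ b) :
    (s : EReal) ∈ Set.uIcc (extInv fp y) (extInv fm y) := by
  constructor
  · rcases le_max_iff.1 ha with h | h
    · exact inf_le_right.trans (extInv_le hm (h.trans (hm.monotone has)))
    · exact inf_le_left.trans (extInv_le hp (h.trans (hp.monotone has)))
  · rcases min_le_iff.1 hb with h | h
    · exact (le_extInv ((hm.monotone hsb).trans h)).trans le_sup_right
    · exact (le_extInv ((hp.monotone hsb).trans h)).trans le_sup_left

end QuasiFuchsian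

/-! ### Conclusion: comparison at the farthest points on either side -/

theorem mainTheorem6
    (F : Type*) [TopologicalSpace F] [T2Space F] [CompactSpace F] [ConnectedSpace F]
    [ChartedSpace (EuclideanSpace ℝ (Fin 2)) F]
    (Γ : Subgroup (Matrix.ProjectiveSpecialLinearGroup (Fin 2) ℂ))
    (hΓ : QuasiFuchsian.IsQuasiFuchsian Γ)
    (φ : F × ℝ ≃ₜ QuasiFuchsian.Mfd Γ)
    (Ωp Ωm : Set QuasiFuchsian.Ideal)
    (hΩ : QuasiFuchsian.AreTwoComponents (QuasiFuchsian.limitSet Γ) Ωp Ωm)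
    (S S' : Set (QuasiFuchsian.Mfd Γ))
    (hS : QuasiFuchsian.IsFiberSurface φ S) (hS' : QuasiFuchsian.IsFiberSurface φ S')
    (Up Um Up' Um' : Set QuasiFuchsian.Hyp) (ν ν' : QuasiFuchsian.Mat → QuasiFuchsian.Mat)
    (hν : QuasiFuchsian.IsCooriented Ωp Ωm (QuasiFuchsian.lift S) Up Um ν)
    (hν' : QuasiFuchsian.IsCooriented Ωp Ωm (QuasiFuchsian.lift S') Up' Um' ν')
    (H H' : ℝ) (hne : H ≠ H')
    (hH : QuasiFuchsian.HasConstMeanCurvature (QuasiFuchsian.lift S) ν H)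
    (hH' : QuasiFuchsian.HasConstMeanCurvature (QuasiFuchsian.lift S') ν' H')
    (hsmall : QuasiFuchsian.HasSmallPrincipalCurvatures (QuasiFuchsian.lift S) ν) :
    Disjoint S S' ∧
    (∃ fm fp : ℝ → ℝ, QuasiFuchsian.AreCurvatureBounds (QuasiFuchsian.lift S) ν H fm fp) ∧
    ∀ fm fp : ℝ → ℝ, QuasiFuchsian.AreCurvatureBounds (QuasiFuchsian.lift S) ν H fm fp →
      ∀ q ∈ S', (QuasiFuchsian.signedDist S Up q : EReal) ∈
        Set.uIcc (QuasiFuchsian.extInv fp H') (QuasiFuchsian.extInv fm H') := by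
  open QuasiFuchsian in
  have cS := hS.isCompact
  have cS' := hS'.isCompact
  have h := hν.sides hS.nonempty hS.embedded hsmall
  have hL := LSurface.of hS.embedded hν.unitNormal hH
  have hL' := LSurface.of hS'.embedded hν'.unitNormal hH'
  have hsc := fun x hx X hX => hsmall.smallCurv hν.unitNormal (x := x) hx (X := X) hX
  obtain ⟨⟨q₁, hq₁, hmax⟩, q₀, hq₀, hmin⟩ := h.exists_extrema φ cS cS' hν'.components.isClosed
    hS'.nonempty
  obtain ⟨X₁, hX₁, hc₁, -⟩ := h.exists_mc_comparison hL' hq₁ (Or.inl hmax)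
    (h.normal_ne_of_max hΩ cS cS' hν hν' hq₁ hmax) hsc
  obtain ⟨X₀, hX₀, -, hc₀⟩ := h.exists_mc_comparison hL' hq₀ (Or.inr hmin)
    (h.normal_ne_of_min hΩ cS cS' hν hν' hq₀ hmin) hsc
  replace hc₁ := hc₁ hmax
  replace hc₀ := hc₀ hmin
  refine ⟨?_, exists_curvatureBounds cS hν.components.isClosed hS.nonempty hS.embedded
    hν.unitNormal hH hsmall, fun fm fp hf q hq => ?_⟩
  · rw [Set.disjoint_left]
    intro q hqS hqS'
    obtain ⟨y, rfl⟩ := proj_surjective q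
    have hy0 : h.sd y = 0 := (h.sd_eq_zero_iff y).2 hqS
    have s₁ := hsc _ hX₁.mem X₁ hX₁
    have s₀ := hsc _ hX₀.mem X₀ hX₀
    have z₁ : curvFun (LParam.mc X₁ (n4 ν ∘ X₁)) (LParam.ec X₁ (n4 ν ∘ X₁)) 0 = H := by
      rw [curvFun_zero, hL.mean _ hX₁.mem X₁ hX₁]
    have z₀ : curvFun (LParam.mc X₀ (n4 ν ∘ X₀)) (LParam.ec X₀ (n4 ν ∘ X₀)) 0 = H := by
      rw [curvFun_zero, hL.mean _ hX₀.mem X₀ hX₀]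
    -- A common point has distance 0, so the maximum is nonnegative and the minimum nonpositive.
    -- Monotonicity in the distance then gives H ≤ H' at `q₁` and H' ≤ H at `q₀`.
    have m₁ : 0 ≤ h.sd q₁ := hy0 ▸ hmax y hqS'
    have m₀ : h.sd q₀ ≤ 0 := hy0 ▸ hmin y hqS'
    have e₁ := s₁.strictMono.monotone m₁
    have e₀ := s₀.strictMono.monotone m₀
    rw [z₁] at e₁
    rw [z₀] at e₀
    exact hne (le_antisymm (e₁.trans hc₁) (hc₀.trans e₀))
  · obtain ⟨y, rfl⟩ := proj_surjective q
    rw [h.signedDist_proj φ cS]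
    -- The two extremal points may have different feet, hence different extrinsic curvatures; any
    -- admissible pair of bounds covers both.
    have b₁ := hf.curvFun_mem hν.unitNormal hsmall (h.foot q₁).2 hX₁ (h.sd q₁)
    have b₀ := hf.curvFun_mem hν.unitNormal hsmall (h.foot q₀).2 hX₀ (h.sd q₀)
    exact mem_uIcc_extInv (strictMono_of_deriv_pos hf.deriv_minus)
      (strictMono_of_deriv_pos hf.deriv_plus) (hc₀.trans b₀.2) (b₁.1.trans hc₁) (hmin y hq)
      (hmax y hq)
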